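/- Let $L>0$, $I=(0,L)$ and $0<k_1\le k_2$. For $m\in\mathbb N$ and $q\in[1,\infty]$ let $W^{m,q}(I)$ be the Sobolev space with norm $\|u\|_{W^{m,q}}=\big(\sum_{i=0}^m\|u^{(i)}\|_q^q\big)^{1/q}$ (maximum of the $\|u^{(i)}\|_\infty$ if $q=\infty$), and $H^m(I)=W^{m,2}(I)$. Let $\varepsilon\in(0,1)$ and let $k\in L^\infty(I)$ satisfy $k_1\le k\le k_2$ a.e. in $I$. For $(f,g)\in L^2(I)\times L^2(I)$, a weak solution of $$ku+\varepsilon u''''=\varepsilon f'+g\ \text{ in } I,\qquad u''=0,\ u'''=f\ \text{ on }\partial I$$ is a function $u\in H^2(I)$ such that $$\int_I kuv\,ds+\varepsilon\int_I u''v''\,ds=-\varepsilon\int_I fv'\,ds+\int_I gv\,ds\qquad\text{for all } v\in H^2(I).$$ There is exactly one weak solution for each such $(f,g)$; denote it by $A_\varepsilon(f,g)$, and put $A_{1,\varepsilon}f=A_\varepsilon(f,0)$, $A_{2,\varepsilon}g=A_\varepsilon(0,g)$. Moreover there is a constant $K>0$ depending only on $k_1,k_2,L$ (in particular not on $k$,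 $\varepsilon$, $q$, $f$, $g$) such that (i) and (ii) hold: (i) For all $(f,g)\in L^2(I)\times L^2(I)$, $u=A_\varepsilon(f,g)$ satisfies $$\|u^{(j)}\|_2\le K\varepsilon^{-j/4}\big(\varepsilon^{3/4}\|f\|_2+\|g\|_2\big),\qquad j\in\{0,1,2\}.$$ (ii) For all $q\in[2,\infty]$, $(f,g)\in W^{1,q}(I)\times L^q(I)$ and every integer $0\le j\le 4$, the functions $A_{1,\varepsilon}f$ and $A_{2,\varepsilon}g$ belong to $W^{j,q}(I)$ and $$\|A_{1,\varepsilon}f\|_{W^{j,q}}\le K\varepsilon^{(3-j)/4}\big(\|f\|_q+\varepsilon^{1/4}\|f'\|_q\big),\qquad \|A_{2,\varepsilon}g\|_{W^{j,q}}\le K\varepsilon^{-j/4}\|g\|_q.$$ (iii) For every $K_1>0$ there is a constant $\tilde K>0$ depending only on $k_1,k_2,K_1,L$ such that, if in addition $k\in H^2(I)$ and $\|k\|_{H^2(I)}\le K_1$, then $A_{2,\varepsilon}$ maps $H^2(I)$ into $H^4(I)$ as a bounded linear operator, and $$\|A_{2,\varepsilon}\|_{\mathcal L(H^2(I),H^{2+j}(I))}\le\tilde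 K\varepsilon^{-j/4},\qquad j\in\{0,1,2\}.$$ -/

import Mathlib

open MeasureTheory Set
open scoped ENNReal ContDiff

noncomputable section

/-- Lebesgue measure on the open interval `I = (0, L)`. -/
abbrev intervalMeasure (L : ℝ) : Measure ℝ := volume.restrict (Ioo 0 L)

/-- The Lebesgue space `L^q(I)`, `I = (0, L)`. -/
abbrev LebI (L : ℝ) (q : ℝ≥0∞) : Type := Lp ℝ q (intervalMeasure L)

/-- `v` is the weak (distributional) derivative of `u` on `I = (0, L)`:
`∫_I u φ' = - ∫_I v φ` for every test function `φ ∈ C_c^∞(I)`. -/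
def IsWeakDeriv (L : ℝ) (u v : ℝ → ℝ) : Prop :=
  ∀ φ : ℝ → ℝ, ContDiff ℝ ∞ φ → HasCompactSupport φ → tsupport φ ⊆ Ioo 0 L →
    ∫ s in Ioo 0 L, u s * deriv φ s = - ∫ s in Ioo 0 L, v s * φ s

/-- A product of an `L^q` function on `I` (`q ≥ 1`) and a continuous compactly supported function
is integrable on `I`. -/
theorem integrable_mul_test {L : ℝ} {q : ℝ≥0∞} [hq : Fact (1 ≤ q)] (u : LebI L q)
    {ψ : ℝ → ℝ} (hψ : Continuous ψ) (hc : HasCompactSupport ψ) :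
    Integrable (fun s => u s * ψ s) (intervalMeasure L) := by
  obtain ⟨C, hC⟩ := hψ.bounded_above_of_compact_support hc
  exact ((Lp.memLp u).integrable hq.out).mul_bdd (c := C) hψ.aestronglyMeasurable
    (Filter.Eventually.of_forall hC)

/-- The Sobolev space `W^{m,q}(I)`, `I = (0, L)`. An element `u` is recorded as the tuple
`(u, u', …, u^{(m)})` of elements of `L^q(I)` in which each entry is the weak derivative of the
preceding one (so the whole tuple is determined by its entry `0`). The norm is the one inherited
from the `ℓ^q` product, `‖u‖ = (∑_{i ≤ m} ‖u^{(i)}‖_q^q)^{1/q}`, respectively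
`max_{i ≤ m} ‖u^{(i)}‖_∞` when `q = ∞`. -/
def SobolevI (L : ℝ) (m : ℕ) (q : ℝ≥0∞) [Fact (1 ≤ q)] :
    Submodule ℝ (PiLp q (fun _ : Fin (m + 1) => LebI L q)) where
  carrier := {D | ∀ i : Fin m, IsWeakDeriv L (D i.castSucc) (D i.succ)}
  zero_mem' := by
    intro i φ _ _ _
    have h : (((0 : LebI L q) : ℝ → ℝ)) =ᵐ[intervalMeasure L] 0 := Lp.coeFn_zero _ _ _
    have e (ψ : ℝ → ℝ) : ∫ s in Ioo 0 L, ((0 : LebI L q) : ℝ → ℝ) s * ψ s = 0 := by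
      rw [integral_congr_ae (g := fun _ => (0 : ℝ))]
      · simp
      · filter_upwards [h] with s hs
        rw [hs, Pi.zero_apply, zero_mul]
    simp only [PiLp.zero_apply]
    rw [e, e, neg_zero]
  add_mem' := by
    intro D E hD hE i φ h1 h2 h3
    have key (a b : LebI L q) {ψ : ℝ → ℝ} (hψ : Continuous ψ) (hc : HasCompactSupport ψ) :
        ∫ s in Ioo 0 L, ((a + b : LebI L q) : ℝ → ℝ) s * ψ s
          = (∫ s in Ioo 0 L, a s * ψ s) + ∫ s in Ioo 0 L, b s * ψ s := by
      rw [← integral_add (integrable_mul_test a hψ hc) (integrable_mul_test b hψ hc)]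
      refine integral_congr_ae ?_
      filter_upwards [Lp.coeFn_add a b] with s hs
      rw [hs, Pi.add_apply, add_mul]
    have hd : Continuous (deriv φ) := h1.continuous_deriv (by simp)
    simp only [PiLp.add_apply]
    rw [key _ _ hd h2.deriv, key _ _ h1.continuous h2, hD i φ h1 h2 h3, hE i φ h1 h2 h3]
    ring
  smul_mem' := by
    intro c D hD i φ h1 h2 h3
    have key (a : LebI L q) (ψ : ℝ → ℝ) :
        ∫ s in Ioo 0 L, ((c • a : LebI L q) : ℝ → ℝ) s * ψ s = c * ∫ s in Ioo 0 L, a s * ψ s := by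
      rw [← integral_const_mul]
      refine integral_congr_ae ?_
      filter_upwards [Lp.coeFn_smul c a] with s hs
      rw [hs, Pi.smul_apply, smul_eq_mul, mul_assoc]
    simp only [PiLp.smul_apply]
    rw [key, key, hD i φ h1 h2 h3]
    ring

/-- The weak derivative `u^{(i)} ∈ L^q(I)`, `0 ≤ i ≤ m`, of `u ∈ W^{m,q}(I)`; `weakDer u 0` is `u`
itself as an element of `L^q(I)`. -/
def weakDer {L : ℝ} {m : ℕ} {q : ℝ≥0∞} [Fact (1 ≤ q)] (u : SobolevI L m q)
    (i : Fin (m + 1)) : LebI L q :=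
  u.1 i

/-- The inclusion `L^q(I) ⊆ L^2(I)` for `q ≥ 2`. -/
def LebI.toL2 {L : ℝ} {q : ℝ≥0∞} (hq : 2 ≤ q) (f : LebI L q) : LebI L 2 :=
  ((Lp.memLp f).mono_exponent hq).toLp f

/-- `u ∈ H²(I)` is a weak solution of `k u + ε u'''' = ε f' + g` in `I`, `u'' = 0`, `u''' = f` on
`∂I`, for data `f, g ∈ L²(I)`:
`∫ k u v + ε ∫ u'' v'' = - ε ∫ f v' + ∫ g v` for all `v ∈ H²(I)`. -/
def IsWeakSolution (L : ℝ) (k : ℝ → ℝ) (ε : ℝ) (f g : LebI L 2) (u : SobolevI L 2 2) : Prop :=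
  ∀ v : SobolevI L 2 2,
    (∫ s in Ioo 0 L, k s * (weakDer u 0) s * (weakDer v 0) s)
        + ε * (∫ s in Ioo 0 L, (weakDer u 2) s * (weakDer v 2) s)
      = - ε * (∫ s in Ioo 0 L, f s * (weakDer v 1) s) + ∫ s in Ioo 0 L, g s * (weakDer v 0) s

/-- The resolvent operator `A_ε : L²(I) × L²(I) → H²(I)`, mapping `(f, g)` to the weak solution. -/
def resolventOp (L : ℝ) (k : ℝ → ℝ) (ε : ℝ) (f g : LebI L 2) : SobolevI L 2 2 :=
  Classical.epsilon (IsWeakSolution L k ε f g)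

/-- `A_{1,ε} f = A_ε(f, 0)`. -/
def resolventOp₁ (L : ℝ) (k : ℝ → ℝ) (ε : ℝ) (f : LebI L 2) : SobolevI L 2 2 :=
  resolventOp L k ε f 0

/-- `A_{2,ε} g = A_ε(0, g)`. -/
def resolventOp₂ (L : ℝ) (k : ℝ → ℝ) (ε : ℝ) (g : LebI L 2) : SobolevI L 2 2 :=
  resolventOp L k ε 0 g

/-- The standing assumption on the coefficient: `k ∈ L^∞(I)` and `k₁ ≤ k ≤ k₂` almost everywhere
on `I` (boundedness follows from the two inequalities). -/
def AdmissibleCoeff (L k₁ k₂ : ℝ) (k : ℝ → ℝ) : Prop :=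
  AEStronglyMeasurable k (intervalMeasure L) ∧ ∀ᵐ s ∂(intervalMeasure L), k₁ ≤ k s ∧ k s ≤ k₂

end

/-! Put δ = ε^{1/4}, so that every estimate becomes polynomial in δ. The engine is a weighted energy
estimate, `IsWeakSolution.weighted_energy`. Let ρ > 0 satisfy |ρ'| ≤ τρ/δ and |ρ''| ≤ τρ/δ². Since
every H² function is admissible, the weak formulation may be tested with ρu without any condition at
the end points. This gives ∫ρ(ku² + δ⁴u''²) up to data terms and commutators of size τ∫ρ(u² + δ²u'²
+ δ⁴u''²). The u' term is controlled by the other two through a weighted interpolation inequality at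
scale δ (`IsSlowWeight.integral_deriv_sq_le`), so a small τ depending only on k₁ and L absorbs all
commutators. The coefficient enters only through its bounds, which is why no constant sees k itself.

Taking ρ = 1 gives (i) and uniqueness; existence is Lax–Milgram.

For (ii), take ρ = ρ_x with ρ_x(x) = 1 and decay on scale δ away from x. The energy estimate and a
pointwise form of the interpolation (`IsSlowWeight.pointwise_le`) give, for i ≤ 3,
δ^{2i}|u^{(i)}(x)|² ≤ (C/δ)∫ρ_x G² with G = |g| + δ³|f| + δ⁴|f'| (`IsStrongSolution.pointwise`).
Orders 2 and 3 come from interpolating u'' against u'''', which the equation supplies. The kernel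
ρ_x(s)/δ has mass bounded in each variable, so a Schur test (`eLpNorm_le_of_sq_le_lintegral`) turns
this into L^q bounds for all q in [2,∞] with one constant. Order 4 is read off the equation. Neither
a Green function nor interpolation between L^q spaces is involved.

For (iii), write g = kP with P = g/k in H² and test with u − P. This yields ∫k(u−P)² +
δ⁴∫u''(u''−P'') = 0, so u'' is bounded by P'' without loss, and u − P is of order δ² in L². Then
δ⁴u'''' = k(P−u) costs only δ^{-2}, and interpolation gives δ^{-1} for u'''. Linearity of the
solution operator follows from uniqueness. -/

/-- `F` is a primitive on `[a, b]`, `a ≤ b`, of the integrable function `f`. -/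
structure IsPrimitiveOn (F f : ℝ → ℝ) (a b : ℝ) : Prop where
  le : a ≤ b
  intervalIntegrable : IntervalIntegrable f volume a b
  eq : ∀ t ∈ Icc a b, F t = F a + ∫ s in a..t, f s

/-! ### Calculus of primitives of integrable functions -/

namespace IsPrimitiveOn

variable {F f G g : ℝ → ℝ} {a b : ℝ}

theorem intervalIntegrable_sub (h : IsPrimitiveOn F f a b) {s t : ℝ} (hs : s ∈ Icc a b)
    (ht : t ∈ Icc a b) : IntervalIntegrable f volume s t :=
  h.intervalIntegrable.mono_set (uIcc_subset_uIcc (Icc_subset_uIcc hs) (Icc_subset_uIcc ht))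

theorem sub_eq (h : IsPrimitiveOn F f a b) {s t : ℝ} (hs : s ∈ Icc a b) (ht : t ∈ Icc a b) :
    F t - F s = ∫ x in s..t, f x := by
  have hab : a ∈ Icc a b := ⟨le_rfl, hs.1.trans hs.2⟩
  rw [h.eq t ht, h.eq s hs, ← intervalIntegral.integral_interval_sub_left
    (h.intervalIntegrable_sub hab ht) (h.intervalIntegrable_sub hab hs)]
  ring

theorem mono (h : IsPrimitiveOn F f a b) {c d : ℝ} (hac : a ≤ c) (hcd : c ≤ d) (hdb : d ≤ b) :
    IsPrimitiveOn F f c d := by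
  have hc : c ∈ Icc a b := ⟨hac, hcd.trans hdb⟩
  refine ⟨hcd, h.intervalIntegrable_sub hc ⟨hac.trans hcd, hdb⟩, fun t ht => ?_⟩
  rw [← h.sub_eq hc ⟨hac.trans ht.1, ht.2.trans hdb⟩]
  ring

theorem continuousOn (h : IsPrimitiveOn F f a b) : ContinuousOn F (Icc a b) := by
  have h1 : ContinuousOn (fun t => F a + ∫ s in a..t, f s) (Icc a b) := by
    refine continuousOn_const.add ?_
    have := intervalIntegral.continuousOn_primitive_interval' h.intervalIntegrable left_mem_uIcc
    rwa [uIcc_of_le h.le] at this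
  exact h1.congr h.eq

theorem congr_ae (h : IsPrimitiveOn F f a b)
    (hfg : f =ᵐ[volume.restrict (Ioo a b)] g) : IsPrimitiveOn F g a b := by
  have hfg' : f =ᵐ[volume.restrict (Ioc a b)] g := by
    rwa [← Measure.restrict_congr_set Ioo_ae_eq_Ioc]
  refine ⟨h.le, h.intervalIntegrable.congr_ae (by rwa [uIoc_of_le h.le]), fun t ht => ?_⟩
  rw [h.eq t ht]
  congr 1
  refine intervalIntegral.integral_congr_ae_restrict ?_
  rw [uIoc_of_le ht.1]
  exact ae_restrict_of_ae_restrict_of_subset (Ioc_subset_Ioc_right ht.2) hfg'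

theorem integral_eq (h : IsPrimitiveOn F f a b) : ∫ x in a..b, f x = F b - F a :=
  (h.sub_eq (left_mem_Icc.2 h.le) (right_mem_Icc.2 h.le)).symm

theorem of_hasDerivAt (hab : a ≤ b) (h : ∀ x, HasDerivAt F (f x) x) (hf : Continuous f) :
    IsPrimitiveOn F f a b :=
  ⟨hab, hf.intervalIntegrable _ _, fun t _ => by
    rw [intervalIntegral.integral_eq_sub_of_hasDerivAt (fun x _ => h x)
      (hf.intervalIntegrable _ _)]; ring⟩

theorem of_intervalIntegrable (hab : a ≤ b) (hf : IntervalIntegrable f volume a b) :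
    IsPrimitiveOn (fun t => ∫ s in a..t, f s) f a b :=
  ⟨hab, hf, fun t _ => by simp⟩

theorem add (h : IsPrimitiveOn F f a b) (h' : IsPrimitiveOn G g a b) :
    IsPrimitiveOn (fun t => F t + G t) (fun t => f t + g t) a b :=
  ⟨h.le, h.intervalIntegrable.add h'.intervalIntegrable, fun t ht => by
    have ha : a ∈ Icc a b := ⟨le_rfl, ht.1.trans ht.2⟩
    rw [intervalIntegral.integral_add (h.intervalIntegrable_sub ha ht)
      (h'.intervalIntegrable_sub ha ht), h.eq t ht, h'.eq t ht]
    ring⟩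

theorem const_mul (h : IsPrimitiveOn F f a b) (c : ℝ) :
    IsPrimitiveOn (fun t => c * F t) (fun t => c * f t) a b :=
  ⟨h.le, h.intervalIntegrable.const_mul c, fun t ht => by
    rw [intervalIntegral.integral_const_mul, h.eq t ht]
    ring⟩

theorem const (hab : a ≤ b) (c : ℝ) : IsPrimitiveOn (fun _ => c) (fun _ => 0) a b :=
  of_hasDerivAt hab (fun x => hasDerivAt_const x c) continuous_const

theorem sub (h : IsPrimitiveOn F f a b) (h' : IsPrimitiveOn G g a b) :
    IsPrimitiveOn (fun t => F t - G t) (fun t => f t - g t) a b := by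
  simpa [sub_eq_add_neg] using h.add (h'.const_mul (-1))

/-- On [a, b] the functions agree with indefinite integrals, which are absolutely continuous and
have the integrands as a.e. derivatives, so integration by parts for absolutely continuous functions
applies. Nothing is known of `F` and `G` outside [a, b], hence the replacements `F'` and `G'`. -/
theorem integral_mul_aux (h : IsPrimitiveOn F f a b) (h' : IsPrimitiveOn G g a b) :
    ∫ x in a..b, (f x * G x + F x * g x) = F b * G b - F a * G a := by
  have hab := h.le
  have hi := h.intervalIntegrable
  have hi' := h'.intervalIntegrable
  set F' : ℝ → ℝ := fun t => F a + ∫ s in a..t, f s with hF'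
  set G' : ℝ → ℝ := fun t => G a + ∫ s in a..t, g s with hG'
  have ha : a ∈ uIcc a b := left_mem_uIcc
  have cF : AbsolutelyContinuousOnInterval F' a b :=
    (AbsolutelyContinuousOnInterval.fun_add
      (LipschitzWith.const (F a)).lipschitzOnWith.absolutelyContinuousOnInterval
      (hi.absolutelyContinuousOnInterval_intervalIntegral ha))
  have cG : AbsolutelyContinuousOnInterval G' a b :=
    (AbsolutelyContinuousOnInterval.fun_add
      (LipschitzWith.const (G a)).lipschitzOnWith.absolutelyContinuousOnInterval
      (hi'.absolutelyContinuousOnInterval_intervalIntegral ha))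
  rw [h.eq b (right_mem_Icc.2 hab), h'.eq b (right_mem_Icc.2 hab)]
  have hFa : F a = F' a := by simp [hF']
  have hGa : G a = G' a := by simp [hG']
  conv_rhs => rw [hFa, hGa]
  have key := cF.integral_deriv_mul_eq_sub cG
  rw [hF', hG'] at key ⊢
  simp only [intervalIntegral.integral_same, add_zero] at key ⊢
  rw [← key]
  refine intervalIntegral.integral_congr_ae ?_
  filter_upwards [hi.ae_hasDerivAt_integral, hi'.ae_hasDerivAt_integral] with x hx hx' hxm
  have hxc : x ∈ uIcc a b := uIoc_subset_uIcc hxm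
  have e1 : deriv (fun t => F a + ∫ s in a..t, f s) x = f x :=
    ((hx hxc a ha).const_add _).deriv
  have e2 : deriv (fun t => G a + ∫ s in a..t, g s) x = g x :=
    ((hx' hxc a ha).const_add _).deriv
  rw [uIcc_of_le hab] at hxc
  rw [e1, e2, h.eq x hxc, h'.eq x hxc]

/-- The product rule. -/
theorem mul (h : IsPrimitiveOn F f a b) (h' : IsPrimitiveOn G g a b) :
    IsPrimitiveOn (fun t => F t * G t) (fun t => f t * G t + F t * g t) a b := by
  refine ⟨h.le, ?_, fun t ht => ?_⟩
  · refine (h.intervalIntegrable.mul_continuousOn ?_).add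
      (h'.intervalIntegrable.continuousOn_mul ?_)
    · rw [uIcc_of_le h.le]; exact h'.continuousOn
    · rw [uIcc_of_le h.le]; exact h.continuousOn
  · rw [integral_mul_aux (h.mono le_rfl ht.1 ht.2) (h'.mono le_rfl ht.1 ht.2)]
    ring

/-- Integration by parts. -/
theorem integral_mul_eq (h : IsPrimitiveOn F f a b) (h' : IsPrimitiveOn G g a b) :
    ∫ x in a..b, F x * g x = F b * G b - F a * G a - ∫ x in a..b, f x * G x := by
  rw [← (h.mul h').integral_eq, intervalIntegral.integral_add]
  · ring
  · refine h.intervalIntegrable.mul_continuousOn ?_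
    rw [uIcc_of_le h.le]; exact h'.continuousOn
  · refine h'.intervalIntegrable.continuousOn_mul ?_
    rw [uIcc_of_le h.le]; exact h.continuousOn

end IsPrimitiveOn

/-! ### Weak derivatives and primitives -/

theorem setIntegral_Ioo_eq {a b : ℝ} (hab : a ≤ b) (f : ℝ → ℝ) :
    ∫ s in Ioo a b, f s = ∫ s in a..b, f s := by
  rw [intervalIntegral.integral_of_le hab, integral_Ioc_eq_integral_Ioo]

theorem IsPrimitiveOn.isWeakDeriv {L : ℝ} {U V : ℝ → ℝ} (h : IsPrimitiveOn U V 0 L) :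
    IsWeakDeriv L U V := by
  intro φ h1 _ h3
  have hd : IsPrimitiveOn φ (deriv φ) 0 L :=
    IsPrimitiveOn.of_hasDerivAt h.le
      (fun x => (h1.differentiable (by simp) x).hasDerivAt) (h1.continuous_deriv (by simp))
  have h0 : ∀ x, x ∉ Ioo 0 L → φ x = 0 := fun x hx =>
    image_eq_zero_of_notMem_tsupport fun hx' => hx (h3 hx')
  rw [setIntegral_Ioo_eq h.le, setIntegral_Ioo_eq h.le, h.integral_mul_eq hd,
    h0 0 (by simp), h0 L (by simp)]
  ring

theorem IsWeakDeriv.congr_ae {L : ℝ} {u v u' v' : ℝ → ℝ} (h : IsWeakDeriv L u v)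
    (hu : u =ᵐ[intervalMeasure L] u') (hv : v =ᵐ[intervalMeasure L] v') :
    IsWeakDeriv L u' v' := by
  intro φ h1 h2 h3
  have e1 : ∫ s in Ioo 0 L, u' s * deriv φ s = ∫ s in Ioo 0 L, u s * deriv φ s :=
    integral_congr_ae (by filter_upwards [hu] with s hs; rw [hs])
  have e2 : ∫ s in Ioo 0 L, v' s * φ s = ∫ s in Ioo 0 L, v s * φ s :=
    integral_congr_ae (by filter_upwards [hv] with s hs; rw [hs])
  rw [e1, e2, h φ h1 h2 h3]

/-- The fundamental lemma of the calculus of variations on (0, L). Integrals over the interval and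
over the line agree because the test functions vanish outside it. -/
theorem ae_eq_zero_of_integral_mul_test_eq_zero {L : ℝ} {w : ℝ → ℝ}
    (hw : Integrable w (intervalMeasure L))
    (h : ∀ φ : ℝ → ℝ, ContDiff ℝ ∞ φ → HasCompactSupport φ → tsupport φ ⊆ Ioo 0 L →
      ∫ s in Ioo 0 L, w s * φ s = 0) : w =ᵐ[intervalMeasure L] 0 := by
  have key := isOpen_Ioo.ae_eq_zero_of_integral_contDiff_smul_eq_zero (μ := volume)
    (U := Ioo 0 L) (f := w) (show IntegrableOn w (Ioo 0 L) volume from hw).locallyIntegrableOn ?_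
  · exact (ae_restrict_iff' measurableSet_Ioo).2 key
  · intro φ h1 h2 h3
    rw [← h φ h1 h2 h3, ← setIntegral_eq_integral_of_forall_compl_eq_zero (s := Ioo 0 L)]
    · simp [mul_comm]
    · intro x hx
      rw [image_eq_zero_of_notMem_tsupport fun hx' => hx (h3 hx'), zero_smul]

/-- A smooth compactly supported function on `(0, L)` with zero integral is the derivative of a
smooth compactly supported function on `(0, L)`. -/
theorem exists_test_deriv_eq {L : ℝ} {ψ : ℝ → ℝ} (h1 : ContDiff ℝ ∞ ψ)
    (h2 : HasCompactSupport ψ) (h3 : tsupport ψ ⊆ Ioo 0 L) (h4 : ∫ s in Ioo 0 L, ψ s = 0) :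
    ∃ φ : ℝ → ℝ, ContDiff ℝ ∞ φ ∧ HasCompactSupport φ ∧ tsupport φ ⊆ Ioo 0 L ∧ deriv φ = ψ := by
  rcases (tsupport ψ).eq_empty_or_nonempty with he | hne
  · have : ψ = 0 := by rwa [tsupport_eq_empty_iff] at he
    refine ⟨0, contDiff_const, HasCompactSupport.zero, ?_, by rw [this]; simp⟩
    rw [tsupport_eq_empty_iff.2 rfl]; exact empty_subset _
  obtain ⟨a, ha, ha'⟩ := h2.isCompact.exists_isLeast hne
  obtain ⟨b, hb, hb'⟩ := h2.isCompact.exists_isGreatest hne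
  have hc := h1.continuous
  have h0L : 0 ≤ L := ((h3 ha).1.trans (h3 ha).2).le
  have z : ∀ x, x ∉ Icc a b → ψ x = 0 := fun x hx =>
    image_eq_zero_of_notMem_tsupport fun hx' => hx ⟨ha' hx', hb' hx'⟩
  have hd : ∀ x, HasDerivAt (fun t => ∫ s in 0..t, ψ s) (ψ x) x := fun x =>
    intervalIntegral.integral_hasDerivAt_right (hc.intervalIntegrable _ _)
      (hc.stronglyMeasurableAtFilter _ _) hc.continuousAt
  have hderiv : deriv (fun t => ∫ s in 0..t, ψ s) = ψ := funext fun x => (hd x).deriv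
  -- To the left of the support the integrand vanishes; to the right the integral equals the total
  -- one, which is zero by `h4`.
  have zφ : ∀ x, x ∉ Icc a b → ∫ s in 0..x, ψ s = 0 := by
    intro x hx
    rw [mem_Icc, not_and_or, not_le, not_le] at hx
    rcases hx with hx | hx
    · refine intervalIntegral.integral_zero_ae (Filter.Eventually.of_forall fun s hs => z s ?_)
      intro hs'
      have := (uIoc_subset_uIcc hs)
      rw [mem_uIcc] at this
      have := (h3 ha).1
      grind
    · have : ∫ s in 0..L, ψ s = 0 := by rw [← setIntegral_Ioo_eq h0L, h4]
      rw [← intervalIntegral.integral_add_adjacent_intervals (b := L)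
        (hc.intervalIntegrable _ _) (hc.intervalIntegrable _ _), this, zero_add]
      refine intervalIntegral.integral_zero_ae (Filter.Eventually.of_forall fun s hs => z s ?_)
      intro hs'
      have := (uIoc_subset_uIcc hs)
      rw [mem_uIcc] at this
      have := (h3 hb).2
      grind
  have hsub : tsupport (fun t => ∫ s in 0..t, ψ s) ⊆ Icc a b :=
    closure_minimal (fun x hx => by by_contra h; exact hx (zφ x h)) isClosed_Icc
  refine ⟨fun t => ∫ s in 0..t, ψ s, ?_, ?_, ?_, hderiv⟩
  · rw [contDiff_infty_iff_deriv, hderiv]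
    exact ⟨fun x => (hd x).differentiableAt, h1⟩
  · exact isCompact_Icc.of_isClosed_subset (isClosed_tsupport _) hsub
  · exact hsub.trans fun x hx => ⟨(h3 ha).1.trans_le hx.1, hx.2.trans_lt (h3 hb).2⟩

/-- A function on `(0, L)` with vanishing weak derivative is constant. -/
theorem IsWeakDeriv.ae_eq_const {L : ℝ} (hL : 0 < L) {w : ℝ → ℝ}
    (hw : Integrable w (intervalMeasure L)) (h : IsWeakDeriv L w 0) :
    ∃ c : ℝ, w =ᵐ[intervalMeasure L] fun _ => c := by
  let χ : ContDiffBump (L / 2) := ⟨L / 8, L / 4, by linarith, by linarith⟩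
  have hχ1 : ContDiff ℝ ∞ χ := χ.contDiff
  have hχ2 : HasCompactSupport χ := χ.hasCompactSupport
  have hχ3 : tsupport χ ⊆ Ioo 0 L := by
    rw [χ.tsupport_eq, Real.closedBall_eq_Icc]
    intro x hx
    have h1 := hx.1; have h2 := hx.2
    simp only [χ] at h1 h2
    constructor <;> linarith
  have bdd : ∀ {φ : ℝ → ℝ}, Continuous φ → HasCompactSupport φ →
      Integrable (fun s => w s * φ s) (intervalMeasure L) := fun {φ} hc hs => by
    obtain ⟨C, hC⟩ := hc.bounded_above_of_compact_support hs
    exact hw.mul_bdd (c := C) hc.aestronglyMeasurable (Filter.Eventually.of_forall hC)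
  have hpos : 0 < ∫ s in Ioo 0 L, χ s := by
    have e : ∫ s in Ioo 0 L, χ s = ∫ s, χ s :=
      setIntegral_eq_integral_of_forall_compl_eq_zero fun x hx =>
        image_eq_zero_of_notMem_tsupport fun hx' => hx (hχ3 hx')
    rw [e]; exact χ.integral_pos
  set m := ∫ s in Ioo 0 L, χ s with hm
  refine ⟨(∫ s in Ioo 0 L, w s * χ s) / m, ?_⟩
  set c := (∫ s in Ioo 0 L, w s * χ s) / m with hc
  have hz : (fun s => w s - c) =ᵐ[intervalMeasure L] 0 := by
    refine ae_eq_zero_of_integral_mul_test_eq_zero (hw.sub (integrable_const c)) ?_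
    intro ψ h1 h2 h3
    set n := ∫ s in Ioo 0 L, ψ s with hn
    have iψ : Integrable ψ (intervalMeasure L) :=
      (h1.continuous.integrable_of_hasCompactSupport h2).restrict
    have iχ : Integrable χ (intervalMeasure L) :=
      (hχ1.continuous.integrable_of_hasCompactSupport hχ2).restrict
    -- Subtracting the multiple of the bump χ with the same integral makes an arbitrary test
    -- function ψ a derivative of a test function. The constant is therefore the χ-average of `w`.
    obtain ⟨φ, p1, p2, p3, p4⟩ := exists_test_deriv_eq (L := L)
      (ψ := fun s => ψ s - n / m * χ s) (h1.sub (contDiff_const.mul hχ1))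
      (h2.sub (hχ2.mul_left)) ((tsupport_sub _ _).trans
        (union_subset h3 ((tsupport_mul_subset_right).trans hχ3)))
      (by rw [integral_sub iψ (iχ.const_mul _), integral_const_mul, ← hm, ← hn]
          field_simp
          ring)
    have := h φ p1 p2 p3
    rw [p4] at this
    simp only [Pi.zero_apply, zero_mul, integral_zero, neg_zero] at this
    have e : ∀ s, w s * (ψ s - n / m * χ s) = w s * ψ s - n / m * (w s * χ s) := fun s => by ring
    simp_rw [e] at this
    rw [integral_sub (bdd h1.continuous h2) ((bdd hχ1.continuous hχ2).const_mul _),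
      integral_const_mul] at this
    simp_rw [sub_mul]
    rw [integral_sub (bdd h1.continuous h2) (iψ.const_mul _), integral_const_mul, ← hn]
    linear_combination this - n * hc
  filter_upwards [hz] with s hs
  simpa [sub_eq_zero] using hs

/-- An integrable function with an integrable weak derivative is a.e. equal to a primitive of that
derivative. -/
theorem IsWeakDeriv.exists_isPrimitiveOn {L : ℝ} (hL : 0 < L) {u v : ℝ → ℝ}
    (hu : Integrable u (intervalMeasure L)) (hv : Integrable v (intervalMeasure L))
    (h : IsWeakDeriv L u v) :
    ∃ U : ℝ → ℝ, u =ᵐ[intervalMeasure L] U ∧ IsPrimitiveOn U v 0 L := by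
  have hvi : IntervalIntegrable v volume 0 L :=
    (intervalIntegrable_iff_integrableOn_Ioo_of_le hL.le).2 hv
  have hV := IsPrimitiveOn.of_intervalIntegrable hL.le hvi
  set V : ℝ → ℝ := fun t => ∫ s in 0..t, v s with hVdef
  have hVint : Integrable V (intervalMeasure L) :=
    (intervalIntegrable_iff_integrableOn_Ioo_of_le hL.le).1
      (hV.continuousOn.intervalIntegrable_of_Icc hL.le)
  have hw : IsWeakDeriv L (fun s => u s - V s) 0 := by
    intro φ h1 h2 h3
    have bdd : ∀ {u φ : ℝ → ℝ}, Integrable u (intervalMeasure L) → Continuous φ →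
        HasCompactSupport φ → Integrable (fun s => u s * φ s) (intervalMeasure L) :=
      fun {u φ} hu hc hs => by
        obtain ⟨C, hC⟩ := hc.bounded_above_of_compact_support hs
        exact hu.mul_bdd (c := C) hc.aestronglyMeasurable (Filter.Eventually.of_forall hC)
    have hd : Continuous (deriv φ) := h1.continuous_deriv (by simp)
    simp_rw [sub_mul]
    rw [integral_sub (bdd hu hd h2.deriv) (bdd hVint hd h2.deriv), h φ h1 h2 h3,
      hV.isWeakDeriv φ h1 h2 h3]
    simp
  obtain ⟨c, hc⟩ := IsWeakDeriv.ae_eq_const hL (hu.sub hVint) hw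
  refine ⟨fun t => V t + c, ?_, ?_⟩
  · filter_upwards [hc] with s hs
    simp only [Pi.sub_apply] at hs
    linarith
  · simpa using hV.add (IsPrimitiveOn.const hL.le c)

/-! ### Representatives, uniqueness and norms in W^{m,q} -/

section Sobolev

variable {L : ℝ} {m : ℕ} {q : ℝ≥0∞} [hq : Fact (1 ≤ q)]

theorem LebI.integrable (f : LebI L q) : Integrable f (intervalMeasure L) :=
  (Lp.memLp f).integrable hq.out

theorem SobolevI.isWeakDeriv (u : SobolevI L m q) (i : Fin m) :
    IsWeakDeriv L (weakDer u i.castSucc) (weakDer u i.succ) :=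
  u.2 i

theorem weakDer_add (u v : SobolevI L m q) (i : Fin (m + 1)) :
    weakDer (u + v) i = weakDer u i + weakDer v i := rfl

theorem weakDer_sub (u v : SobolevI L m q) (i : Fin (m + 1)) :
    weakDer (u - v) i = weakDer u i - weakDer v i := rfl

theorem weakDer_smul (c : ℝ) (u : SobolevI L m q) (i : Fin (m + 1)) :
    weakDer (c • u) i = c • weakDer u i := rfl

theorem weakDer_ext {u v : SobolevI L m q} (h : ∀ i, weakDer u i = weakDer v i) : u = v :=
  Subtype.ext (PiLp.ext h)

/-- Representatives of a Sobolev function and its weak derivatives that are successive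
primitives. -/
theorem SobolevI.exists_isPrimitiveOn (hL : 0 < L) (u : SobolevI L m q) :
    ∃ U : Fin (m + 1) → ℝ → ℝ, (∀ i, weakDer u i =ᵐ[intervalMeasure L] U i) ∧
      ∀ i : Fin m, IsPrimitiveOn (U i.castSucc) (U i.succ) 0 L := by
  have h (i : Fin m) := (SobolevI.isWeakDeriv u i).exists_isPrimitiveOn hL
    (weakDer u i.castSucc).integrable (weakDer u i.succ).integrable
  choose V hV hV' using h
  -- Only entries below the top have a weak derivative to integrate; the top one keeps its own
  -- representative.
  let U : Fin (m + 1) → ℝ → ℝ := Fin.lastCases (weakDer u (Fin.last m)) V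
  have hU : ∀ i, weakDer u i =ᵐ[intervalMeasure L] U i := by
    intro i
    refine Fin.lastCases ?_ (fun i => ?_) i
    · simp [U]
    · simpa [U] using hV i
  refine ⟨U, hU, fun i => ?_⟩
  have := (hV' i).congr_ae (hU i.succ)
  simpa [U] using this

/-- The Sobolev function with prescribed representatives. -/
theorem SobolevI.exists_of_isPrimitiveOn (D : Fin (m + 1) → ℝ → ℝ)
    (hD : ∀ i, MemLp (D i) q (intervalMeasure L))
    (h : ∀ i : Fin m, IsPrimitiveOn (D i.castSucc) (D i.succ) 0 L) :
    ∃ w : SobolevI L m q, ∀ i, weakDer w i = (hD i).toLp (D i) :=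
  ⟨⟨WithLp.toLp q fun i => (hD i).toLp (D i), fun i =>
    (h i).isWeakDeriv.congr_ae (hD _).coeFn_toLp.symm (hD _).coeFn_toLp.symm⟩, fun _ => rfl⟩

/-- Weak derivatives are unique. -/
theorem SobolevI.ext_of_weakDer_zero {u v : SobolevI L m q} (h : weakDer u 0 = weakDer v 0) :
    u = v := by
  refine weakDer_ext fun i => ?_
  induction i using Fin.induction with
  | zero => exact h
  | succ i ih =>
    have hd := SobolevI.isWeakDeriv (u - v) i
    rw [weakDer_sub, weakDer_sub, ih, sub_self] at hd
    have : (weakDer u i.succ - weakDer v i.succ : LebI L q) =ᵐ[intervalMeasure L] 0 := by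
      refine ae_eq_zero_of_integral_mul_test_eq_zero (LebI.integrable _) fun φ h1 h2 h3 => ?_
      rw [← neg_eq_zero, ← hd φ h1 h2 h3]
      refine integral_eq_zero_of_ae ?_
      filter_upwards [Lp.coeFn_zero ℝ q (intervalMeasure L)] with s hs
      rw [hs]; simp
    exact sub_eq_zero.1 ((Lp.eq_zero_iff_ae_eq_zero).2 this)

/-- Triangle inequality for the decomposition into single coordinates. The constant 1 is the same
for every `q`, which keeps the later Sobolev constants independent of `q`. -/
theorem PiLp.norm_le_sum {ι : Type*} [Fintype ι] [DecidableEq ι] {E : ι → Type*}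
    [∀ i, NormedAddCommGroup (E i)] (x : PiLp q E) : ‖x‖ ≤ ∑ i, ‖x i‖ := by
  have : x = ∑ i, PiLp.single q i (x i) := by
    ext j
    rw [WithLp.ofLp_sum, Finset.sum_apply, Finset.sum_eq_single j]
    · simp
    · intro i _ hij
      exact PiLp.single_eq_of_ne' _ hij _
    · simp
  calc ‖x‖ = ‖∑ i, PiLp.single q i (x i)‖ := by rw [← this]
    _ ≤ ∑ i, ‖PiLp.single q i (x i)‖ := norm_sum_le _ _
    _ = ∑ i, ‖x i‖ := by simp

theorem SobolevI.norm_le_sum (u : SobolevI L m q) : ‖u‖ ≤ ∑ i, ‖weakDer u i‖ :=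
  PiLp.norm_le_sum u.1

theorem SobolevI.norm_weakDer_le (u : SobolevI L m q) (i : Fin (m + 1)) : ‖weakDer u i‖ ≤ ‖u‖ :=
  PiLp.norm_apply_le (p := q) u.1 i

end Sobolev

/-! ### L² norms and the Cauchy–Schwarz inequality -/

section L2

variable {α : Type*} [MeasurableSpace α] {μ : Measure α}

theorem MeasureTheory.MemLp.integrable_mul_of_two {f g : α → ℝ} (hf : MemLp f 2 μ)
    (hg : MemLp g 2 μ) : Integrable (fun s => f s * g s) μ :=
  hf.integrable_mul hg

theorem MeasureTheory.Lp.norm_sq_eq_integral (f : Lp ℝ 2 μ) : ‖f‖ ^ 2 = ∫ s, f s ^ 2 ∂μ := by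
  rw [← real_inner_self_eq_norm_sq, L2.inner_def]
  simp [pow_two]

end L2

/-- Expand the integral of (|f| − m)² ≥ 0, with `m` the mean of |f|. -/
theorem sq_intervalIntegral_abs_le {a b : ℝ} (hab : a ≤ b) {f : ℝ → ℝ}
    (hf : IntervalIntegrable f volume a b) (hf2 : IntervalIntegrable (fun s => f s ^ 2) volume a b) :
    (∫ s in a..b, |f s|) ^ 2 ≤ (b - a) * ∫ s in a..b, f s ^ 2 := by
  rcases hab.eq_or_lt with rfl | hab'
  · simp
  have hpos : 0 < b - a := sub_pos.2 hab'
  set A := ∫ s in a..b, |f s| with hA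
  set m := A / (b - a) with hm
  have h0 : 0 ≤ ∫ s in a..b, (|f s| - m) ^ 2 :=
    intervalIntegral.integral_nonneg hab fun s _ => sq_nonneg _
  have e : ∀ s, (|f s| - m) ^ 2 = (f s ^ 2 - 2 * m * |f s|) + m ^ 2 := fun s => by
    rw [sub_sq, sq_abs]; ring
  simp_rw [e] at h0
  rw [intervalIntegral.integral_add (hf2.sub (hf.abs.const_mul _)) intervalIntegrable_const,
    intervalIntegral.integral_sub hf2 (hf.abs.const_mul _), intervalIntegral.integral_const_mul,
    intervalIntegral.integral_const, ← hA, smul_eq_mul] at h0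
  have hAm : A = m * (b - a) := by rw [hm]; field_simp
  rw [hAm] at h0 ⊢
  nlinarith [mul_nonneg hpos.le h0]

/-! ### Interpolation on a single interval -/

section Local

variable {W W₁ W₂ : ℝ → ℝ} {a b : ℝ}

theorem IsPrimitiveOn.abs_sub_le {F f : ℝ → ℝ} (h : IsPrimitiveOn F f a b) {s t : ℝ}
    (hs : s ∈ Icc a b) (ht : t ∈ Icc a b) : |F t - F s| ≤ ∫ x in a..b, |f x| := by
  rw [h.sub_eq hs ht]
  refine (intervalIntegral.norm_integral_le_integral_norm_uIoc (f := f)).trans ?_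
  rw [intervalIntegral.integral_of_le h.le]
  refine setIntegral_mono_set h.intervalIntegrable.1.abs
    (Filter.Eventually.of_forall fun x => abs_nonneg _) ?_
  refine (Filter.Eventually.of_forall ?_)
  intro x hx
  exact ⟨(le_min hs.1 ht.1).trans_lt hx.1, hx.2.trans (max_le hs.2 ht.2)⟩

/-- Interpolation of the first derivative on an interval, in the `L¹` form. -/
theorem abs_deriv_le_of_isPrimitiveOn (hab : a < b) (h : IsPrimitiveOn W W₁ a b)
    (h₁ : IsPrimitiveOn W₁ W₂ a b) {x : ℝ} (hx : x ∈ Icc a b) :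
    |W₁ x| ≤ 4 / (b - a) ^ 2 * (∫ s in a..b, |W s|) + 2 * ∫ s in a..b, |W₂ s| := by
  set B := ∫ s in a..b, |W₂ s| with hB
  set A := ∫ s in a..b, |W s| with hA
  set η := b - a with hη
  have hpos : 0 < η := sub_pos.2 hab
  set m := a + η / 2 with hm
  have ham : a ≤ m := by linarith
  have hmb : m ≤ b := by linarith
  have hWi : IntervalIntegrable (fun s => |W s|) volume a b :=
    (h.continuousOn.intervalIntegrable_of_Icc hab.le).abs
  have hB0 : 0 ≤ B := intervalIntegral.integral_nonneg hab.le fun s _ => abs_nonneg _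
  -- The difference quotient of `W` over a step η/2 is an average of `W₁`, and `W₁` oscillates by at
  -- most `B`. Integrating over the right half in t covers both halves of [a, b] exactly once on the
  -- right-hand side, so the total is `A`.
  have pt : ∀ t ∈ Icc m b, η / 2 * |W₁ x| ≤ |W t| + |W (t - η / 2)| + η / 2 * B := by
    intro t ht
    have ht' : t ∈ Icc a b := ⟨ham.trans ht.1, ht.2⟩
    have hs' : t - η / 2 ∈ Icc a b := ⟨by linarith [ht.1], by linarith [ht.2]⟩
    have hle : t - η / 2 ≤ t := by linarith
    have hint : IntervalIntegrable W₁ volume (t - η / 2) t := h.intervalIntegrable_sub hs' ht'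
    have e : W t - W (t - η / 2) - η / 2 * W₁ x = ∫ y in (t - η / 2)..t, (W₁ y - W₁ x) := by
      rw [intervalIntegral.integral_sub hint intervalIntegrable_const, ← h.sub_eq hs' ht',
        intervalIntegral.integral_const, smul_eq_mul]
      ring
    have b1 : |∫ y in (t - η / 2)..t, (W₁ y - W₁ x)| ≤ B * |t - (t - η / 2)| := by
      refine intervalIntegral.norm_integral_le_of_norm_le_const (f := fun y => W₁ y - W₁ x)
        (C := B) fun y hy => ?_
      rw [uIoc_of_le hle] at hy
      exact h₁.abs_sub_le hx ⟨hs'.1.trans hy.1.le, hy.2.trans ht'.2⟩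
    rw [← e, show t - (t - η / 2) = η / 2 by ring, abs_of_pos (half_pos hpos)] at b1
    have b2 : η / 2 * |W₁ x| = |η / 2 * W₁ x| := by rw [abs_mul, abs_of_pos (half_pos hpos)]
    have b3 : |η / 2 * W₁ x| ≤ |W t - W (t - η / 2) - η / 2 * W₁ x| + |W t - W (t - η / 2)| := by
      have := abs_sub_le (η / 2 * W₁ x) (W t - W (t - η / 2)) 0
      simp only [sub_zero] at this
      rwa [abs_sub_comm (η / 2 * W₁ x)] at this
    have b4 := abs_sub (W t) (W (t - η / 2))
    linarith
  have i1 : IntervalIntegrable (fun s => |W s|) volume m b :=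
    hWi.mono_set (by rw [uIcc_of_le hmb, uIcc_of_le hab.le]; exact Icc_subset_Icc_left ham)
  have i2' : IntervalIntegrable (fun s => |W s|) volume a m :=
    hWi.mono_set (by rw [uIcc_of_le ham, uIcc_of_le hab.le]; exact Icc_subset_Icc_right hmb)
  have i2 : IntervalIntegrable (fun s => |W (s - η / 2)|) volume m b := by
    have := i2'.comp_sub_right (η / 2)
    rwa [show m + η / 2 = b by rw [hm, hη]; ring, ← hm] at this
  have key := intervalIntegral.integral_mono_on hmb
    (intervalIntegrable_const (c := η / 2 * |W₁ x|)) ((i1.add i2).add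
      (intervalIntegrable_const (c := η / 2 * B))) pt
  rw [intervalIntegral.integral_add (i1.add i2) intervalIntegrable_const,
    intervalIntegral.integral_add i1 i2, intervalIntegral.integral_const,
    intervalIntegral.integral_const, smul_eq_mul, smul_eq_mul,
    intervalIntegral.integral_comp_sub_right (fun s => |W s|),
    show m - η / 2 = a by rw [hm]; ring, show b - η / 2 = m by rw [hm, hη]; ring,
    show b - m = η / 2 by rw [hm, hη]; ring, add_comm (∫ s in m..b, |W s|),
    intervalIntegral.integral_add_adjacent_intervals i2' i1, ← hA] at key
  rw [div_mul_eq_mul_div, ← sub_le_iff_le_add, le_div_iff₀ (by positivity)]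
  nlinarith

/-- The derivative bound limits the oscillation of `W` by ηM; averaging |W x| ≤ |W t| + ηM over t
gives A/η + ηM, and ηM = 4A/η + 2ηB. -/
theorem abs_le_of_isPrimitiveOn (hab : a < b) (h : IsPrimitiveOn W W₁ a b)
    (h₁ : IsPrimitiveOn W₁ W₂ a b) {x : ℝ} (hx : x ∈ Icc a b) :
    |W x| ≤ 5 / (b - a) * (∫ s in a..b, |W s|) + 2 * (b - a) * ∫ s in a..b, |W₂ s| := by
  have key := fun y hy => abs_deriv_le_of_isPrimitiveOn hab h h₁ (x := y) hy
  set B := ∫ s in a..b, |W₂ s| with hB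
  set A := ∫ s in a..b, |W s| with hA
  set η := b - a with hη
  have hpos : 0 < η := sub_pos.2 hab
  set M := 4 / η ^ 2 * A + 2 * B with hM
  have hWi : IntervalIntegrable (fun s => |W s|) volume a b :=
    (h.continuousOn.intervalIntegrable_of_Icc hab.le).abs
  have d : ∫ y in a..b, |W₁ y| ≤ M * η := by
    have := intervalIntegral.integral_mono_on hab.le h.intervalIntegrable.abs
      (intervalIntegrable_const (c := M)) key
    rwa [intervalIntegral.integral_const, smul_eq_mul, mul_comm] at this
  have pt : ∀ t ∈ Icc a b, |W x| ≤ |W t| + M * η := fun t ht => by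
    have h1 := h.abs_sub_le ht hx
    have h2 := abs_sub_abs_le_abs_sub (W x) (W t)
    linarith
  have := intervalIntegral.integral_mono_on hab.le (intervalIntegrable_const (c := |W x|))
    (hWi.add (intervalIntegrable_const (c := M * η))) pt
  rw [intervalIntegral.integral_add hWi intervalIntegrable_const, intervalIntegral.integral_const,
    intervalIntegral.integral_const, smul_eq_mul, smul_eq_mul, ← hη, ← hA] at this
  have e : 5 / η * A + 2 * η * B = (A + η * (M * η)) / η := by
    rw [hM]; field_simp; ring
  rw [e, le_div_iff₀ hpos]
  linarith

/-- Local interpolation: pointwise bound of `W` and `W'` on an interval of length `η ≤ δ`. -/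
theorem sq_add_sq_le_of_isPrimitiveOn (hab : a < b) (h : IsPrimitiveOn W W₁ a b)
    (h₁ : IsPrimitiveOn W₁ W₂ a b) (h₂ : IntervalIntegrable (fun s => W₂ s ^ 2) volume a b)
    {x : ℝ} (hx : x ∈ Icc a b) :
    W x ^ 2 + (b - a) ^ 2 * W₁ x ^ 2
      ≤ 100 / (b - a) * ∫ s in a..b, (W s ^ 2 + (b - a) ^ 4 * W₂ s ^ 2) := by
  have k1 := abs_deriv_le_of_isPrimitiveOn hab h h₁ hx
  have k0 := abs_le_of_isPrimitiveOn hab h h₁ hx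
  have hWi := h.continuousOn.intervalIntegrable_of_Icc (μ := volume) hab.le
  have hWi2 : IntervalIntegrable (fun s => W s ^ 2) volume a b :=
    (h.continuousOn.pow 2).intervalIntegrable_of_Icc (μ := volume) hab.le
  have cA := sq_intervalIntegral_abs_le hab.le hWi hWi2
  have cB := sq_intervalIntegral_abs_le hab.le h₁.intervalIntegrable h₂
  rw [intervalIntegral.integral_add hWi2 (h₂.const_mul _), intervalIntegral.integral_const_mul]
  have hA0 : 0 ≤ ∫ s in a..b, |W s| := intervalIntegral.integral_nonneg hab.le fun s _ => abs_nonneg _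
  have hB0 : 0 ≤ ∫ s in a..b, |W₂ s| := intervalIntegral.integral_nonneg hab.le fun s _ => abs_nonneg _
  have hX0 : 0 ≤ ∫ s in a..b, W s ^ 2 := intervalIntegral.integral_nonneg hab.le fun s _ => sq_nonneg _
  have hY0 : 0 ≤ ∫ s in a..b, W₂ s ^ 2 := intervalIntegral.integral_nonneg hab.le fun s _ => sq_nonneg _
  set B := ∫ s in a..b, |W₂ s|
  set A := ∫ s in a..b, |W s|
  set X := ∫ s in a..b, W s ^ 2
  set Y := ∫ s in a..b, W₂ s ^ 2
  set η := b - a with hη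
  have hpos : 0 < η := sub_pos.2 hab
  have s1 : W₁ x ^ 2 ≤ (4 / η ^ 2 * A + 2 * B) ^ 2 := sq_le_sq.2 (by
    rwa [abs_of_nonneg (by positivity : 0 ≤ 4 / η ^ 2 * A + 2 * B)])
  have s0 : W x ^ 2 ≤ (5 / η * A + 2 * η * B) ^ 2 := sq_le_sq.2 (by
    rwa [abs_of_nonneg (by positivity : 0 ≤ 5 / η * A + 2 * η * B)])
  have t1 : η ^ 2 * W₁ x ^ 2 ≤ η ^ 2 * (4 / η ^ 2 * A + 2 * B) ^ 2 := by gcongr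
  have e1 : η ^ 2 * (4 / η ^ 2 * A + 2 * B) ^ 2 = (4 * (A / η) + 2 * (η * B)) ^ 2 := by
    field_simp
  have e0 : 5 / η * A + 2 * η * B = 5 * (A / η) + 2 * (η * B) := by field_simp
  have a1 : (A / η) ^ 2 ≤ X / η := by
    rw [div_pow, div_le_div_iff₀ (by positivity) hpos]; nlinarith
  have a2 : (η * B) ^ 2 ≤ η ^ 3 * Y := by
    rw [mul_pow]; nlinarith [mul_le_mul_of_nonneg_left cB (sq_nonneg η)]
  have e2 : 100 / η * (X + η ^ 4 * Y) = 100 * (X / η) + 100 * (η ^ 3 * Y) := by field_simp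
  rw [e0] at s0
  rw [e1] at t1
  rw [e2]
  have : 0 ≤ X / η := by positivity
  have : 0 ≤ η ^ 3 * Y := by positivity
  -- With p = A/η and r = ηB the left side is at most (5p + 2r)² + (4p + 2r)² ≤ 59p² + 26r², well
  -- below 100(p² + r²).
  nlinarith [sq_nonneg (A / η - η * B)]

end Local

/-! ### Weighted interpolation on (0, L) by subdivision into cells -/

/-- Take N = ⌈L/δ⌉: then Nδ < L + δ ≤ L + 1, so equal cells are comparable with δ from both sides.
Here the dependence of the interpolation constants on `L` arises, since L may be smaller than δ. -/
theorem exists_cell_length {L δ : ℝ} (hL : 0 < L) (hδ : 0 < δ) (hδ1 : δ ≤ 1) :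
    ∃ N : ℕ, 0 < N ∧ L / N ≤ δ ∧ L / (L + 1) * δ ≤ L / N := by
  have hN : 0 < ⌈L / δ⌉₊ := Nat.ceil_pos.2 (by positivity)
  have hN' : (0 : ℝ) < ⌈L / δ⌉₊ := by exact_mod_cast hN
  refine ⟨⌈L / δ⌉₊, hN, ?_, ?_⟩
  · rw [div_le_comm₀ hN' hδ]
    exact Nat.le_ceil _
  · rw [div_mul_eq_mul_div, div_le_div_iff₀ (by positivity) hN', mul_assoc]
    refine mul_le_mul_of_nonneg_left ?_ hL.le
    have h1 : (⌈L / δ⌉₊ : ℝ) < L / δ + 1 := Nat.ceil_lt_add_one (by positivity)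
    have h2 : δ * (L / δ + 1) = L + δ := by field_simp
    nlinarith [mul_lt_mul_of_pos_left h1 hδ]

/-- A positive continuous weight that varies by a factor of at most `4` at scale `δ`. -/
structure IsSlowWeight (δ : ℝ) (ρ : ℝ → ℝ) : Prop where
  continuous : Continuous ρ
  pos : ∀ s, 0 < ρ s
  le : ∀ s t, |s - t| ≤ δ → ρ s ≤ 4 * ρ t

/-- The constant of the weighted interpolation inequalities on `(0, L)`. -/
noncomputable def interpConst (L : ℝ) : ℝ := 400 * ((L + 1) / L) ^ 3

theorem interpConst_pos {L : ℝ} (hL : 0 < L) : 0 < interpConst L := by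
  unfold interpConst; positivity

section Weighted

variable {L δ : ℝ} {ρ W W₁ W₂ : ℝ → ℝ}

/-- On a cell of length at most δ the weight is constant up to the factor 4, so the unweighted
constant 100 becomes 400. -/
theorem IsSlowWeight.cell_bound (hρ : IsSlowWeight δ ρ) {a b : ℝ} (hab : a < b) (hδ : b - a ≤ δ)
    (h : IsPrimitiveOn W W₁ a b) (h₁ : IsPrimitiveOn W₁ W₂ a b)
    (h₂ : IntervalIntegrable (fun s => W₂ s ^ 2) volume a b) {x : ℝ} (hx : x ∈ Icc a b) :
    ρ x * (W x ^ 2 + (b - a) ^ 2 * W₁ x ^ 2)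
      ≤ 400 / (b - a) * ∫ s in a..b, ρ s * (W s ^ 2 + δ ^ 4 * W₂ s ^ 2) := by
  have key := sq_add_sq_le_of_isPrimitiveOn hab h h₁ h₂ hx
  have hpos : 0 < b - a := sub_pos.2 hab
  have hWi2 : IntervalIntegrable (fun s => W s ^ 2) volume a b :=
    (h.continuousOn.pow 2).intervalIntegrable_of_Icc (μ := volume) hab.le
  have mono : ρ x * ∫ s in a..b, (W s ^ 2 + (b - a) ^ 4 * W₂ s ^ 2)
      ≤ 4 * ∫ s in a..b, ρ s * (W s ^ 2 + δ ^ 4 * W₂ s ^ 2) := by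
    rw [← intervalIntegral.integral_const_mul, ← intervalIntegral.integral_const_mul]
    refine intervalIntegral.integral_mono_on hab.le ((hWi2.add (h₂.const_mul _)).const_mul _)
      (((hWi2.add (h₂.const_mul _)).continuousOn_mul hρ.continuous.continuousOn).const_mul _)
      fun s hs => ?_
    have h1 : ρ x ≤ 4 * ρ s := hρ.le x s ((abs_sub_le_iff.2 ⟨by linarith [hx.2, hs.1],
      by linarith [hx.1, hs.2]⟩).trans hδ)
    have h2 : (b - a) ^ 4 ≤ δ ^ 4 := pow_le_pow_left₀ hpos.le hδ 4
    have h3 := (hρ.pos x).le.trans h1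
    calc ρ x * (W s ^ 2 + (b - a) ^ 4 * W₂ s ^ 2)
        ≤ (4 * ρ s) * (W s ^ 2 + δ ^ 4 * W₂ s ^ 2) := by gcongr
      _ = _ := by ring
  calc ρ x * (W x ^ 2 + (b - a) ^ 2 * W₁ x ^ 2)
      ≤ ρ x * (100 / (b - a) * ∫ s in a..b, (W s ^ 2 + (b - a) ^ 4 * W₂ s ^ 2)) :=
        mul_le_mul_of_nonneg_left key (hρ.pos x).le
    _ = 100 / (b - a) * (ρ x * ∫ s in a..b, (W s ^ 2 + (b - a) ^ 4 * W₂ s ^ 2)) := by ring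
    _ ≤ 100 / (b - a) * (4 * ∫ s in a..b, ρ s * (W s ^ 2 + δ ^ 4 * W₂ s ^ 2)) := by gcongr
    _ = _ := by ring

variable (hL : 0 < L) (hδ : 0 < δ) (hδ1 : δ ≤ 1) (hρ : IsSlowWeight δ ρ)
  (h : IsPrimitiveOn W W₁ 0 L) (h₁ : IsPrimitiveOn W₁ W₂ 0 L)
  (h₂ : IntervalIntegrable (fun s => W₂ s ^ 2) volume 0 L)

include hL hδ hδ1 hρ h h₁ h₂

/-- Weighted pointwise bound of `W` and `W'`. -/
theorem IsSlowWeight.pointwise_le {x : ℝ} (hx : x ∈ Icc 0 L) :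
    ρ x * (W x ^ 2 + δ ^ 2 * W₁ x ^ 2)
      ≤ interpConst L / δ * ∫ s in 0..L, ρ s * (W s ^ 2 + δ ^ 4 * W₂ s ^ 2) := by
  obtain ⟨N, hN, hη, hη'⟩ := exists_cell_length hL hδ hδ1
  have hN0 : (0 : ℝ) < N := by exact_mod_cast hN
  have hN1 : (1 : ℝ) ≤ N := by exact_mod_cast hN
  set η := L / N with hηdef
  have hpos : 0 < η := by positivity
  have hηL : η ≤ L := div_le_self hL.le hN1
  -- The cell starts at x, or is pushed left so as to end at L: in both cases it contains x and
  -- stays inside [0, L].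
  set a := min x (L - η) with ha
  have ha0 : 0 ≤ a := le_min hx.1 (by linarith)
  have haL : a + η ≤ L := by linarith [min_le_right x (L - η)]
  have hxa : x ∈ Icc a (a + η) := ⟨min_le_left _ _, by
    rcases min_choice x (L - η) with h | h <;> rw [ha, h]
    · linarith
    · linarith [hx.2]⟩
  have hWi2 : IntervalIntegrable (fun s => W s ^ 2) volume 0 L :=
    (h.continuousOn.pow 2).intervalIntegrable_of_Icc (μ := volume) hL.le
  have hI : IntervalIntegrable (fun s => ρ s * (W s ^ 2 + δ ^ 4 * W₂ s ^ 2)) volume 0 L :=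
    (hWi2.add (h₂.const_mul _)).continuousOn_mul hρ.continuous.continuousOn
  have hnn : ∀ s, 0 ≤ ρ s * (W s ^ 2 + δ ^ 4 * W₂ s ^ 2) := fun s =>
    mul_nonneg (hρ.pos s).le (by positivity)
  have key := hρ.cell_bound (a := a) (b := a + η) (by linarith) (by linarith)
    (h.mono ha0 (by linarith) haL) (h₁.mono ha0 (by linarith) haL)
    (h₂.mono_set (by rw [uIcc_of_le (by linarith), uIcc_of_le hL.le]
                     exact Icc_subset_Icc ha0 haL)) hxa
  rw [add_sub_cancel_left] at key
  have mono : ∫ s in a..(a + η), ρ s * (W s ^ 2 + δ ^ 4 * W₂ s ^ 2)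
      ≤ ∫ s in 0..L, ρ s * (W s ^ 2 + δ ^ 4 * W₂ s ^ 2) :=
    intervalIntegral.integral_mono_interval ha0 (by linarith) haL
      (Filter.Eventually.of_forall hnn) hI
  have hJ : 0 ≤ ∫ s in 0..L, ρ s * (W s ^ 2 + δ ^ 4 * W₂ s ^ 2) :=
    intervalIntegral.integral_nonneg hL.le fun s _ => hnn s
  set J := ∫ s in 0..L, ρ s * (W s ^ 2 + δ ^ 4 * W₂ s ^ 2)
  -- Since δ ≤ κη, passing from η² to δ² costs κ² and from 1/η to 1/δ one more κ: hence the cube in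
  -- `interpConst`.
  set κ := (L + 1) / L with hκ
  have hκ1 : 1 ≤ κ := (one_le_div hL).2 (by linarith)
  have hκη : δ ≤ κ * η := by
    rw [div_mul_eq_mul_div, div_le_iff₀ (by positivity)] at hη'
    rw [hκ, div_mul_eq_mul_div, le_div_iff₀ hL]; linarith
  have hρx := (hρ.pos x).le
  calc ρ x * (W x ^ 2 + δ ^ 2 * W₁ x ^ 2)
      ≤ ρ x * (κ ^ 2 * W x ^ 2 + (κ * η) ^ 2 * W₁ x ^ 2) := by
        gcongr
        exact le_mul_of_one_le_left (sq_nonneg _) (one_le_pow₀ hκ1)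
    _ = κ ^ 2 * (ρ x * (W x ^ 2 + η ^ 2 * W₁ x ^ 2)) := by ring
    _ ≤ κ ^ 2 * (400 / η * J) := by
        refine mul_le_mul_of_nonneg_left (key.trans ?_) (by positivity)
        gcongr
    _ ≤ κ ^ 2 * (400 / (δ / κ) * J) := by
        gcongr
        rwa [div_le_iff₀ (by positivity), mul_comm]
    _ = interpConst L / δ * J := by
        rw [interpConst, ← hκ]; field_simp

/-- Weighted interpolation inequality for the first derivative. -/
theorem IsSlowWeight.integral_deriv_sq_le :
    δ ^ 2 * ∫ s in 0..L, ρ s * W₁ s ^ 2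
      ≤ interpConst L * ∫ s in 0..L, ρ s * (W s ^ 2 + δ ^ 4 * W₂ s ^ 2) := by
  obtain ⟨N, hN, hη, hη'⟩ := exists_cell_length hL hδ hδ1
  have hN0 : (0 : ℝ) < N := by exact_mod_cast hN
  set η := L / N with hηdef
  have hpos : 0 < η := by positivity
  have hNη : N * η = L := by rw [hηdef]; field_simp
  have hWi2 : IntervalIntegrable (fun s => W s ^ 2) volume 0 L :=
    (h.continuousOn.pow 2).intervalIntegrable_of_Icc (μ := volume) hL.le
  have hI : IntervalIntegrable (fun s => ρ s * (W s ^ 2 + δ ^ 4 * W₂ s ^ 2)) volume 0 L :=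
    (hWi2.add (h₂.const_mul _)).continuousOn_mul hρ.continuous.continuousOn
  have hI1 : IntervalIntegrable (fun s => ρ s * W₁ s ^ 2) volume 0 L :=
    (hρ.continuous.continuousOn.mul (h₁.continuousOn.pow 2)).intervalIntegrable_of_Icc hL.le
  have hnn : ∀ s, 0 ≤ ρ s * (W s ^ 2 + δ ^ 4 * W₂ s ^ 2) := fun s =>
    mul_nonneg (hρ.pos s).le (by positivity)
  have hJ : 0 ≤ ∫ s in 0..L, ρ s * (W s ^ 2 + δ ^ 4 * W₂ s ^ 2) :=
    intervalIntegral.integral_nonneg hL.le fun s _ => hnn s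
  have sub : ∀ i < N, 0 ≤ (i : ℝ) * η ∧ (i : ℝ) * η ≤ ((i + 1 : ℕ) : ℝ) * η ∧
      ((i + 1 : ℕ) : ℝ) * η ≤ L := fun i hi => by
    have : ((i + 1 : ℕ) : ℝ) ≤ N := by exact_mod_cast hi
    refine ⟨by positivity, by push_cast; linarith, ?_⟩
    rw [← hNη]; gcongr
  have uI : ∀ i < N, uIcc ((i : ℝ) * η) (((i + 1 : ℕ) : ℝ) * η) ⊆ uIcc 0 L := fun i hi => by
    obtain ⟨s1, s2, s3⟩ := sub i hi
    rw [uIcc_of_le s2, uIcc_of_le hL.le]; exact Icc_subset_Icc s1 s3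
  -- Integrating the pointwise bound over a cell cancels its factor 1/η; the cells are then summed.
  have cell : ∀ i < N, η ^ 2 * ∫ s in ((i : ℝ) * η)..(((i + 1 : ℕ) : ℝ) * η), ρ s * W₁ s ^ 2
      ≤ 400 * ∫ s in ((i : ℝ) * η)..(((i + 1 : ℕ) : ℝ) * η),
        ρ s * (W s ^ 2 + δ ^ 4 * W₂ s ^ 2) := by
    intro i hi
    obtain ⟨s1, s2, s3⟩ := sub i hi
    have e : ((i + 1 : ℕ) : ℝ) * η - (i : ℝ) * η = η := by push_cast; ring
    have key := fun x hx => hρ.cell_bound (a := (i : ℝ) * η) (b := ((i + 1 : ℕ) : ℝ) * η)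
      (by linarith) (by linarith) (h.mono s1 s2 s3) (h₁.mono s1 s2 s3)
      (h₂.mono_set (uI i hi)) (x := x) hx
    rw [e] at key
    have := intervalIntegral.integral_mono_on s2 ((hI1.mono_set (uI i hi)).const_mul (η ^ 2))
      (intervalIntegrable_const (c := 400 / η * ∫ s in ((i : ℝ) * η)..(((i + 1 : ℕ) : ℝ) * η),
        ρ s * (W s ^ 2 + δ ^ 4 * W₂ s ^ 2))) (fun x hx => by
        refine le_trans ?_ (key x hx)
        nlinarith [mul_nonneg (hρ.pos x).le (sq_nonneg (W x))])
    rw [intervalIntegral.integral_const_mul, intervalIntegral.integral_const, e, smul_eq_mul,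
      ← mul_assoc, mul_div_cancel₀ _ hpos.ne'] at this
    exact this
  have tot : η ^ 2 * ∫ s in 0..L, ρ s * W₁ s ^ 2
      ≤ 400 * ∫ s in 0..L, ρ s * (W s ^ 2 + δ ^ 4 * W₂ s ^ 2) := by
    have e1 := intervalIntegral.sum_integral_adjacent_intervals (a := fun i : ℕ => (i : ℝ) * η)
      (n := N) (fun i hi => hI1.mono_set (uI i hi))
    have e2 := intervalIntegral.sum_integral_adjacent_intervals (a := fun i : ℕ => (i : ℝ) * η)
      (n := N) (fun i hi => hI.mono_set (uI i hi))
    simp only [Nat.cast_zero, zero_mul, hNη] at e1 e2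
    rw [← e1, ← e2, Finset.mul_sum, Finset.mul_sum]
    exact Finset.sum_le_sum fun i hi => cell i (Finset.mem_range.1 hi)
  have hK : 0 ≤ ∫ s in 0..L, ρ s * W₁ s ^ 2 :=
    intervalIntegral.integral_nonneg hL.le fun s _ => mul_nonneg (hρ.pos s).le (sq_nonneg _)
  set J := ∫ s in 0..L, ρ s * (W s ^ 2 + δ ^ 4 * W₂ s ^ 2)
  set K := ∫ s in 0..L, ρ s * W₁ s ^ 2
  set κ := (L + 1) / L with hκ
  have hκ1 : 1 ≤ κ := (one_le_div hL).2 (by linarith)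
  have hκη : δ ≤ κ * η := by
    rw [div_mul_eq_mul_div, div_le_iff₀ (by positivity)] at hη'
    rw [hκ, div_mul_eq_mul_div, le_div_iff₀ hL]; linarith
  calc δ ^ 2 * K ≤ (κ * η) ^ 2 * K := by gcongr
    _ = κ ^ 2 * (η ^ 2 * K) := by ring
    _ ≤ κ ^ 2 * (400 * J) := by gcongr
    _ ≤ κ ^ 3 * (400 * J) := by
        gcongr
        norm_num
    _ = interpConst L * J := by rw [interpConst, ← hκ]; ring

end Weighted

/-! ### Integrability of continuous functions and products -/

section MemLp

variable {L : ℝ} {q : ℝ≥0∞}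

theorem memLp_of_continuousOn_Icc {F : ℝ → ℝ} (hF : ContinuousOn F (Icc 0 L)) :
    MemLp F q (intervalMeasure L) := by
  obtain ⟨C, hC⟩ := isCompact_Icc.exists_bound_of_continuousOn hF
  refine MemLp.of_bound ((hF.mono Ioo_subset_Icc_self).aestronglyMeasurable measurableSet_Ioo) C ?_
  filter_upwards [ae_restrict_mem measurableSet_Ioo] with s hs
  exact hC s (Ioo_subset_Icc_self hs)

theorem MeasureTheory.MemLp.continuousOn_mul {F f : ℝ → ℝ} (hf : MemLp f q (intervalMeasure L))
    (hF : ContinuousOn F (Icc 0 L)) : MemLp (fun s => F s * f s) q (intervalMeasure L) :=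
  hf.mul (memLp_of_continuousOn_Icc (q := ∞) hF)

theorem AdmissibleCoeff.memLp_top {k₁ k₂ : ℝ} {k : ℝ → ℝ} (hk₁ : 0 < k₁)
    (hk : AdmissibleCoeff L k₁ k₂ k) : MemLp k ∞ (intervalMeasure L) := by
  refine memLp_top_of_bound hk.1 k₂ ?_
  filter_upwards [hk.2] with s hs
  rw [Real.norm_eq_abs, abs_of_pos (hk₁.trans_le hs.1)]
  exact hs.2

theorem AdmissibleCoeff.memLp_mul {k₁ k₂ : ℝ} {k f : ℝ → ℝ} (hk₁ : 0 < k₁)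
    (hk : AdmissibleCoeff L k₁ k₂ k) (hf : MemLp f q (intervalMeasure L)) :
    MemLp (fun s => k s * f s) q (intervalMeasure L) :=
  hf.mul (hk.memLp_top hk₁)

theorem intervalIntegrable_sq_of_memLp (hL : 0 ≤ L) {f : ℝ → ℝ}
    (hf : MemLp f 2 (intervalMeasure L)) : IntervalIntegrable (fun s => f s ^ 2) volume 0 L :=
  (intervalIntegrable_iff_integrableOn_Ioo_of_le hL).2 hf.integrable_sq

end MemLp

/-! ### H² functions as test functions -/

/-- An `H²` function: `U` with its first two derivatives. -/
structure IsH2Triple (L : ℝ) (U U₁ U₂ : ℝ → ℝ) : Prop where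
  prim : IsPrimitiveOn U U₁ 0 L
  prim₁ : IsPrimitiveOn U₁ U₂ 0 L
  memLp : MemLp U₂ 2 (intervalMeasure L)

section H2

variable {L : ℝ} {U U₁ U₂ V V₁ V₂ : ℝ → ℝ}

/-- In one dimension H² is an algebra: functions and first derivatives are continuous, so only terms
linear in a second derivative are merely L². This makes ρu admissible in the weak formulation. -/
theorem IsH2Triple.mul (h : IsH2Triple L U U₁ U₂) (h' : IsH2Triple L V V₁ V₂) :
    IsH2Triple L (fun s => U s * V s) (fun s => U₁ s * V s + U s * V₁ s)
      (fun s => U₂ s * V s + 2 * (U₁ s * V₁ s) + U s * V₂ s) where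
  prim := h.prim.mul h'.prim
  prim₁ := by
    have := (h.prim₁.mul h'.prim).add (h.prim.mul h'.prim₁)
    convert this using 2
    ring
  memLp := by
    have h1 := h.memLp.continuousOn_mul h'.prim.continuousOn
    have h2 := h'.memLp.continuousOn_mul h.prim.continuousOn
    have h3 := (memLp_of_continuousOn_Icc (q := 2)
      (h.prim₁.continuousOn.mul h'.prim₁.continuousOn)).const_mul 2
    refine MemLp.ae_eq ?_ ((h1.add h3).add h2)
    filter_upwards with s
    simp only [Pi.add_apply, Pi.mul_apply]
    ring

theorem SobolevI.exists_isH2Triple (hL : 0 < L) (u : SobolevI L 2 2) :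
    ∃ U U₁ U₂ : ℝ → ℝ, IsH2Triple L U U₁ U₂ ∧ weakDer u 0 =ᵐ[intervalMeasure L] U ∧
      weakDer u 1 =ᵐ[intervalMeasure L] U₁ ∧ weakDer u 2 =ᵐ[intervalMeasure L] U₂ := by
  obtain ⟨D, hD, hD'⟩ := SobolevI.exists_isPrimitiveOn hL u
  exact ⟨D 0, D 1, D 2, ⟨hD' 0, hD' 1, (memLp_congr_ae (hD 2)).1 (Lp.memLp _)⟩, hD 0, hD 1, hD 2⟩

theorem IsH2Triple.exists_sobolevI (h : IsH2Triple L U U₁ U₂) :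
    ∃ u : SobolevI L 2 2, weakDer u 0 =ᵐ[intervalMeasure L] U ∧
      weakDer u 1 =ᵐ[intervalMeasure L] U₁ ∧ weakDer u 2 =ᵐ[intervalMeasure L] U₂ := by
  have hD : ∀ i, MemLp ((![U, U₁, U₂] : Fin 3 → ℝ → ℝ) i) 2 (intervalMeasure L) := by
    intro i
    fin_cases i
    · exact memLp_of_continuousOn_Icc h.prim.continuousOn
    · exact memLp_of_continuousOn_Icc h.prim₁.continuousOn
    · exact h.memLp
  obtain ⟨w, hw⟩ := SobolevI.exists_of_isPrimitiveOn (![U, U₁, U₂] : Fin 3 → ℝ → ℝ) hD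
    (by intro i; fin_cases i; exacts [h.prim, h.prim₁])
  refine ⟨w, ?_, ?_, ?_⟩
  · rw [hw]; exact (hD 0).coeFn_toLp
  · rw [hw]; exact (hD 1).coeFn_toLp
  · rw [hw]; exact (hD 2).coeFn_toLp

/-- Testing the weak formulation with representatives. -/
theorem IsWeakSolution.test {k : ℝ → ℝ} {ε : ℝ} {f g : LebI L 2} {u : SobolevI L 2 2}
    (hu : IsWeakSolution L k ε f g u) (h0 : weakDer u 0 =ᵐ[intervalMeasure L] U)
    (h2 : weakDer u 2 =ᵐ[intervalMeasure L] U₂) (hV : IsH2Triple L V V₁ V₂) :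
    (∫ s in Ioo 0 L, k s * U s * V s) + ε * (∫ s in Ioo 0 L, U₂ s * V₂ s)
      = - ε * (∫ s in Ioo 0 L, f s * V₁ s) + ∫ s in Ioo 0 L, g s * V s := by
  obtain ⟨v, hv0, hv1, hv2⟩ := hV.exists_sobolevI
  have e1 : ∫ s in Ioo 0 L, k s * (weakDer u 0) s * (weakDer v 0) s
      = ∫ s in Ioo 0 L, k s * U s * V s :=
    integral_congr_ae (by filter_upwards [h0, hv0] with s hs hs'; rw [hs, hs'])
  have e2 : ∫ s in Ioo 0 L, (weakDer u 2) s * (weakDer v 2) s = ∫ s in Ioo 0 L, U₂ s * V₂ s :=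
    integral_congr_ae (by filter_upwards [h2, hv2] with s hs hs'; rw [hs, hs'])
  have e3 : ∫ s in Ioo 0 L, f s * (weakDer v 1) s = ∫ s in Ioo 0 L, f s * V₁ s :=
    integral_congr_ae (by filter_upwards [hv1] with s hs; rw [hs])
  have e4 : ∫ s in Ioo 0 L, g s * (weakDer v 0) s = ∫ s in Ioo 0 L, g s * V s :=
    integral_congr_ae (by filter_upwards [hv0] with s hs; rw [hs])
  rw [← e1, ← e2, ← e3, ← e4]
  exact hu v

end H2

/-! ### The weighted energy estimate -/

/-- A slowly varying `C²` weight with relative derivatives of size `τ` at scale `δ`. -/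
structure IsC2Weight (δ τ : ℝ) (ρ ρ₁ ρ₂ : ℝ → ℝ) : Prop extends IsSlowWeight δ ρ where
  hasDerivAt : ∀ s, HasDerivAt ρ (ρ₁ s) s
  hasDerivAt₁ : ∀ s, HasDerivAt ρ₁ (ρ₂ s) s
  continuous₂ : Continuous ρ₂
  abs_le₁ : ∀ s, δ * |ρ₁ s| ≤ τ * ρ s
  abs_le₂ : ∀ s, δ ^ 2 * |ρ₂ s| ≤ τ * ρ s

theorem IsC2Weight.isH2Triple {L δ τ : ℝ} (hL : 0 ≤ L) {ρ ρ₁ ρ₂ : ℝ → ℝ}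
    (h : IsC2Weight δ τ ρ ρ₁ ρ₂) : IsH2Triple L ρ ρ₁ ρ₂ where
  prim := IsPrimitiveOn.of_hasDerivAt hL h.hasDerivAt
    (continuous_iff_continuousAt.2 fun s => (h.hasDerivAt₁ s).continuousAt)
  prim₁ := IsPrimitiveOn.of_hasDerivAt hL h.hasDerivAt₁ h.continuous₂
  memLp := memLp_of_continuousOn_Icc h.continuous₂.continuousOn

/-- Relative size of the derivatives of the weights allowed in the energy estimate. -/
noncomputable def energyTau (L k₁ : ℝ) : ℝ := min k₁ 1 / (6 * (1 + interpConst L))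

/-- Constant of the weighted energy estimate. -/
noncomputable def energyConst (L k₁ : ℝ) : ℝ := 2 / (min k₁ 1 * energyTau L k₁)

theorem energyTau_pos {L k₁ : ℝ} (hL : 0 < L) (hk₁ : 0 < k₁) : 0 < energyTau L k₁ := by
  have := interpConst_pos hL
  unfold energyTau; positivity

theorem energyTau_le_one {L k₁ : ℝ} (hL : 0 < L) : energyTau L k₁ ≤ 1 := by
  have := interpConst_pos hL
  unfold energyTau
  rw [div_le_one (by positivity)]
  linarith [min_le_right k₁ 1]

theorem energyConst_pos {L k₁ : ℝ} (hL : 0 < L) (hk₁ : 0 < k₁) : 0 < energyConst L k₁ := by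
  have := energyTau_pos hL hk₁
  unfold energyConst; positivity

/-- Integrand-level form of testing with ρu, scaled so that δ disappears: a, b, c stand for u, δu',
δ²u'', F for δ³f, and V₀, V₁, V₂ for the equally scaled derivatives of ρu. The product-rule errors
carry a factor τ, and the data terms are split by Young's inequality with parameter τ. -/
theorem energy_pointwise {m τ k ρ a b c F g V₀ V₁ V₂ : ℝ} (hτ : 0 < τ) (hτ1 : τ ≤ 1)
    (hρ : 0 < ρ) (hk : m ≤ k) (hm : m ≤ 1) (h0 : V₀ = ρ * a) (h1 : |V₁ - ρ * b| ≤ τ * ρ * |a|)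
    (h2 : |V₂ - ρ * c| ≤ τ * ρ * |a| + 2 * (τ * ρ * |b|)) :
    m * (ρ * (a ^ 2 + c ^ 2)) - 3 * τ * (ρ * (a ^ 2 + c ^ 2) + ρ * b ^ 2)
        - 1 / τ * (ρ * (g ^ 2 + F ^ 2))
      ≤ k * a * V₀ + c * V₂ + F * V₁ - g * V₀ := by
  have y1 : ∀ x y : ℝ, |x| * |y| ≤ τ * x ^ 2 + 1 / τ * y ^ 2 / 4 := fun x y => by
    rw [← sq_abs x, ← sq_abs y]
    have : τ * |x| ^ 2 + 1 / τ * |y| ^ 2 / 4 - |x| * |y| = (2 * τ * |x| - |y|) ^ 2 / (4 * τ) := by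
      field_simp; ring
    have h : 0 ≤ (2 * τ * |x| - |y|) ^ 2 / (4 * τ) := by positivity
    linarith
  have y2 : ∀ x y : ℝ, 2 * (|x| * |y|) ≤ x ^ 2 + y ^ 2 := fun x y => by
    rw [← sq_abs x, ← sq_abs y]; nlinarith [sq_nonneg (|x| - |y|)]
  have b1 : F * V₁ ≥ - (ρ * (2 * (1 / τ * F ^ 2 / 4) + τ * a ^ 2 + τ * b ^ 2)) := by
    have e1 : |F * (V₁ - ρ * b)| ≤ ρ * (τ * a ^ 2 + 1 / τ * F ^ 2 / 4) := by
      rw [abs_mul]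
      calc |F| * |V₁ - ρ * b| ≤ |F| * (τ * ρ * |a|) := by gcongr
        _ = τ * (ρ * (|a| * |F|)) := by ring
        _ ≤ 1 * (ρ * (|a| * |F|)) := by gcongr
        _ ≤ ρ * (τ * a ^ 2 + 1 / τ * F ^ 2 / 4) := by rw [one_mul]; gcongr; exact y1 a F
    have e2 : |F * (ρ * b)| ≤ ρ * (τ * b ^ 2 + 1 / τ * F ^ 2 / 4) := by
      rw [abs_mul, abs_mul, abs_of_pos hρ]
      calc |F| * (ρ * |b|) = ρ * (|b| * |F|) := by ring
        _ ≤ _ := by gcongr; exact y1 b F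
    have := neg_abs_le (F * (V₁ - ρ * b))
    have := neg_abs_le (F * (ρ * b))
    have : F * V₁ = F * (V₁ - ρ * b) + F * (ρ * b) := by ring
    linarith
  have b2 : c * V₂ ≥ ρ * c ^ 2 - ρ * (τ * (a ^ 2 + c ^ 2) / 2 + τ * (b ^ 2 + c ^ 2)) := by
    have e1 : |c * (V₂ - ρ * c)| ≤ ρ * (τ * (a ^ 2 + c ^ 2) / 2 + τ * (b ^ 2 + c ^ 2)) := by
      rw [abs_mul]
      calc |c| * |V₂ - ρ * c| ≤ |c| * (τ * ρ * |a| + 2 * (τ * ρ * |b|)) := by gcongr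
        _ = ρ * (τ * (2 * (|a| * |c|)) / 2 + τ * (2 * (|b| * |c|))) := by ring
        _ ≤ _ := by
          gcongr
          · exact y2 a c
          · exact y2 b c
    have := neg_abs_le (c * (V₂ - ρ * c))
    have : c * V₂ = c * (V₂ - ρ * c) + ρ * c ^ 2 := by ring
    linarith
  have b3 : g * V₀ ≤ ρ * (τ * a ^ 2 + 1 / τ * g ^ 2 / 4) := by
    rw [h0]
    have h := le_abs_self (g * a)
    rw [abs_mul, mul_comm] at h
    calc g * (ρ * a) = ρ * (g * a) := by ring
      _ ≤ _ := by gcongr; linarith [y1 a g]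
  have b4 : k * a * V₀ ≥ m * (ρ * a ^ 2) := by
    rw [h0, show k * a * (ρ * a) = k * (ρ * a ^ 2) by ring]
    exact mul_le_mul_of_nonneg_right hk (by positivity)
  have b5 : m * (ρ * c ^ 2) ≤ ρ * c ^ 2 := by
    have : 0 ≤ ρ * c ^ 2 := by positivity
    nlinarith
  have p1 : 0 ≤ ρ * τ * a ^ 2 := by positivity
  have p2 : 0 ≤ ρ * τ * b ^ 2 := by positivity
  have p3 : 0 ≤ ρ * τ * c ^ 2 := by positivity
  have p4 : 0 ≤ ρ * (1 / τ) * F ^ 2 := by positivity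
  have p5 : 0 ≤ ρ * (1 / τ) * g ^ 2 := by positivity
  nlinarith

/-- The weighted energy estimate. -/
theorem IsWeakSolution.weighted_energy {L k₁ k₂ δ : ℝ} {k : ℝ → ℝ} (hL : 0 < L) (hk₁ : 0 < k₁)
    (hk : AdmissibleCoeff L k₁ k₂ k) (hδ : 0 < δ) (hδ1 : δ ≤ 1) {f g : LebI L 2}
    {u : SobolevI L 2 2} (hu : IsWeakSolution L k (δ ^ 4) f g u) {U U₁ U₂ : ℝ → ℝ}
    (hU : IsH2Triple L U U₁ U₂) (h0 : weakDer u 0 =ᵐ[intervalMeasure L] U)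
    (h2 : weakDer u 2 =ᵐ[intervalMeasure L] U₂) {ρ ρ₁ ρ₂ : ℝ → ℝ}
    (hρ : IsC2Weight δ (energyTau L k₁) ρ ρ₁ ρ₂) :
    ∫ s in Ioo 0 L, ρ s * (U s ^ 2 + δ ^ 4 * U₂ s ^ 2)
      ≤ energyConst L k₁ * ∫ s in Ioo 0 L, ρ s * (g s ^ 2 + δ ^ 6 * f s ^ 2) := by
  have hρH := hρ.isH2Triple (L := L) hL.le
  have hV := hρH.mul hU
  have test := hu.test h0 h2 hV
  set m := min k₁ 1 with hm
  have hmpos : 0 < m := lt_min hk₁ one_pos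
  set τ := energyTau L k₁ with hτdef
  have hτ : 0 < τ := energyTau_pos hL hk₁
  have hρc : ContinuousOn ρ (Icc 0 L) := hρ.continuous.continuousOn
  have cU := hU.prim.continuousOn
  have cU1 := hU.prim₁.continuousOn
  have mU : MemLp U 2 (intervalMeasure L) := memLp_of_continuousOn_Icc cU
  have mU1 : MemLp U₁ 2 (intervalMeasure L) := memLp_of_continuousOn_Icc cU1
  have mf := Lp.memLp f
  have mg := Lp.memLp g
  have mV : MemLp _ 2 (intervalMeasure L) := memLp_of_continuousOn_Icc (q := 2) hV.prim.continuousOn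
  have mV1 : MemLp _ 2 (intervalMeasure L) :=
    memLp_of_continuousOn_Icc (q := 2) hV.prim₁.continuousOn
  have i1 := (hk.memLp_mul hk₁ mU).integrable_mul_of_two mV
  have i2 := hU.memLp.integrable_mul_of_two hV.memLp
  have i3 := mf.integrable_mul_of_two mV1
  have i4 := mg.integrable_mul_of_two mV
  have wint : ∀ {h : ℝ → ℝ}, MemLp h 2 (intervalMeasure L) →
      Integrable (fun s => ρ s * h s ^ 2) (intervalMeasure L) := fun {h} hh => by
    have := (hh.continuousOn_mul hρc).integrable_mul_of_two hh
    simpa [pow_two, mul_assoc] using this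
  have iP : Integrable (fun s => ρ s * (U s ^ 2 + δ ^ 4 * U₂ s ^ 2)) (intervalMeasure L) := by
    refine ((wint mU).add ((wint hU.memLp).const_mul (δ ^ 4))).congr ?_
    filter_upwards with s
    simp only [Pi.add_apply]; ring
  have iR : Integrable (fun s => ρ s * (g s ^ 2 + δ ^ 6 * f s ^ 2)) (intervalMeasure L) := by
    refine ((wint mg).add ((wint mf).const_mul (δ ^ 6))).congr ?_
    filter_upwards with s
    simp only [Pi.add_apply]; ring
  have iQ := wint mU1
  have interp := hρ.toIsSlowWeight.integral_deriv_sq_le hL hδ hδ1 hU.prim hU.prim₁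
    (intervalIntegrable_sq_of_memLp hL.le hU.memLp)
  rw [← setIntegral_Ioo_eq hL.le, ← setIntegral_Ioo_eq hL.le] at interp
  have pt := integral_mono_ae
    (((iP.const_mul m).sub ((iP.add (iQ.const_mul (δ ^ 2))).const_mul (3 * τ))).sub
      (iR.const_mul (1 / τ)))
    (((i1.add (i2.const_mul (δ ^ 4))).add (i3.const_mul (δ ^ 4))).sub i4) (by
      filter_upwards [hk.2] with s hs
      have hρs := hρ.pos s
      have e := energy_pointwise (m := m) (τ := τ) (k := k s) (ρ := ρ s) (a := U s)
        (b := δ * U₁ s) (c := δ ^ 2 * U₂ s) (F := δ ^ 3 * f s) (g := g s) (V₀ := ρ s * U s)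
        (V₁ := δ * (ρ₁ s * U s + ρ s * U₁ s))
        (V₂ := δ ^ 2 * (ρ₂ s * U s + 2 * (ρ₁ s * U₁ s) + ρ s * U₂ s)) hτ
        (energyTau_le_one hL) hρs ((min_le_left _ _).trans hs.1) (min_le_right _ _) rfl
        (by
          rw [show δ * (ρ₁ s * U s + ρ s * U₁ s) - ρ s * (δ * U₁ s) = δ * ρ₁ s * U s by ring,
            abs_mul, abs_mul, abs_of_pos hδ]
          exact mul_le_mul_of_nonneg_right (hρ.abs_le₁ s) (abs_nonneg _))
        (by
          rw [show δ ^ 2 * (ρ₂ s * U s + 2 * (ρ₁ s * U₁ s) + ρ s * U₂ s) - ρ s * (δ ^ 2 * U₂ s)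
            = δ ^ 2 * ρ₂ s * U s + 2 * ((δ * ρ₁ s) * (δ * U₁ s)) by ring]
          refine (abs_add_le _ _).trans ?_
          rw [abs_mul, abs_mul, abs_mul 2, abs_mul (δ * ρ₁ s), abs_mul δ (ρ₁ s),
            abs_of_pos hδ, abs_of_pos (pow_pos hδ 2), abs_two]
          have := hρ.abs_le₁ s
          have := hρ.abs_le₂ s
          gcongr)
      simp only [Pi.add_apply, Pi.sub_apply]
      refine le_trans (le_of_eq ?_) (e.trans (le_of_eq ?_)) <;> ring)
  simp only [Pi.add_apply, Pi.sub_apply] at pt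
  have eL : ∫ s in Ioo 0 L, (m * (ρ s * (U s ^ 2 + δ ^ 4 * U₂ s ^ 2))
      - 3 * τ * (ρ s * (U s ^ 2 + δ ^ 4 * U₂ s ^ 2) + δ ^ 2 * (ρ s * U₁ s ^ 2))
      - 1 / τ * (ρ s * (g s ^ 2 + δ ^ 6 * f s ^ 2)))
      = m * (∫ s in Ioo 0 L, ρ s * (U s ^ 2 + δ ^ 4 * U₂ s ^ 2))
        - 3 * τ * ((∫ s in Ioo 0 L, ρ s * (U s ^ 2 + δ ^ 4 * U₂ s ^ 2))
          + δ ^ 2 * ∫ s in Ioo 0 L, ρ s * U₁ s ^ 2)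
        - 1 / τ * ∫ s in Ioo 0 L, ρ s * (g s ^ 2 + δ ^ 6 * f s ^ 2) := by
    rw [integral_sub, integral_sub, integral_const_mul, integral_const_mul, integral_const_mul,
      integral_add, integral_const_mul]
    exacts [iP, iQ.const_mul _, iP.const_mul _, (iP.add (iQ.const_mul _)).const_mul _,
      (iP.const_mul m).sub ((iP.add (iQ.const_mul _)).const_mul _), iR.const_mul _]
  have eR : ∫ s in Ioo 0 L, (k s * U s * (ρ s * U s)
      + δ ^ 4 * (U₂ s * (ρ₂ s * U s + 2 * (ρ₁ s * U₁ s) + ρ s * U₂ s))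
      + δ ^ 4 * (f s * (ρ₁ s * U s + ρ s * U₁ s)) - g s * (ρ s * U s))
      = (∫ s in Ioo 0 L, k s * U s * (ρ s * U s))
        + δ ^ 4 * (∫ s in Ioo 0 L, U₂ s * (ρ₂ s * U s + 2 * (ρ₁ s * U₁ s) + ρ s * U₂ s))
        + δ ^ 4 * (∫ s in Ioo 0 L, f s * (ρ₁ s * U s + ρ s * U₁ s))
        - ∫ s in Ioo 0 L, g s * (ρ s * U s) := by
    rw [integral_sub, integral_add, integral_add, integral_const_mul, integral_const_mul]
    exacts [i1, i2.const_mul _, i1.add (i2.const_mul _), i3.const_mul _,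
      (i1.add (i2.const_mul _)).add (i3.const_mul _), i4]
  rw [eL, eR] at pt
  have hC0 := interpConst_pos hL
  -- The choice of `energyTau`: by interpolation the error terms are at most 3τ(1 + `interpConst
  -- L`)P, exactly half of the coercive term mP.
  have hmτ : 3 * τ * (1 + interpConst L) = m / 2 := by
    rw [hτdef, energyTau, ← hm]; field_simp; ring
  have hP : 0 ≤ ∫ s in Ioo 0 L, ρ s * (U s ^ 2 + δ ^ 4 * U₂ s ^ 2) :=
    integral_nonneg fun s => mul_nonneg (hρ.pos s).le (by positivity)
  rw [energyConst, ← hm, ← hτdef, div_mul_eq_mul_div, le_div_iff₀ (by positivity)]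
  set P := ∫ s in Ioo 0 L, ρ s * (U s ^ 2 + δ ^ 4 * U₂ s ^ 2)
  set R := ∫ s in Ioo 0 L, ρ s * (g s ^ 2 + δ ^ 6 * f s ^ 2)
  set Q := ∫ s in Ioo 0 L, ρ s * U₁ s ^ 2
  have f1 : m * P - 3 * τ * (P + δ ^ 2 * Q) - 1 / τ * R ≤ 0 := by linarith
  have f2 : 3 * τ * (δ ^ 2 * Q) ≤ 3 * τ * (interpConst L * P) := by gcongr
  have f3 : m / 2 * P ≤ 1 / τ * R := by nlinarith
  have f4 := mul_le_mul_of_nonneg_left f3 hτ.le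
  have f5 : τ * (1 / τ * R) = R := by field_simp
  linarith

/-! ### Well-posedness: completeness, unweighted energy, Lax–Milgram -/

section Existence

/-- The `i`-th weak derivative as a continuous linear map. -/
noncomputable def weakDerL (L : ℝ) (m : ℕ) (q : ℝ≥0∞) [Fact (1 ≤ q)] (i : Fin (m + 1)) :
    SobolevI L m q →L[ℝ] LebI L q :=
  (PiLp.proj (𝕜 := ℝ) q (fun _ : Fin (m + 1) => LebI L q) i).comp (SobolevI L m q).subtypeL

/-- The pairing `(f, g) ↦ ∫_I f g` on `L²(I)`. -/
noncomputable def l2Pairing (L : ℝ) : LebI L 2 →L[ℝ] LebI L 2 →L[ℝ] ℝ :=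
  (ContinuousLinearMap.mul ℝ ℝ).lpPairing (intervalMeasure L) 2 2

theorem l2Pairing_apply {L : ℝ} (f g : LebI L 2) :
    l2Pairing L f g = ∫ s in Ioo 0 L, f s * g s := by
  rw [l2Pairing, ContinuousLinearMap.lpPairing_eq_integral]
  rfl

/-- Multiplication by an admissible coefficient on `L²(I)`. -/
theorem AdmissibleCoeff.exists_mulL {L k₁ k₂ : ℝ} {k : ℝ → ℝ} (hk₁ : 0 < k₁)
    (hk : AdmissibleCoeff L k₁ k₂ k) :
    ∃ M : LebI L 2 →L[ℝ] LebI L 2, ∀ f, M f =ᵐ[intervalMeasure L] fun s => k s * f s := by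
  have h := hk.memLp_top hk₁
  refine ⟨(ContinuousLinearMap.mul ℝ ℝ).holderL (intervalMeasure L) ∞ 2 2 (h.toLp k), fun f => ?_⟩
  filter_upwards [(ContinuousLinearMap.mul ℝ ℝ).coeFn_holder (r := 2) (h.toLp k) f,
    h.coeFn_toLp] with s h1 h2
  rw [h2] at h1
  exact h1

instance SobolevI.instCompleteSpace (L : ℝ) (m : ℕ) : CompleteSpace (SobolevI L m 2) := by
  have : IsClosed (SobolevI L m 2 : Set (PiLp 2 (fun _ : Fin (m + 1) => LebI L 2))) := by
    -- Each test function contributes one condition that is continuous in the tuple, so the space is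
    -- an intersection of closed sets.
    have e : (SobolevI L m 2 : Set (PiLp 2 (fun _ : Fin (m + 1) => LebI L 2)))
        = ⋂ (i : Fin m) (φ : {φ : ℝ → ℝ // ContDiff ℝ ∞ φ ∧ HasCompactSupport φ ∧
            tsupport φ ⊆ Ioo 0 L}),
          {D | ∫ s in Ioo 0 L, (D i.castSucc) s * deriv φ.1 s
            = - ∫ s in Ioo 0 L, (D i.succ) s * φ.1 s} := by
      ext D
      simp only [mem_iInter, Subtype.forall]
      exact ⟨fun h i φ hφ => h i φ hφ.1 hφ.2.1 hφ.2.2, fun h i φ h1 h2 h3 => h i φ ⟨h1, h2, h3⟩⟩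
    have cont : ∀ (j : Fin (m + 1)) {ψ : ℝ → ℝ}, Continuous ψ →
        Continuous fun D : PiLp 2 (fun _ : Fin (m + 1) => LebI L 2) =>
          ∫ s in Ioo 0 L, (D j) s * ψ s := by
      intro j ψ hψ
      have hm := memLp_of_continuousOn_Icc (L := L) (q := 2) hψ.continuousOn
      have : (fun D : PiLp 2 (fun _ : Fin (m + 1) => LebI L 2) =>
          ∫ s in Ioo 0 L, (D j) s * ψ s) = fun D => l2Pairing L (D j) (hm.toLp ψ) := by
        funext D
        rw [l2Pairing_apply]
        refine integral_congr_ae ?_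
        filter_upwards [hm.coeFn_toLp] with s hs
        rw [hs]
      rw [this]
      have hp : Continuous fun D : PiLp 2 (fun _ : Fin (m + 1) => LebI L 2) => D j :=
        (PiLp.proj (𝕜 := ℝ) 2 (fun _ : Fin (m + 1) => LebI L 2) j).continuous
      exact ((l2Pairing L).flip (hm.toLp ψ)).continuous.comp hp
    rw [e]
    refine isClosed_iInter fun i => isClosed_iInter fun φ => ?_
    exact isClosed_eq (cont _ (φ.2.1.continuous_deriv (by simp)))
      (cont _ φ.2.1.continuous).neg
  exact this.completeSpace_coe

/-- Specialises every weighted inequality to its unweighted form, at any scale. -/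
theorem isC2Weight_one {δ τ : ℝ} (hτ : 0 ≤ τ) : IsC2Weight δ τ (fun _ => 1) (fun _ => 0)
    (fun _ => 0) where
  continuous := continuous_const
  pos _ := one_pos
  le _ _ _ := by norm_num
  hasDerivAt s := hasDerivAt_const s 1
  hasDerivAt₁ s := hasDerivAt_const s 0
  continuous₂ := continuous_const
  abs_le₁ _ := by simpa using hτ
  abs_le₂ _ := by simpa using hτ

variable {L : ℝ}

theorem norm_sq_weakDer {u : SobolevI L 2 2} {i : Fin 3} {U : ℝ → ℝ}
    (h : weakDer u i =ᵐ[intervalMeasure L] U) :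
    ‖weakDer u i‖ ^ 2 = ∫ s in Ioo 0 L, U s ^ 2 := by
  rw [Lp.norm_sq_eq_integral]
  exact integral_congr_ae (by filter_upwards [h] with s hs; rw [hs])

theorem integral_add_pow_mul_sq {δ : ℝ} {n : ℕ} {f g : ℝ → ℝ} (hf : MemLp f 2 (intervalMeasure L))
    (hg : MemLp g 2 (intervalMeasure L)) :
    ∫ s in Ioo 0 L, (f s ^ 2 + δ ^ n * g s ^ 2)
      = (∫ s in Ioo 0 L, f s ^ 2) + δ ^ n * ∫ s in Ioo 0 L, g s ^ 2 := by
  rw [integral_add hf.integrable_sq (hg.integrable_sq.const_mul _), integral_const_mul]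

/-- Interpolation of the first derivative in `H²(I)`. -/
theorem SobolevI.norm_weakDer_one_sq_le (hL : 0 < L) {δ : ℝ} (hδ : 0 < δ) (hδ1 : δ ≤ 1)
    (u : SobolevI L 2 2) :
    δ ^ 2 * ‖weakDer u 1‖ ^ 2
      ≤ interpConst L * (‖weakDer u 0‖ ^ 2 + δ ^ 4 * ‖weakDer u 2‖ ^ 2) := by
  obtain ⟨U, U₁, U₂, hU, h0, h1, h2⟩ := SobolevI.exists_isH2Triple hL u
  have := (isC2Weight_one (δ := δ) le_rfl).toIsSlowWeight.integral_deriv_sq_le hL hδ hδ1 hU.prim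
    hU.prim₁ (intervalIntegrable_sq_of_memLp hL.le hU.memLp)
  simp only [one_mul] at this
  rw [← setIntegral_Ioo_eq hL.le, ← setIntegral_Ioo_eq hL.le, integral_add_pow_mul_sq
    (memLp_of_continuousOn_Icc hU.prim.continuousOn) hU.memLp] at this
  rwa [norm_sq_weakDer h0, norm_sq_weakDer h1, norm_sq_weakDer h2]

/-- Constant of the energy estimate without weight. -/
noncomputable def resolventConst (L k₁ : ℝ) : ℝ := (1 + interpConst L) * energyConst L k₁

theorem resolventConst_pos {k₁ : ℝ} (hL : 0 < L) (hk₁ : 0 < k₁) : 0 < resolventConst L k₁ := by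
  have := interpConst_pos hL
  have := energyConst_pos hL hk₁
  unfold resolventConst; positivity

variable {k₁ k₂ : ℝ} {k : ℝ → ℝ}

/-- The weight 1 in the weighted estimate covers orders 0 and 2; interpolation supplies order 1. -/
theorem IsWeakSolution.energy (hL : 0 < L) (hk₁ : 0 < k₁)
    (hk : AdmissibleCoeff L k₁ k₂ k) {δ : ℝ} (hδ : 0 < δ) (hδ1 : δ ≤ 1) {f g : LebI L 2}
    {u : SobolevI L 2 2} (hu : IsWeakSolution L k (δ ^ 4) f g u) (j : Fin 3) :
    (δ ^ (j : ℕ) * ‖weakDer u j‖) ^ 2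
      ≤ resolventConst L k₁ * (‖g‖ ^ 2 + δ ^ 6 * ‖f‖ ^ 2) := by
  obtain ⟨U, U₁, U₂, hU, h0, h1, h2⟩ := SobolevI.exists_isH2Triple hL u
  have key := hu.weighted_energy hL hk₁ hk hδ hδ1 hU h0 h2
    (isC2Weight_one (energyTau_pos hL hk₁).le)
  simp only [one_mul] at key
  rw [integral_add_pow_mul_sq (memLp_of_continuousOn_Icc hU.prim.continuousOn) hU.memLp,
    integral_add_pow_mul_sq (Lp.memLp g) (Lp.memLp f), ← norm_sq_weakDer h0,
    ← norm_sq_weakDer h2, ← Lp.norm_sq_eq_integral, ← Lp.norm_sq_eq_integral] at key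
  have k1 := SobolevI.norm_weakDer_one_sq_le hL hδ hδ1 u
  have hC := interpConst_pos hL
  set E := ‖weakDer u 0‖ ^ 2 + δ ^ 4 * ‖weakDer u 2‖ ^ 2 with hE
  have hE0 : 0 ≤ E := by positivity
  have hEC : (1 + interpConst L) * E ≤ resolventConst L k₁ * (‖g‖ ^ 2 + δ ^ 6 * ‖f‖ ^ 2) := by
    rw [resolventConst, mul_assoc]; gcongr
  refine le_trans ?_ hEC
  have a0 : 0 ≤ ‖weakDer u 0‖ ^ 2 := by positivity
  have a2 : 0 ≤ δ ^ 4 * ‖weakDer u 2‖ ^ 2 := by positivity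
  have a3 : 0 ≤ interpConst L * E := by positivity
  rw [mul_pow, one_add_mul]
  fin_cases j
  · change (δ ^ 0) ^ 2 * ‖weakDer u 0‖ ^ 2 ≤ _
    linarith
  · change (δ ^ 1) ^ 2 * ‖weakDer u 1‖ ^ 2 ≤ _
    linarith
  · change (δ ^ 2) ^ 2 * ‖weakDer u 2‖ ^ 2 ≤ _
    rw [← pow_mul, show 2 * 2 = 4 from rfl]
    linarith

/-- The weak formulation as an identity between bounded bilinear forms. -/
theorem isWeakSolution_iff_pairing {M : LebI L 2 →L[ℝ] LebI L 2}
    (hM : ∀ f, M f =ᵐ[intervalMeasure L] fun s => k s * f s) {ε : ℝ} {f g : LebI L 2}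
    {u : SobolevI L 2 2} : IsWeakSolution L k ε f g u ↔ ∀ v : SobolevI L 2 2,
      l2Pairing L (M (weakDer u 0)) (weakDer v 0) + ε * l2Pairing L (weakDer u 2) (weakDer v 2)
        = -ε * l2Pairing L f (weakDer v 1) + l2Pairing L g (weakDer v 0) := by
  refine forall_congr' fun v => ?_
  simp only [l2Pairing_apply]
  have : ∫ s in Ioo 0 L, M (weakDer u 0) s * (weakDer v 0) s
      = ∫ s in Ioo 0 L, k s * (weakDer u 0) s * (weakDer v 0) s :=
    integral_congr_ae (by filter_upwards [hM (weakDer u 0)] with s hs; rw [hs])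
  rw [this]

theorem IsWeakSolution.add (hk₁ : 0 < k₁) (hk : AdmissibleCoeff L k₁ k₂ k) {ε : ℝ}
    {f g f' g' : LebI L 2} {u u' : SobolevI L 2 2} (hu : IsWeakSolution L k ε f g u)
    (hu' : IsWeakSolution L k ε f' g' u') : IsWeakSolution L k ε (f + f') (g + g') (u + u') := by
  obtain ⟨M, hM⟩ := hk.exists_mulL hk₁
  rw [isWeakSolution_iff_pairing hM] at hu hu' ⊢
  intro v
  simp only [weakDer_add, map_add, add_apply]
  linear_combination hu v + hu' v

theorem IsWeakSolution.smul (hk₁ : 0 < k₁) (hk : AdmissibleCoeff L k₁ k₂ k) {ε : ℝ}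
    {f g : LebI L 2} {u : SobolevI L 2 2} (hu : IsWeakSolution L k ε f g u) (c : ℝ) :
    IsWeakSolution L k ε (c • f) (c • g) (c • u) := by
  obtain ⟨M, hM⟩ := hk.exists_mulL hk₁
  rw [isWeakSolution_iff_pairing hM] at hu ⊢
  intro v
  simp only [weakDer_smul, map_smul, smul_apply, smul_eq_mul]
  linear_combination c * hu v

theorem IsWeakSolution.unique (hL : 0 < L) (hk₁ : 0 < k₁) (hk : AdmissibleCoeff L k₁ k₂ k)
    {δ : ℝ} (hδ : 0 < δ) (hδ1 : δ ≤ 1) {f g : LebI L 2} {u u' : SobolevI L 2 2}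
    (hu : IsWeakSolution L k (δ ^ 4) f g u) (hu' : IsWeakSolution L k (δ ^ 4) f g u') :
    u = u' := by
  have h := hu.add hk₁ hk (hu'.smul hk₁ hk (-1))
  have e := h.energy hL hk₁ hk hδ hδ1 0
  simp only [neg_smul, one_smul, add_neg_cancel, norm_zero] at e
  refine SobolevI.ext_of_weakDer_zero ?_
  have : ‖weakDer (u + -u') 0‖ ^ 2 ≤ 0 := by simpa using e
  have := norm_eq_zero.1 (pow_eq_zero_iff two_ne_zero |>.1 (this.antisymm (sq_nonneg _)))
  rwa [← sub_eq_add_neg, weakDer_sub, sub_eq_zero] at this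

/-- Existence of weak solutions, by the Lax–Milgram theorem. -/
theorem exists_isWeakSolution (hL : 0 < L) (hk₁ : 0 < k₁) (hk : AdmissibleCoeff L k₁ k₂ k)
    {ε : ℝ} (hε : 0 < ε) (f g : LebI L 2) : ∃ u : SobolevI L 2 2, IsWeakSolution L k ε f g u := by
  obtain ⟨M, hM⟩ := hk.exists_mulL hk₁
  let B : SobolevI L 2 2 →L[ℝ] SobolevI L 2 2 →L[ℝ] ℝ :=
    (l2Pairing L).bilinearComp (M.comp (weakDerL L 2 2 0)) (weakDerL L 2 2 0)
      + ε • (l2Pairing L).bilinearComp (weakDerL L 2 2 2) (weakDerL L 2 2 2)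
  let ℓ : SobolevI L 2 2 →L[ℝ] ℝ :=
    (-ε) • (l2Pairing L f).comp (weakDerL L 2 2 1) + (l2Pairing L g).comp (weakDerL L 2 2 0)
  -- The coercivity constant degenerates as ε → 0, which is harmless: it serves existence only. The
  -- missing u' term is recovered by interpolation at scale 1.
  have hB : IsCoercive B := by
    set c := min k₁ ε with hc
    have hcpos : 0 < c := lt_min hk₁ hε
    have hC := interpConst_pos hL
    refine ⟨c / (3 * (1 + interpConst L)), by positivity, fun u => ?_⟩
    have h1 := SobolevI.norm_weakDer_one_sq_le hL one_pos le_rfl u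
    have e : B u u = l2Pairing L (M (weakDer u 0)) (weakDer u 0)
        + ε * l2Pairing L (weakDer u 2) (weakDer u 2) := rfl
    have e2 : l2Pairing L (weakDer u 2) (weakDer u 2) = ‖weakDer u 2‖ ^ 2 := by
      rw [l2Pairing_apply, Lp.norm_sq_eq_integral]; simp [pow_two]
    have e1 : k₁ * ‖weakDer u 0‖ ^ 2 ≤ l2Pairing L (M (weakDer u 0)) (weakDer u 0) := by
      rw [l2Pairing_apply, Lp.norm_sq_eq_integral, ← integral_const_mul]
      refine integral_mono_ae ((Lp.memLp _).integrable_sq.const_mul _)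
        ((Lp.memLp _).integrable_mul_of_two (Lp.memLp _)) ?_
      filter_upwards [hk.2, hM (weakDer u 0)] with s hs hs'
      rw [hs', mul_assoc, ← pow_two]
      exact mul_le_mul_of_nonneg_right hs.1 (sq_nonneg _)
    have n := SobolevI.norm_le_sum u
    rw [Fin.sum_univ_three] at n
    have n2 : ‖u‖ ^ 2 ≤ 3 * (‖weakDer u 0‖ ^ 2 + ‖weakDer u 1‖ ^ 2 + ‖weakDer u 2‖ ^ 2) := by
      refine (pow_le_pow_left₀ (norm_nonneg _) n 2).trans ?_
      nlinarith [sq_nonneg (‖weakDer u 0‖ - ‖weakDer u 1‖),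
        sq_nonneg (‖weakDer u 0‖ - ‖weakDer u 2‖), sq_nonneg (‖weakDer u 1‖ - ‖weakDer u 2‖)]
    have c1 : c * ‖weakDer u 0‖ ^ 2 ≤ k₁ * ‖weakDer u 0‖ ^ 2 := by
      gcongr; exact min_le_left _ _
    have c2 : c * ‖weakDer u 2‖ ^ 2 ≤ ε * ‖weakDer u 2‖ ^ 2 := by
      gcongr; exact min_le_right _ _
    have n3 : ‖u‖ ^ 2 ≤ 3 * (1 + interpConst L) * (‖weakDer u 0‖ ^ 2 + ‖weakDer u 2‖ ^ 2) := by
      linarith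
    rw [e, e2, mul_assoc, ← pow_two, div_mul_eq_mul_div, div_le_iff₀ (by positivity)]
    calc c * ‖u‖ ^ 2
        ≤ c * (3 * (1 + interpConst L) * (‖weakDer u 0‖ ^ 2 + ‖weakDer u 2‖ ^ 2)) := by gcongr
      _ = (c * ‖weakDer u 0‖ ^ 2 + c * ‖weakDer u 2‖ ^ 2) * (3 * (1 + interpConst L)) := by ring
      _ ≤ _ := by
        gcongr
        exact c1.trans e1
  let w := (InnerProductSpace.toDual ℝ (SobolevI L 2 2)).symm ℓ
  refine ⟨hB.continuousLinearEquivOfBilin.symm w, (isWeakSolution_iff_pairing hM).2 fun v => ?_⟩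
  have h1 := hB.continuousLinearEquivOfBilin_apply (hB.continuousLinearEquivOfBilin.symm w) v
  rw [ContinuousLinearEquiv.apply_symm_apply, InnerProductSpace.toDual_symm_apply] at h1
  exact h1.symm

theorem isWeakSolution_resolventOp (hL : 0 < L) (hk₁ : 0 < k₁) (hk : AdmissibleCoeff L k₁ k₂ k)
    {ε : ℝ} (hε : 0 < ε) (f g : LebI L 2) :
    IsWeakSolution L k ε f g (resolventOp L k ε f g) :=
  Classical.epsilon_spec (exists_isWeakSolution hL hk₁ hk hε f g)

end Existence

/-! ### From weak to strong solutions -/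

section Regularity

variable {L k₁ k₂ : ℝ} {k : ℝ → ℝ}

theorem intervalIntegrable_of_memLp (hL : 0 ≤ L) {f : ℝ → ℝ} {q : ℝ≥0∞} (hq : 1 ≤ q)
    (hf : MemLp f q (intervalMeasure L)) : IntervalIntegrable f volume 0 L :=
  (intervalIntegrable_iff_integrableOn_Ioo_of_le hL).2 (hf.integrable hq)

/-- A primitive vanishing at the right end point. -/
theorem exists_isPrimitiveOn_right_zero (hL : 0 ≤ L) {f : ℝ → ℝ}
    (hf : IntervalIntegrable f volume 0 L) :
    ∃ F : ℝ → ℝ, IsPrimitiveOn F f 0 L ∧ F L = 0 := by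
  refine ⟨fun t => (∫ s in 0..t, f s) + -∫ s in 0..L, f s, ?_, by simp⟩
  simpa using (IsPrimitiveOn.of_intervalIntegrable hL hf).add
    (IsPrimitiveOn.const hL (-∫ s in 0..L, f s))

/-- A function `V ∈ H²(I)` with `V'' = ψ` and `V(0) = V'(0) = 0`. -/
theorem exists_isH2Triple_of_memLp (hL : 0 ≤ L) {ψ : ℝ → ℝ}
    (hψ : MemLp ψ 2 (intervalMeasure L)) :
    ∃ V V₁ : ℝ → ℝ, IsH2Triple L V V₁ ψ ∧ V 0 = 0 ∧ V₁ 0 = 0 := by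
  have h1 := IsPrimitiveOn.of_intervalIntegrable hL
    (intervalIntegrable_of_memLp hL (by norm_num) hψ)
  have h0 := IsPrimitiveOn.of_intervalIntegrable hL
    (h1.continuousOn.intervalIntegrable_of_Icc hL)
  exact ⟨_, _, ⟨h0, h1, hψ⟩, by simp, by simp⟩

/-- `U` solves `k U + ε U'''' = ε F' + g` almost everywhere, with integrable `F'`; the functions
`U, U₁, U₂, U₃` are successive primitives and `F₁` stands for `F'`. -/
structure IsStrongSolution (L : ℝ) (k : ℝ → ℝ) (ε : ℝ) (F₁ g U U₁ U₂ U₃ : ℝ → ℝ) : Prop where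
  prim : IsPrimitiveOn U U₁ 0 L
  prim₁ : IsPrimitiveOn U₁ U₂ 0 L
  prim₂ : IsPrimitiveOn U₂ U₃ 0 L
  prim₃ : IsPrimitiveOn U₃ (fun s => F₁ s + ε⁻¹ * (g s - k s * U s)) 0 L

theorem IsStrongSolution.isH2Triple {ε : ℝ} {F₁ g U U₁ U₂ U₃ : ℝ → ℝ}
    (h : IsStrongSolution L k ε F₁ g U U₁ U₂ U₃) : IsH2Triple L U U₁ U₂ :=
  ⟨h.prim, h.prim₁, memLp_of_continuousOn_Icc h.prim₂.continuousOn⟩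

/-- Regularity of weak solutions. -/
theorem IsWeakSolution.exists_isStrongSolution (hL : 0 < L) (hk₁ : 0 < k₁)
    (hk : AdmissibleCoeff L k₁ k₂ k) {ε : ℝ} (hε : 0 < ε) {f g : LebI L 2} {u : SobolevI L 2 2}
    (hu : IsWeakSolution L k ε f g u) {F F₁ : ℝ → ℝ} (hF : IsPrimitiveOn F F₁ 0 L)
    (hfF : f =ᵐ[intervalMeasure L] F) :
    ∃ U U₁ U₂ U₃ : ℝ → ℝ, IsStrongSolution L k ε F₁ g U U₁ U₂ U₃ ∧
      weakDer u 0 =ᵐ[intervalMeasure L] U ∧ weakDer u 1 =ᵐ[intervalMeasure L] U₁ ∧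
      weakDer u 2 =ᵐ[intervalMeasure L] U₂ := by
  obtain ⟨U, U₁, U₂, hU, h0, h1, h2⟩ := SobolevI.exists_isH2Triple hL u
  have mU : MemLp U 2 (intervalMeasure L) := memLp_of_continuousOn_Icc hU.prim.continuousOn
  have mkU := hk.memLp_mul hk₁ mU
  have mh : MemLp (fun s => k s * U s - g s) 2 (intervalMeasure L) := mkU.sub (Lp.memLp g)
  -- H'' = kU − g and Φ' = F, normalised to vanish at L, while the test function V vanishes with V'
  -- at 0. All boundary terms drop, and the weak formulation becomes ∫ψV'' = 0 with ψ = H + εU₂ −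
  -- εΦ.
  obtain ⟨H₁, hH₁, hH₁L⟩ := exists_isPrimitiveOn_right_zero hL.le
    (intervalIntegrable_of_memLp hL.le (by norm_num) mh)
  obtain ⟨H, hH, hHL⟩ := exists_isPrimitiveOn_right_zero hL.le
    (hH₁.continuousOn.intervalIntegrable_of_Icc hL.le)
  obtain ⟨Φ, hΦ, hΦL⟩ := exists_isPrimitiveOn_right_zero hL.le
    (hF.continuousOn.intervalIntegrable_of_Icc hL.le)
  have mH : MemLp H 2 (intervalMeasure L) := memLp_of_continuousOn_Icc hH.continuousOn
  have mΦ : MemLp Φ 2 (intervalMeasure L) := memLp_of_continuousOn_Icc hΦ.continuousOn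
  have mψ : MemLp (fun s => H s + ε * U₂ s - ε * Φ s) 2 (intervalMeasure L) :=
    (mH.add (hU.memLp.const_mul ε)).sub (mΦ.const_mul ε)
  -- Choosing V'' = ψ itself gives ∫ψ² = 0. Hence U₂ = Φ − H/ε a.e., which can be differentiated
  -- twice more.
  obtain ⟨V, V₁, hV, hV0, hV10⟩ := exists_isH2Triple_of_memLp hL.le mψ
  have test := hu.test h0 h2 hV
  have mV : MemLp V 2 (intervalMeasure L) := memLp_of_continuousOn_Icc hV.prim.continuousOn
  have e1 : (∫ s in Ioo 0 L, k s * U s * V s) - ∫ s in Ioo 0 L, g s * V s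
      = ∫ s in Ioo 0 L, H s * (H s + ε * U₂ s - ε * Φ s) := by
    rw [← integral_sub (mkU.integrable_mul_of_two mV) ((Lp.memLp g).integrable_mul_of_two mV)]
    simp_rw [← sub_mul]
    have p1 := hV.prim.integral_mul_eq hH₁
    have p2 := hV.prim₁.integral_mul_eq hH
    rw [hH₁L, hV0] at p1
    rw [hHL, hV10] at p2
    rw [setIntegral_Ioo_eq hL.le, setIntegral_Ioo_eq hL.le]
    simp_rw [mul_comm _ (V _), mul_comm (H _)]
    rw [p1, p2]
    ring
  have e2 : ∫ s in Ioo 0 L, f s * V₁ s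
      = - ∫ s in Ioo 0 L, Φ s * (H s + ε * U₂ s - ε * Φ s) := by
    have p := hV.prim₁.integral_mul_eq hΦ
    rw [hΦL, hV10] at p
    have : ∫ s in Ioo 0 L, f s * V₁ s = ∫ s in Ioo 0 L, V₁ s * F s :=
      integral_congr_ae (by filter_upwards [hfF] with s hs; rw [hs, mul_comm])
    rw [this, setIntegral_Ioo_eq hL.le, setIntegral_Ioo_eq hL.le, p]
    simp_rw [mul_comm (Φ _)]
    ring
  have e3 : ∫ s in Ioo 0 L, (H s + ε * U₂ s - ε * Φ s) ^ 2 = 0 := by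
    have : ∫ s in Ioo 0 L, (H s + ε * U₂ s - ε * Φ s) ^ 2
        = (∫ s in Ioo 0 L, H s * (H s + ε * U₂ s - ε * Φ s))
          + ε * (∫ s in Ioo 0 L, U₂ s * (H s + ε * U₂ s - ε * Φ s))
          - ε * ∫ s in Ioo 0 L, Φ s * (H s + ε * U₂ s - ε * Φ s) := by
      rw [← integral_const_mul, ← integral_const_mul, ← integral_add, ← integral_sub]
      · congr 1; ext s; ring
      · exact (mH.integrable_mul_of_two mψ).add ((hU.memLp.integrable_mul_of_two mψ).const_mul _)
      · exact (mΦ.integrable_mul_of_two mψ).const_mul _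
      · exact mH.integrable_mul_of_two mψ
      · exact (hU.memLp.integrable_mul_of_two mψ).const_mul _
    rw [this, ← e1]
    rw [e2] at test
    linarith
  rw [integral_eq_zero_iff_of_nonneg (fun s => sq_nonneg _) mψ.integrable_sq] at e3
  have e4 : U₂ =ᵐ[intervalMeasure L] fun s => Φ s - ε⁻¹ * H s := by
    filter_upwards [e3] with s hs
    have h : H s + ε * U₂ s - ε * Φ s = 0 := by simpa using hs
    field_simp
    linarith
  refine ⟨U, U₁, fun s => Φ s - ε⁻¹ * H s, fun s => F s - ε⁻¹ * H₁ s, ⟨hU.prim,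
    hU.prim₁.congr_ae e4, hΦ.sub (hH.const_mul _), ?_⟩, h0, h1, h2.trans e4⟩
  convert hF.sub (hH₁.const_mul ε⁻¹) using 2
  ring

end Regularity

/-! ### A Schur test for quadratic kernel bounds -/

section Schur

variable {α : Type*} [MeasurableSpace α] {μ : Measure α} [SFinite μ]

/-- A kernel bound of Schur type: if `|W|² ≤ A ∫ R |G|²` with a kernel whose marginals are at most
`M`, then `‖W‖_q ≤ (A M)^{1/2} ‖G‖_q` for every `q ≥ 2`. -/
theorem eLpNorm_le_of_sq_le_lintegral {W G : α → ℝ} {R : α → α → ℝ≥0∞}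
    (hR : Measurable (Function.uncurry R)) (hG : AEStronglyMeasurable G μ) {A M : ℝ≥0∞}
    (hM0 : M ≠ 0) (hM : M ≠ ⊤)
    (hR₁ : ∀ x, ∫⁻ s, R x s ∂μ ≤ M) (hR₂ : ∀ s, ∫⁻ x, R x s ∂μ ≤ M)
    (hW : ∀ᵐ x ∂μ, ‖W x‖ₑ ^ 2 ≤ A * ∫⁻ s, R x s * ‖G s‖ₑ ^ 2 ∂μ) {q : ℝ≥0∞} (hq : 2 ≤ q) :
    eLpNorm W q μ ≤ (A * M) ^ (1 / 2 : ℝ) * eLpNorm G q μ := by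
  have hRx : ∀ x, Measurable (R x) := fun x => hR.of_uncurry_left
  have hac : ∀ x, μ.withDensity (R x) ≪ μ := fun x => withDensity_absolutelyContinuous _ _
  have hmass : ∀ x, μ.withDensity (R x) univ ≤ M := fun x => by
    rw [withDensity_apply _ MeasurableSet.univ, Measure.restrict_univ]; exact hR₁ x
  -- Hölder with respect to the measure R(x, ·)μ, whose mass is at most M, raises the exponent from
  -- 2 to q.
  have step : ∀ᵐ x ∂μ, ‖W x‖ₑ
      ≤ A ^ (1 / 2 : ℝ) * (eLpNorm G q (μ.withDensity (R x)) * M ^ (1 / 2 - 1 / q.toReal : ℝ)) := by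
    filter_upwards [hW] with x hx
    have e : ∫⁻ s, R x s * ‖G s‖ₑ ^ 2 ∂μ = eLpNorm G 2 (μ.withDensity (R x)) ^ 2 := by
      rw [eLpNorm_eq_lintegral_rpow_enorm_toReal two_ne_zero ENNReal.ofNat_ne_top,
        lintegral_withDensity_eq_lintegral_mul₀ (hRx x).aemeasurable (by fun_prop),
        ← ENNReal.rpow_natCast, ← ENNReal.rpow_mul]
      simp
    have h1 : ‖W x‖ₑ ≤ A ^ (1 / 2 : ℝ) * eLpNorm G 2 (μ.withDensity (R x)) := by
      rw [e] at hx
      have := ENNReal.rpow_le_rpow hx (by norm_num : (0 : ℝ) ≤ 1 / 2)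
      rw [ENNReal.mul_rpow_of_nonneg _ _ (by norm_num), ← ENNReal.rpow_natCast,
        ← ENNReal.rpow_natCast, ← ENNReal.rpow_mul, ← ENNReal.rpow_mul] at this
      simpa using this
    refine h1.trans ?_
    gcongr
    refine (eLpNorm_le_eLpNorm_mul_rpow_measure_univ hq (hG.mono_ac (hac x))).trans ?_
    have h2 : (0 : ℝ) ≤ 1 / 2 - 1 / q.toReal := by
      rcases eq_or_ne q ∞ with rfl | hq'
      · simp
      · have : 2 ≤ q.toReal := by simpa using ENNReal.toReal_mono hq' hq
        rw [sub_nonneg]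
        exact one_div_le_one_div_of_le two_pos this
    simp only [ENNReal.toReal_ofNat]
    gcongr
    exact hmass x
  rcases eq_or_ne q ∞ with rfl | hq'
  · rw [eLpNorm_exponent_top]
    refine eLpNormEssSup_le_of_ae_enorm_bound ?_
    filter_upwards [step] with x hx
    refine hx.trans ?_
    rw [ENNReal.mul_rpow_of_nonneg _ _ (by norm_num : (0 : ℝ) ≤ 1 / 2), mul_assoc]
    simp only [ENNReal.toReal_top, div_zero, sub_zero, eLpNorm_exponent_top]
    rw [mul_comm (eLpNormEssSup G _)]
    gcongr
    exact hac x
  · have hq0 : q ≠ 0 := (two_pos.trans_le hq).ne'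
    set p := q.toReal with hp
    have hp2 : 2 ≤ p := by simpa using ENNReal.toReal_mono hq' hq
    have hp0 : 0 < p := two_pos.trans_le hp2
    rw [eLpNorm_eq_lintegral_rpow_enorm_toReal hq0 hq', ← hp,
      eLpNorm_eq_lintegral_rpow_enorm_toReal hq0 hq', ← hp]
    have step2 : ∀ᵐ x ∂μ, ‖W x‖ₑ ^ p
        ≤ (A ^ (p / 2) * M ^ (p / 2 - 1)) * ∫⁻ s, R x s * ‖G s‖ₑ ^ p ∂μ := by
      filter_upwards [step] with x hx
      refine (ENNReal.rpow_le_rpow hx hp0.le).trans (le_of_eq ?_)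
      rw [eLpNorm_eq_lintegral_rpow_enorm_toReal hq0 hq', ← hp,
        lintegral_withDensity_eq_lintegral_mul₀ (hRx x).aemeasurable (by fun_prop),
        ENNReal.mul_rpow_of_nonneg _ _ hp0.le, ENNReal.mul_rpow_of_nonneg _ _ hp0.le,
        ← ENNReal.rpow_mul, ← ENNReal.rpow_mul, ← ENNReal.rpow_mul,
        one_div_mul_cancel hp0.ne', ENNReal.rpow_one,
        show 1 / 2 * p = p / 2 by ring, show (1 / 2 - 1 / p) * p = p / 2 - 1 by field_simp]
      simp only [Pi.mul_apply]
      ring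
    have hmeas : AEMeasurable (Function.uncurry fun x s => R x s * ‖G s‖ₑ ^ p) (μ.prod μ) := by
      refine hR.aemeasurable.mul ?_
      have : AEMeasurable (fun s => ‖G s‖ₑ ^ p) μ := by fun_prop
      exact this.comp_snd
    -- Tonelli brings in the marginal in the other variable, which contributes the one power of M
    -- missing from M^(p/2 − 1).
    have step3 : ∫⁻ x, ‖W x‖ₑ ^ p ∂μ ≤ (A * M) ^ (p / 2) * ∫⁻ s, ‖G s‖ₑ ^ p ∂μ := by
      calc ∫⁻ x, ‖W x‖ₑ ^ p ∂μ
          ≤ ∫⁻ x, (A ^ (p / 2) * M ^ (p / 2 - 1)) * ∫⁻ s, R x s * ‖G s‖ₑ ^ p ∂μ ∂μ :=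
            lintegral_mono_ae step2
        _ = (A ^ (p / 2) * M ^ (p / 2 - 1)) * ∫⁻ x, ∫⁻ s, R x s * ‖G s‖ₑ ^ p ∂μ ∂μ :=
            lintegral_const_mul'' _ hmeas.lintegral_prod_right'
        _ = (A ^ (p / 2) * M ^ (p / 2 - 1)) * ∫⁻ s, (∫⁻ x, R x s ∂μ) * ‖G s‖ₑ ^ p ∂μ := by
            rw [lintegral_lintegral_swap hmeas]
            congr 1
            refine lintegral_congr fun s => ?_
            rw [lintegral_mul_const _ hR.of_uncurry_right]
        _ ≤ (A ^ (p / 2) * M ^ (p / 2 - 1)) * ∫⁻ s, M * ‖G s‖ₑ ^ p ∂μ := by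
            gcongr with s
            exact hR₂ s
        _ = (A * M) ^ (p / 2) * ∫⁻ s, ‖G s‖ₑ ^ p ∂μ := by
            rw [lintegral_const_mul'' _ (by fun_prop),
              ENNReal.mul_rpow_of_nonneg _ _ (by positivity), ← mul_assoc, mul_assoc (A ^ _)]
            congr 3
            nth_rewrite 2 [← ENNReal.rpow_one M]
            rw [← ENNReal.rpow_add _ _ hM0 hM]
            congr 1; ring
    refine (ENNReal.rpow_le_rpow step3 (by positivity : (0 : ℝ) ≤ 1 / p)).trans (le_of_eq ?_)
    rw [ENNReal.mul_rpow_of_nonneg _ _ (by positivity), ← ENNReal.rpow_mul]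
    congr 2
    field_simp

end Schur

/-! ### Weights localised at scale δ around a point -/

section RationalWeight

/-- The weight `s ↦ (1 + (c (s - x) / δ)²)⁻¹` centred at `x`. -/
noncomputable def ratWeight (c δ x s : ℝ) : ℝ := (1 + (c / δ * (s - x)) ^ 2)⁻¹

variable {c δ τ : ℝ}

theorem ratWeight_pos (x s : ℝ) : 0 < ratWeight c δ x s := by unfold ratWeight; positivity

theorem ratWeight_le_one (x s : ℝ) : ratWeight c δ x s ≤ 1 := by
  unfold ratWeight
  exact inv_le_one_of_one_le₀ (by nlinarith [sq_nonneg (c / δ * (s - x))])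

@[simp]
theorem ratWeight_self (x : ℝ) : ratWeight c δ x x = 1 := by simp [ratWeight]

theorem ratWeight_comm (x s : ℝ) : ratWeight c δ x s = ratWeight c δ s x := by
  unfold ratWeight
  rw [← neg_sub s x]
  congr 2
  ring

theorem continuous_ratWeight : Continuous (Function.uncurry (ratWeight c δ)) := by
  unfold ratWeight Function.uncurry
  refine Continuous.inv₀ (by fun_prop) fun p => ?_
  positivity

/-- With r = 1/(1 + y²) and y = c(s − x)/δ, the first two y-derivatives of r are at most r and 10r
in size. Each s-derivative brings a factor c/δ, so c = τ/10 makes both relative sizes at most τ. -/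
theorem isC2Weight_ratWeight (hδ : 0 < δ) (hτ : 0 < τ) (hτ1 : τ ≤ 1) (x : ℝ) :
    IsC2Weight δ τ (ratWeight (τ / 10) δ x)
      (fun s => -(2 * (τ / 10 / δ) * (τ / 10 / δ * (s - x))) * ratWeight (τ / 10) δ x s ^ 2)
      (fun s => (τ / 10 / δ) ^ 2 * (8 * (τ / 10 / δ * (s - x)) ^ 2 * ratWeight (τ / 10) δ x s ^ 3
        - 2 * ratWeight (τ / 10) δ x s ^ 2)) := by
  set c := τ / 10 with hc
  have hcpos : 0 < c := by positivity
  have hc1 : c ≤ 1 / 10 := by linarith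
  set b := c / δ with hb
  have hbpos : 0 < b := by positivity
  have hbδ : δ * b = c := by rw [hb]; field_simp
  have hcont : Continuous (ratWeight c δ x) :=
    continuous_ratWeight.comp (Continuous.prodMk_right x)
  have eρ : ∀ s, ratWeight c δ x s = (1 + (b * (s - x)) ^ 2)⁻¹ := fun s => rfl
  have hne : ∀ s, (1 : ℝ) + (b * (s - x)) ^ 2 ≠ 0 := fun s => by positivity
  have hy : ∀ s, HasDerivAt (fun s => b * (s - x)) b s := fun s => by
    simpa using ((hasDerivAt_id s).sub_const x).const_mul b
  have hd : ∀ s, HasDerivAt (ratWeight c δ x)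
      (-(2 * b * (b * (s - x))) * ratWeight c δ x s ^ 2) s := fun s => by
    have h := (((hy s).pow 2).const_add 1).inv (hne s)
    refine h.congr_deriv ?_
    rw [eρ]
    have := hne s
    simp only [Nat.cast_ofNat, Pi.pow_apply]
    field_simp
    ring
  refine ⟨⟨hcont, fun s => ratWeight_pos x s, fun s t hst => ?_⟩, hd, fun s => ?_, ?_,
    fun s => ?_, fun s => ?_⟩
  · rw [eρ, eρ, ← div_eq_mul_inv, inv_eq_one_div, div_le_div_iff₀ (by positivity) (by positivity)]
    have h1 : |b * (s - t)| ≤ c := by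
      rw [abs_mul, abs_of_pos hbpos, ← hbδ, mul_comm]; gcongr
    have h2 : (b * (s - t)) ^ 2 ≤ 1 := by
      rw [← sq_abs]; nlinarith [abs_nonneg (b * (s - t))]
    nlinarith [sq_nonneg (b * (s - x) + b * (s - t)), sq_nonneg (b * (s - x))]
  · have h := (((hy s).const_mul (2 * b)).neg).mul ((hd s).pow 2)
    refine h.congr_deriv ?_
    simp only [Nat.cast_ofNat, Pi.pow_apply, Pi.neg_apply]
    ring
  · exact continuous_const.mul (((continuous_const.mul ((continuous_const.mul
      (continuous_id.sub continuous_const)).pow 2)).mul (hcont.pow 3)).sub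
      (continuous_const.mul (hcont.pow 2)))
  · set y := b * (s - x) with hydef
    set r := ratWeight c δ x s with hr
    have hr0 : 0 < r := ratWeight_pos x s
    have h3 : r * (1 + y ^ 2) = 1 := inv_mul_cancel₀ (hne s)
    have h4 : |2 * y| ≤ 1 + y ^ 2 := by
      rw [abs_le]; constructor <;> nlinarith [sq_nonneg (y + 1), sq_nonneg (y - 1)]
    have : δ * |-(2 * b * y) * r ^ 2| = c * (|2 * y| * r ^ 2) := by
      rw [show -(2 * b * y) * r ^ 2 = -(b * (2 * y) * r ^ 2) by ring, abs_neg, abs_mul, abs_mul,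
        abs_of_pos hbpos, abs_of_pos (pow_pos hr0 2), ← hbδ]
      ring
    rw [this]
    calc c * (|2 * y| * r ^ 2) ≤ c * ((1 + y ^ 2) * r ^ 2) := by gcongr
      _ = c * (r * (r * (1 + y ^ 2))) := by ring
      _ = c * r := by rw [h3, mul_one]
      _ ≤ τ * r := by gcongr; linarith
  · set y := b * (s - x) with hydef
    set r := ratWeight c δ x s with hr
    have hr0 : 0 < r := ratWeight_pos x s
    have hr1 : r ≤ 1 := ratWeight_le_one x s
    have h3 : r * (1 + y ^ 2) = 1 := inv_mul_cancel₀ (hne s)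
    have h5 : y ^ 2 * r ≤ 1 := by nlinarith
    have h6 : 0 ≤ y ^ 2 * r := by positivity
    have h7 : |8 * y ^ 2 * r ^ 3 - 2 * r ^ 2| ≤ 10 * r := by
      have e : 8 * y ^ 2 * r ^ 3 - 2 * r ^ 2 = r * (8 * (y ^ 2 * r) * r - 2 * r) := by ring
      have : |8 * (y ^ 2 * r) * r - 2 * r| ≤ 10 := by
        rw [abs_le]; constructor <;> nlinarith
      rw [e, abs_mul, abs_of_pos hr0, mul_comm]
      gcongr
    rw [abs_mul, abs_of_pos (pow_pos hbpos 2), ← mul_assoc, ← mul_pow, hbδ]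
    calc c ^ 2 * |8 * y ^ 2 * r ^ 3 - 2 * r ^ 2| ≤ c ^ 2 * (10 * r) := by gcongr
      _ = (c * 10) * c * r := by ring
      _ ≤ (c * 10) * 1 * r := by gcongr; linarith
      _ = τ * r := by rw [hc]; ring

/-- The mass over the whole line is computed by scaling the arctangent integral. Its factor δ
cancels the 1/δ of the pointwise estimate. -/
theorem lintegral_ratWeight_le (hc : 0 < c) (hδ : 0 < δ) (L x : ℝ) :
    ∫⁻ s in Ioo 0 L, ENNReal.ofReal (ratWeight c δ x s) ≤ ENNReal.ofReal (Real.pi * (δ / c)) := by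
  have hb : 0 < c / δ := by positivity
  have i1 : Integrable (fun s => ratWeight c δ x s) := by
    have h := (integrable_inv_one_add_sq.comp_mul_left' hb.ne').comp_sub_right x
    exact h
  have i2 : ∫ s, ratWeight c δ x s = Real.pi * (δ / c) := by
    unfold ratWeight
    rw [integral_sub_right_eq_self (fun s => (1 + (c / δ * s) ^ 2)⁻¹) x,
      Measure.integral_comp_mul_left (fun s => (1 + s ^ 2)⁻¹), integral_univ_inv_one_add_sq,
      abs_of_pos (inv_pos.2 hb), inv_div, smul_eq_mul, mul_comm]
  refine (setLIntegral_le_lintegral _ _).trans ?_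
  rw [← i2, ofReal_integral_eq_lintegral_ofReal i1
    (Filter.Eventually.of_forall fun s => (ratWeight_pos x s).le)]

end RationalWeight

/-! ### Pointwise bounds by localised means of the data -/

section Pointwise

variable {L k₁ k₂ : ℝ} {k : ℝ → ℝ}

/-- Constant of the pointwise estimate. -/
noncomputable def pointwiseConst (L k₁ k₂ : ℝ) : ℝ :=
  interpConst L * ((1 + 3 * k₂ ^ 2) * energyConst L k₁ + 3)

theorem pointwiseConst_pos (hL : 0 < L) (hk₁ : 0 < k₁) : 0 < pointwiseConst L k₁ k₂ := by
  have := interpConst_pos hL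
  have := energyConst_pos hL hk₁
  unfold pointwiseConst; positivity

/-- Pointwise bound of a strong solution by a weighted mean of the data. -/
theorem IsStrongSolution.pointwise (hL : 0 < L) (hk₁ : 0 < k₁)
    (hk : AdmissibleCoeff L k₁ k₂ k) {δ : ℝ} (hδ : 0 < δ) (hδ1 : δ ≤ 1) {f g : LebI L 2}
    {u : SobolevI L 2 2} (hu : IsWeakSolution L k (δ ^ 4) f g u) {F₁ U U₁ U₂ U₃ : ℝ → ℝ}
    (hF₁ : MemLp F₁ 2 (intervalMeasure L))
    (hU : IsStrongSolution L k (δ ^ 4) F₁ g U U₁ U₂ U₃)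
    (h0 : weakDer u 0 =ᵐ[intervalMeasure L] U) (h2 : weakDer u 2 =ᵐ[intervalMeasure L] U₂)
    {x : ℝ} (hx : x ∈ Icc 0 L) (i : Fin 4) :
    (δ ^ (i : ℕ) * (![U, U₁, U₂, U₃] : Fin 4 → ℝ → ℝ) i x) ^ 2
      ≤ pointwiseConst L k₁ k₂ / δ * ∫ s in Ioo 0 L, ratWeight (energyTau L k₁ / 10) δ x s *
        (|g s| + δ ^ 3 * |f s| + δ ^ 4 * |F₁ s|) ^ 2 := by
  have hw := isC2Weight_ratWeight hδ (energyTau_pos hL hk₁) (energyTau_le_one hL) x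
  have hH := hU.isH2Triple
  have energy := hu.weighted_energy hL hk₁ hk hδ hδ1 hH h0 h2 hw
  set ρ := ratWeight (energyTau L k₁ / 10) δ x with hρ
  have hρx : ρ x = 1 := ratWeight_self x
  have hρ0 : ∀ s, 0 < ρ s := fun s => ratWeight_pos x s
  have hρc : ContinuousOn ρ (Icc 0 L) := hw.continuous.continuousOn
  have mU : MemLp U 2 (intervalMeasure L) := memLp_of_continuousOn_Icc hU.prim.continuousOn
  have mU2 : MemLp U₂ 2 (intervalMeasure L) := memLp_of_continuousOn_Icc hU.prim₂.continuousOn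
  have mU4 : MemLp (fun s => F₁ s + (δ ^ 4)⁻¹ * (g s - k s * U s)) 2 (intervalMeasure L) :=
    hF₁.add (((Lp.memLp g).sub (hk.memLp_mul hk₁ mU)).const_mul _)
  set U₄ : ℝ → ℝ := fun s => F₁ s + (δ ^ 4)⁻¹ * (g s - k s * U s) with hU₄
  have mG : MemLp (fun s => |g s| + δ ^ 3 * |f s| + δ ^ 4 * |F₁ s|) 2 (intervalMeasure L) :=
    ((Lp.memLp g).abs.add ((Lp.memLp f).abs.const_mul _)).add (hF₁.abs.const_mul _)
  have wint : ∀ {h : ℝ → ℝ}, MemLp h 2 (intervalMeasure L) →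
      Integrable (fun s => ρ s * h s ^ 2) (intervalMeasure L) := fun {h} hh => by
    have := (hh.continuousOn_mul hρc).integrable_mul_of_two hh
    simpa [pow_two, mul_assoc] using this
  have wint2 : ∀ {h h' : ℝ → ℝ} (a : ℝ), MemLp h 2 (intervalMeasure L) →
      MemLp h' 2 (intervalMeasure L) →
      Integrable (fun s => ρ s * (h s ^ 2 + a * h' s ^ 2)) (intervalMeasure L) :=
    fun {h h'} a hh hh' => by
      refine ((wint hh).add ((wint hh').const_mul a)).congr ?_
      filter_upwards with s
      simp only [Pi.add_apply]; ring
  have p0 := hw.toIsSlowWeight.pointwise_le hL hδ hδ1 hU.prim hU.prim₁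
    (intervalIntegrable_sq_of_memLp hL.le mU2) hx
  -- The interpolation needs no boundary conditions, so it applies equally to u'' with second
  -- derivative u''''.
  have p2 := hw.toIsSlowWeight.pointwise_le hL hδ hδ1 hU.prim₂ hU.prim₃
    (intervalIntegrable_sq_of_memLp hL.le mU4) hx
  rw [hρx, one_mul, ← setIntegral_Ioo_eq hL.le] at p0 p2
  set G : ℝ → ℝ := fun s => |g s| + δ ^ 3 * |f s| + δ ^ 4 * |F₁ s| with hG
  have hC := interpConst_pos hL
  have hE := energyConst_pos hL hk₁
  have J0 : 0 ≤ ∫ s in Ioo 0 L, ρ s * G s ^ 2 :=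
    integral_nonneg fun s => mul_nonneg (hρ0 s).le (sq_nonneg _)
  have sqG : ∀ s, g s ^ 2 + δ ^ 6 * f s ^ 2 + δ ^ 8 * F₁ s ^ 2 ≤ G s ^ 2 := fun s => by
    simp only [hG]
    rw [← sq_abs (g s), ← sq_abs (f s), ← sq_abs (F₁ s)]
    have a1 : 0 ≤ |g s| * (δ ^ 3 * |f s|) := by positivity
    have a2 : 0 ≤ |g s| * (δ ^ 4 * |F₁ s|) := by positivity
    have a3 : 0 ≤ (δ ^ 3 * |f s|) * (δ ^ 4 * |F₁ s|) := by positivity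
    nlinarith
  have en : ∫ s in Ioo 0 L, ρ s * (U s ^ 2 + δ ^ 4 * U₂ s ^ 2)
      ≤ energyConst L k₁ * ∫ s in Ioo 0 L, ρ s * G s ^ 2 := by
    refine energy.trans (mul_le_mul_of_nonneg_left ?_ hE.le)
    refine integral_mono (wint2 _ (Lp.memLp g) (Lp.memLp f)) (wint mG) fun s => ?_
    refine mul_le_mul_of_nonneg_left ?_ (hρ0 s).le
    have : 0 ≤ δ ^ 8 * F₁ s ^ 2 := by positivity
    linarith [sqG s]
  -- The equation gives δ⁴U₄ = δ⁴F₁ + g − kU, so U₄ is controlled by G and the energy already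
  -- bounded in `en`.
  have en2 : δ ^ 4 * ∫ s in Ioo 0 L, ρ s * (U₂ s ^ 2 + δ ^ 4 * U₄ s ^ 2)
      ≤ ((1 + 3 * k₂ ^ 2) * energyConst L k₁ + 3) * ∫ s in Ioo 0 L, ρ s * G s ^ 2 := by
    have : δ ^ 4 * ∫ s in Ioo 0 L, ρ s * (U₂ s ^ 2 + δ ^ 4 * U₄ s ^ 2)
        ≤ (1 + 3 * k₂ ^ 2) * (∫ s in Ioo 0 L, ρ s * (U s ^ 2 + δ ^ 4 * U₂ s ^ 2))
          + 3 * ∫ s in Ioo 0 L, ρ s * G s ^ 2 := by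
      rw [← integral_const_mul, ← integral_const_mul, ← integral_const_mul,
        ← integral_add ((wint2 _ mU mU2).const_mul _) ((wint mG).const_mul _)]
      refine integral_mono_ae ((wint2 _ mU2 mU4).const_mul _)
        (((wint2 _ mU mU2).const_mul _).add ((wint mG).const_mul _)) ?_
      filter_upwards [hk.2] with s hs
      have hd4 : δ ^ 4 * U₄ s = δ ^ 4 * F₁ s + g s - k s * U s := by
        simp only [hU₄]; field_simp; ring
      have h8 : δ ^ 8 * U₄ s ^ 2 ≤ 3 * (δ ^ 8 * F₁ s ^ 2 + g s ^ 2 + (k s * U s) ^ 2) := by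
        have e : δ ^ 8 * U₄ s ^ 2 = (δ ^ 4 * U₄ s) ^ 2 := by ring
        rw [e, hd4]
        nlinarith [sq_nonneg (δ ^ 4 * F₁ s - g s), sq_nonneg (δ ^ 4 * F₁ s + k s * U s),
          sq_nonneg (g s + k s * U s)]
      have hkU : (k s * U s) ^ 2 ≤ k₂ ^ 2 * U s ^ 2 := by
        rw [mul_pow]
        have : 0 < k s := hk₁.trans_le hs.1
        gcongr
        exact hs.2
      have h6 : 0 ≤ δ ^ 6 * f s ^ 2 := by positivity
      have hU2 : 0 ≤ k₂ ^ 2 * (δ ^ 4 * U₂ s ^ 2) := by positivity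
      have := sqG s
      have hU0 : 0 ≤ U s ^ 2 := sq_nonneg _
      have fin : δ ^ 4 * (U₂ s ^ 2 + δ ^ 4 * U₄ s ^ 2)
          ≤ (1 + 3 * k₂ ^ 2) * (U s ^ 2 + δ ^ 4 * U₂ s ^ 2) + 3 * G s ^ 2 := by nlinarith
      calc δ ^ 4 * (ρ s * (U₂ s ^ 2 + δ ^ 4 * U₄ s ^ 2))
          = ρ s * (δ ^ 4 * (U₂ s ^ 2 + δ ^ 4 * U₄ s ^ 2)) := by ring
        _ ≤ ρ s * ((1 + 3 * k₂ ^ 2) * (U s ^ 2 + δ ^ 4 * U₂ s ^ 2) + 3 * G s ^ 2) :=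
            mul_le_mul_of_nonneg_left fin (hρ0 s).le
        _ = _ := by ring
    linarith [mul_le_mul_of_nonneg_left en (by positivity : 0 ≤ 1 + 3 * k₂ ^ 2)]
  have b0 : U x ^ 2 + δ ^ 2 * U₁ x ^ 2
      ≤ pointwiseConst L k₁ k₂ / δ * ∫ s in Ioo 0 L, ρ s * G s ^ 2 := by
    refine p0.trans ?_
    calc interpConst L / δ * ∫ s in Ioo 0 L, ρ s * (U s ^ 2 + δ ^ 4 * U₂ s ^ 2)
        ≤ interpConst L / δ * (energyConst L k₁ * ∫ s in Ioo 0 L, ρ s * G s ^ 2) := by gcongr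
      _ ≤ interpConst L / δ * (((1 + 3 * k₂ ^ 2) * energyConst L k₁ + 3) *
          ∫ s in Ioo 0 L, ρ s * G s ^ 2) := by
          gcongr
          nlinarith [mul_nonneg (sq_nonneg k₂) hE.le]
      _ = _ := by rw [pointwiseConst]; ring
  have b2 : δ ^ 4 * (U₂ x ^ 2 + δ ^ 2 * U₃ x ^ 2)
      ≤ pointwiseConst L k₁ k₂ / δ * ∫ s in Ioo 0 L, ρ s * G s ^ 2 := by
    calc δ ^ 4 * (U₂ x ^ 2 + δ ^ 2 * U₃ x ^ 2)
        ≤ δ ^ 4 * (interpConst L / δ * ∫ s in Ioo 0 L, ρ s * (U₂ s ^ 2 + δ ^ 4 * U₄ s ^ 2)) := by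
          gcongr
      _ = interpConst L / δ * (δ ^ 4 * ∫ s in Ioo 0 L, ρ s * (U₂ s ^ 2 + δ ^ 4 * U₄ s ^ 2)) := by
          ring
      _ ≤ interpConst L / δ * (((1 + 3 * k₂ ^ 2) * energyConst L k₁ + 3) *
          ∫ s in Ioo 0 L, ρ s * G s ^ 2) := by gcongr
      _ = _ := by rw [pointwiseConst]; ring
  have n0 : 0 ≤ U x ^ 2 := sq_nonneg _
  have n1 : 0 ≤ δ ^ 2 * U₁ x ^ 2 := by positivity
  have n2 : 0 ≤ δ ^ 4 * U₂ x ^ 2 := by positivity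
  have n3 : 0 ≤ δ ^ 6 * U₃ x ^ 2 := by positivity
  fin_cases i
  · change (δ ^ 0 * U x) ^ 2 ≤ _
    linarith
  · change (δ ^ 1 * U₁ x) ^ 2 ≤ _
    linarith
  · change (δ ^ 2 * U₂ x) ^ 2 ≤ _
    linarith
  · change (δ ^ 3 * U₃ x) ^ 2 ≤ _
    linarith

end Pointwise

/-! ### L^q and W^{j,q} bounds -/

section LqBounds

variable {L k₁ k₂ : ℝ} {k : ℝ → ℝ}

/-- Constant of the `L^q` bound for derivatives of order at most three. -/
noncomputable def lqConst (L k₁ k₂ : ℝ) : ℝ :=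
  √(pointwiseConst L k₁ k₂ * (Real.pi / (energyTau L k₁ / 10)))

theorem lqConst_nonneg : 0 ≤ lqConst L k₁ k₂ := Real.sqrt_nonneg _

/-- `U, U', …, U''''` for a strong solution. -/
noncomputable def strongFamily (k : ℝ → ℝ) (ε : ℝ) (F₁ g U U₁ U₂ U₃ : ℝ → ℝ) : Fin 5 → ℝ → ℝ :=
  ![U, U₁, U₂, U₃, fun s => F₁ s + ε⁻¹ * (g s - k s * U s)]

theorem IsStrongSolution.isPrimitiveOn_strongFamily {ε : ℝ} {F₁ g U U₁ U₂ U₃ : ℝ → ℝ}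
    (h : IsStrongSolution L k ε F₁ g U U₁ U₂ U₃) (i : Fin 4) :
    IsPrimitiveOn (strongFamily k ε F₁ g U U₁ U₂ U₃ i.castSucc)
      (strongFamily k ε F₁ g U U₁ U₂ U₃ i.succ) 0 L := by
  fin_cases i
  exacts [h.prim, h.prim₁, h.prim₂, h.prim₃]

/-- A Sobolev function built from the first derivatives of a strong solution. -/
theorem IsStrongSolution.exists_sobolevI {ε : ℝ} {F₁ g U U₁ U₂ U₃ : ℝ → ℝ}
    (h : IsStrongSolution L k ε F₁ g U U₁ U₂ U₃) {q : ℝ≥0∞} [Fact (1 ≤ q)]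
    (hm : ∀ i, MemLp (strongFamily k ε F₁ g U U₁ U₂ U₃ i) q (intervalMeasure L)) {m : ℕ}
    (hj : m ≤ 4) {B : ℝ}
    (hB : ∀ i : Fin 5, (i : ℕ) ≤ m →
      (eLpNorm (strongFamily k ε F₁ g U U₁ U₂ U₃ i) q (intervalMeasure L)).toReal ≤ B) :
    ∃ w : SobolevI L m q, weakDer w 0 =ᵐ[intervalMeasure L] U ∧ ‖w‖ ≤ 5 * B := by
  have hle : m + 1 ≤ 5 := by omega
  obtain ⟨w, hw⟩ := SobolevI.exists_of_isPrimitiveOn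
    (fun i : Fin (m + 1) => strongFamily k ε F₁ g U U₁ U₂ U₃ (i.castLE hle))
    (fun i => hm _) (fun i => h.isPrimitiveOn_strongFamily (i.castLE (by omega)))
  refine ⟨w, ?_, ?_⟩
  · rw [hw]
    exact (hm _).coeFn_toLp
  · have hB0 : 0 ≤ B := ENNReal.toReal_nonneg.trans (hB 0 (Nat.zero_le _))
    refine (SobolevI.norm_le_sum w).trans ?_
    calc ∑ i, ‖weakDer w i‖ ≤ ∑ _i : Fin (m + 1), B := by
          refine Finset.sum_le_sum fun i _ => ?_
          rw [hw, Lp.norm_toLp]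
          exact hB _ (by simpa using Nat.lt_succ_iff.1 i.2)
      _ = (m + 1) * B := by simp
      _ ≤ 5 * B := by
          gcongr
          exact_mod_cast hle

/-- `L^q` bounds for the derivatives of a strong solution. -/
theorem IsStrongSolution.eLpNorm_le (hL : 0 < L) (hk₁ : 0 < k₁) (hk₂ : 0 ≤ k₂)
    (hk : AdmissibleCoeff L k₁ k₂ k) {δ : ℝ} (hδ : 0 < δ) (hδ1 : δ ≤ 1) {f g : LebI L 2}
    {u : SobolevI L 2 2} (hu : IsWeakSolution L k (δ ^ 4) f g u) {F₁ U U₁ U₂ U₃ : ℝ → ℝ}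
    (hU : IsStrongSolution L k (δ ^ 4) F₁ g U U₁ U₂ U₃)
    (h0 : weakDer u 0 =ᵐ[intervalMeasure L] U) (h2 : weakDer u 2 =ᵐ[intervalMeasure L] U₂)
    {q : ℝ≥0∞} (hq : 2 ≤ q) (hf : MemLp f q (intervalMeasure L))
    (hg : MemLp g q (intervalMeasure L)) (hF₁ : MemLp F₁ q (intervalMeasure L)) (i : Fin 5) :
    MemLp (strongFamily k (δ ^ 4) F₁ g U U₁ U₂ U₃ i) q (intervalMeasure L) ∧
    δ ^ (i : ℕ) * (eLpNorm (strongFamily k (δ ^ 4) F₁ g U U₁ U₂ U₃ i) q (intervalMeasure L)).toReal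
      ≤ (1 + (1 + k₂) * lqConst L k₁ k₂) *
        ((eLpNorm g q (intervalMeasure L)).toReal
          + δ ^ 3 * (eLpNorm f q (intervalMeasure L)).toReal
          + δ ^ 4 * (eLpNorm F₁ q (intervalMeasure L)).toReal) := by
  have hq1 : 1 ≤ q := one_le_two.trans hq
  set μ := intervalMeasure L with hμ
  set G : ℝ → ℝ := fun s => |g s| + δ ^ 3 * |f s| + δ ^ 4 * |F₁ s| with hG
  have mG : MemLp G q μ := (hg.abs.add (hf.abs.const_mul _)).add (hF₁.abs.const_mul _)
  have mG2 : MemLp G 2 μ := mG.mono_exponent hq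
  have hF₁2 : MemLp F₁ 2 μ := hF₁.mono_exponent hq
  set N := (eLpNorm g q μ).toReal + δ ^ 3 * (eLpNorm f q μ).toReal
    + δ ^ 4 * (eLpNorm F₁ q μ).toReal with hN
  have hN0 : 0 ≤ N := by positivity
  have nG : eLpNorm G q μ ≤ ENNReal.ofReal N := by
    have e1 : eLpNorm G q μ ≤ eLpNorm (fun s => |g s|) q μ
        + eLpNorm (fun s => δ ^ 3 * |f s|) q μ + eLpNorm (fun s => δ ^ 4 * |F₁ s|) q μ := by
      refine (eLpNorm_add_le (hg.abs.add (hf.abs.const_mul _)).1 (hF₁.abs.const_mul _).1 hq1).trans ?_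
      gcongr
      · exact eLpNorm_add_le hg.abs.1 (hf.abs.const_mul _).1 hq1
      · exact le_rfl
    have e2 : ∀ {h : ℝ → ℝ} (a : ℝ), 0 ≤ a → MemLp h q μ →
        eLpNorm (fun s => a * |h s|) q μ = ENNReal.ofReal (a * (eLpNorm h q μ).toReal) :=
      fun {h} a ha hh => by
        have := eLpNorm_const_smul (c := a) (f := fun s => |h s|) (p := q) (μ := μ)
        simp only [Pi.smul_def, smul_eq_mul] at this
        rw [this, ENNReal.ofReal_mul ha, ENNReal.ofReal_toReal hh.2.ne, Real.enorm_of_nonneg ha]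
        congr 1
        exact eLpNorm_norm h
    have e3 := e2 1 zero_le_one hg
    simp only [one_mul] at e3
    rw [e3, e2 _ (by positivity) hf, e2 _ (by positivity) hF₁,
      ← ENNReal.ofReal_add (by positivity) (by positivity),
      ← ENNReal.ofReal_add (by positivity) (by positivity)] at e1
    exact e1
  set τ := energyTau L k₁ with hτdef
  have hτ : 0 < τ := energyTau_pos hL hk₁
  have hP := pointwiseConst_pos (k₂ := k₂) hL hk₁
  have C0 := lqConst_nonneg (L := L) (k₁ := k₁) (k₂ := k₂)
  have low : ∀ i : Fin 4, MemLp ((![U, U₁, U₂, U₃] : Fin 4 → ℝ → ℝ) i) q μ ∧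
      eLpNorm (fun s => δ ^ (i : ℕ) * (![U, U₁, U₂, U₃] : Fin 4 → ℝ → ℝ) i s) q μ
        ≤ ENNReal.ofReal (lqConst L k₁ k₂) * ENNReal.ofReal N := by
    intro i
    refine ⟨?_, ?_⟩
    · fin_cases i
      · exact memLp_of_continuousOn_Icc hU.prim.continuousOn
      · exact memLp_of_continuousOn_Icc hU.prim₁.continuousOn
      · exact memLp_of_continuousOn_Icc hU.prim₂.continuousOn
      · exact memLp_of_continuousOn_Icc hU.prim₃.continuousOn
    · have hRm : Measurable (Function.uncurry fun x s => ENNReal.ofReal (ratWeight (τ / 10) δ x s)) :=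
        ENNReal.measurable_ofReal.comp continuous_ratWeight.measurable
      -- One bound serves for both marginals because the weight is symmetric in x and s. Multiplied
      -- by A = C/δ it is free of δ.
      have hM : 0 < Real.pi * (δ / (τ / 10)) := by positivity
      have schur := eLpNorm_le_of_sq_le_lintegral (μ := μ)
        (W := fun s => δ ^ (i : ℕ) * (![U, U₁, U₂, U₃] : Fin 4 → ℝ → ℝ) i s) (G := G)
        (A := ENNReal.ofReal (pointwiseConst L k₁ k₂ / δ))
        (M := ENNReal.ofReal (Real.pi * (δ / (τ / 10)))) hRm mG.1 (by simpa using hM)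
        ENNReal.ofReal_ne_top
        (fun x => lintegral_ratWeight_le (by positivity) hδ L x)
        (fun s => by
          simp_rw [ratWeight_comm _ s]
          exact lintegral_ratWeight_le (by positivity) hδ L s) (by
          filter_upwards [ae_restrict_mem measurableSet_Ioo] with x hx
          have p := hU.pointwise hL hk₁ hk hδ hδ1 hu hF₁2 h0 h2 (Ioo_subset_Icc_self hx) i
          have hi : Integrable (fun s => ratWeight (τ / 10) δ x s * G s ^ 2) μ := by
            have hc : Continuous (ratWeight (τ / 10) δ x) :=
              continuous_ratWeight.comp (Continuous.prodMk_right x)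
            have := (mG2.continuousOn_mul hc.continuousOn).integrable_mul_of_two mG2
            simpa [pow_two, mul_assoc] using this
          have p' := ENNReal.ofReal_le_ofReal p
          rw [ENNReal.ofReal_mul (by positivity), ofReal_integral_eq_lintegral_ofReal hi
            (Filter.Eventually.of_forall fun s => mul_nonneg (ratWeight_pos x s).le (sq_nonneg _))]
            at p'
          have es : ∀ a : ℝ, ‖a‖ₑ ^ 2 = ENNReal.ofReal (a ^ 2) := fun a => by
            rw [← sq_abs, ENNReal.ofReal_pow (abs_nonneg a), Real.enorm_eq_ofReal_abs]
          rw [es]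
          refine p'.trans (le_of_eq ?_)
          congr 1
          refine lintegral_congr fun s => ?_
          rw [es, ENNReal.ofReal_mul (ratWeight_pos x s).le]) hq
      refine schur.trans ?_
      rw [← ENNReal.ofReal_mul (by positivity), ENNReal.ofReal_rpow_of_nonneg (by positivity)
        (by norm_num), ← Real.sqrt_eq_rpow]
      have : pointwiseConst L k₁ k₂ / δ * (Real.pi * (δ / (τ / 10)))
          = pointwiseConst L k₁ k₂ * (Real.pi / (τ / 10)) := by field_simp
      rw [this]
      exact mul_le_mul_right nG _
  have scale : ∀ {h : ℝ → ℝ} (a : ℝ), 0 ≤ a →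
      (eLpNorm (fun s => a * h s) q μ).toReal = a * (eLpNorm h q μ).toReal :=
    fun {h} a ha => by
      have := eLpNorm_const_smul (c := a) (f := h) (p := q) (μ := μ)
      simp only [Pi.smul_def, smul_eq_mul] at this
      rw [this, ENNReal.toReal_mul, toReal_enorm, Real.norm_of_nonneg ha]
  induction i using Fin.lastCases with
  | cast i =>
    obtain ⟨m, hle⟩ := low i
    have ei : strongFamily k (δ ^ 4) F₁ g U U₁ U₂ U₃ i.castSucc
        = (![U, U₁, U₂, U₃] : Fin 4 → ℝ → ℝ) i := by fin_cases i <;> rfl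
    rw [ei]
    refine ⟨m, ?_⟩
    rw [Fin.val_castSucc, ← scale _ (by positivity)]
    rw [← ENNReal.ofReal_mul C0] at hle
    refine (ENNReal.toReal_le_of_le_ofReal (by positivity) hle).trans ?_
    gcongr
    nlinarith
  -- The fourth derivative comes from the equation and the order-zero bound for U.
  | last =>
    have el : strongFamily k (δ ^ 4) F₁ g U U₁ U₂ U₃ (Fin.last 4)
        = fun s => F₁ s + (δ ^ 4)⁻¹ * (g s - k s * U s) := rfl
    rw [el]
    obtain ⟨mU, hUle⟩ := low 0
    have mU' : MemLp U q μ := mU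
    have hUle' : eLpNorm U q μ ≤ ENNReal.ofReal (lqConst L k₁ k₂) * ENNReal.ofReal N := by
      simpa using hUle
    have m4 : MemLp (fun s => F₁ s + (δ ^ 4)⁻¹ * (g s - k s * U s)) q μ :=
      hF₁.add ((hg.sub (hk.memLp_mul hk₁ mU')).const_mul _)
    refine ⟨m4, ?_⟩
    rw [Fin.val_last, ← scale _ (by positivity)]
    have b : eLpNorm (fun s => δ ^ 4 * (F₁ s + (δ ^ 4)⁻¹ * (g s - k s * U s))) q μ
        ≤ ENNReal.ofReal ((1 + k₂ * lqConst L k₁ k₂) * N) := by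
      calc eLpNorm (fun s => δ ^ 4 * (F₁ s + (δ ^ 4)⁻¹ * (g s - k s * U s))) q μ
          ≤ eLpNorm (fun s => G s + k₂ * |U s|) q μ := by
            refine eLpNorm_mono_ae_real ?_
            filter_upwards [hk.2] with s hs
            have e : δ ^ 4 * (F₁ s + (δ ^ 4)⁻¹ * (g s - k s * U s))
                = δ ^ 4 * F₁ s + (g s + -(k s * U s)) := by field_simp; ring
            have hks : 0 < k s := hk₁.trans_le hs.1
            rw [e, Real.norm_eq_abs]
            refine (abs_add_le _ _).trans ?_
            have t := abs_add_le (g s) (-(k s * U s))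
            rw [abs_neg, abs_mul (k s), abs_of_pos hks] at t
            rw [abs_mul, abs_of_pos (pow_pos hδ 4)]
            have t2 : k s * |U s| ≤ k₂ * |U s| := mul_le_mul_of_nonneg_right hs.2 (abs_nonneg _)
            have t3 : 0 ≤ δ ^ 3 * |f s| := by positivity
            simp only [hG]
            linarith
        _ ≤ eLpNorm G q μ + eLpNorm (fun s => k₂ * |U s|) q μ :=
            eLpNorm_add_le mG.1 (mU'.abs.const_mul _).1 hq1
        _ ≤ ENNReal.ofReal N + ENNReal.ofReal k₂ *
            (ENNReal.ofReal (lqConst L k₁ k₂) * ENNReal.ofReal N) := by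
            have := eLpNorm_const_smul (c := k₂) (f := fun s => |U s|) (p := q) (μ := μ)
            simp only [Pi.smul_def, smul_eq_mul] at this
            rw [this, Real.enorm_of_nonneg hk₂]
            have e : eLpNorm (fun s => |U s|) q μ = eLpNorm U q μ := eLpNorm_norm U
            rw [e]
            gcongr
        _ = ENNReal.ofReal ((1 + k₂ * lqConst L k₁ k₂) * N) := by
            rw [← ENNReal.ofReal_mul C0, ← ENNReal.ofReal_mul hk₂,
              ← ENNReal.ofReal_add hN0 (by positivity)]
            congr 1; ring
    refine (ENNReal.toReal_le_of_le_ofReal (by positivity) b).trans ?_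
    gcongr
    linarith

/-- Constant of the `W^{j,q}` bound. -/
noncomputable def sobolevConst (L k₁ k₂ : ℝ) : ℝ := 5 * (1 + (1 + k₂) * lqConst L k₁ k₂)

theorem sobolevConst_pos (hk₂ : 0 ≤ k₂) : 0 < sobolevConst L k₁ k₂ := by
  have := lqConst_nonneg (L := L) (k₁ := k₁) (k₂ := k₂)
  unfold sobolevConst; positivity

/-- `W^{j,q}` regularity of weak solutions for `0 ≤ j ≤ 4`. -/
theorem IsWeakSolution.exists_sobolevI (hL : 0 < L) (hk₁ : 0 < k₁) (hk₂ : 0 ≤ k₂)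
    (hk : AdmissibleCoeff L k₁ k₂ k) {δ : ℝ} (hδ : 0 < δ) (hδ1 : δ ≤ 1) {f g : LebI L 2}
    {u : SobolevI L 2 2} (hu : IsWeakSolution L k (δ ^ 4) f g u) {F F₁ : ℝ → ℝ}
    (hF : IsPrimitiveOn F F₁ 0 L) (hfF : f =ᵐ[intervalMeasure L] F)
    {q : ℝ≥0∞} [Fact (1 ≤ q)] (hq : 2 ≤ q)
    (hg : MemLp g q (intervalMeasure L)) (hF₁ : MemLp F₁ q (intervalMeasure L))
    {j : ℕ} (hj : j ≤ 4) :
    ∃ w : SobolevI L j q, weakDer w 0 =ᵐ[intervalMeasure L] weakDer u 0 ∧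
      ‖w‖ ≤ sobolevConst L k₁ k₂ * (δ ^ j)⁻¹ *
        ((eLpNorm g q (intervalMeasure L)).toReal
          + δ ^ 3 * (eLpNorm f q (intervalMeasure L)).toReal
          + δ ^ 4 * (eLpNorm F₁ q (intervalMeasure L)).toReal) := by
  obtain ⟨U, U₁, U₂, U₃, hU, h0, h1, h2⟩ :=
    hu.exists_isStrongSolution hL hk₁ hk (by positivity) hF hfF
  have hf : MemLp f q (intervalMeasure L) :=
    (memLp_congr_ae hfF).2 (memLp_of_continuousOn_Icc hF.continuousOn)
  have key := hU.eLpNorm_le hL hk₁ hk₂ hk hδ hδ1 hu h0 h2 hq hf hg hF₁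
  have C0 := lqConst_nonneg (L := L) (k₁ := k₁) (k₂ := k₂)
  obtain ⟨w, hw, hwn⟩ := hU.exists_sobolevI (fun i => (key i).1) hj
    (B := (1 + (1 + k₂) * lqConst L k₁ k₂) * (δ ^ j)⁻¹ *
        ((eLpNorm g q (intervalMeasure L)).toReal
          + δ ^ 3 * (eLpNorm f q (intervalMeasure L)).toReal
          + δ ^ 4 * (eLpNorm F₁ q (intervalMeasure L)).toReal)) (by
      intro i hi
      have h := (key i).2
      rw [← le_div_iff₀' (by positivity)] at h
      refine h.trans ?_
      rw [div_eq_mul_inv, mul_right_comm]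
      -- As δ ≤ 1, the highest derivative carries the worst power and dominates the Sobolev norm.
      have : δ ^ j ≤ δ ^ (i : ℕ) := pow_le_pow_of_le_one hδ.le hδ1 hi
      gcongr)
  refine ⟨w, hw.trans h0.symm, hwn.trans (le_of_eq ?_)⟩
  rw [sobolevConst]; ring

end LqBounds

/-! ### Reciprocals of H² functions -/

section Reciprocal

variable {F f : ℝ → ℝ} {a b : ℝ}

theorem IsPrimitiveOn.hasDerivAt (h : IsPrimitiveOn F f a b) (hf : ContinuousOn f (Icc a b))
    {x : ℝ} (hx : x ∈ Ioo a b) : HasDerivAt F (f x) x := by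
  have hab : Icc a b ∈ nhds x := Icc_mem_nhds hx.1 hx.2
  have h1 : HasDerivAt (fun t => F a + ∫ s in a..t, f s) (f x) x := by
    refine HasDerivAt.const_add _ (intervalIntegral.integral_hasDerivAt_right
      (h.intervalIntegrable_sub ⟨le_rfl, h.le⟩ (Ioo_subset_Icc_self hx)) ?_
      (hf.continuousAt hab))
    exact ⟨Icc a b, hab, hf.aestronglyMeasurable measurableSet_Icc⟩
  refine h1.congr_of_eventuallyEq ?_
  filter_upwards [hab] with t ht
  exact h.eq t ht

theorem IsPrimitiveOn.of_hasDerivAt_Ioo (hab : a ≤ b) (hF : ContinuousOn F (Icc a b))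
    (hf : ContinuousOn f (Icc a b)) (h : ∀ x ∈ Ioo a b, HasDerivAt F (f x) x) :
    IsPrimitiveOn F f a b := by
  refine ⟨hab, hf.intervalIntegrable_of_Icc hab, fun t ht => ?_⟩
  have hsub : Icc a t ⊆ Icc a b := Icc_subset_Icc_right ht.2
  rw [intervalIntegral.integral_eq_sub_of_hasDerivAt_of_le ht.1 (hF.mono hsub)
    (fun x hx => h x ⟨hx.1, hx.2.trans_le ht.2⟩) ((hf.mono hsub).intervalIntegrable_of_Icc ht.1)]
  ring

variable {L : ℝ} {κ κ₁ κ₂ : ℝ → ℝ}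

/-- The reciprocal of a nonvanishing `H²` function. -/
theorem IsH2Triple.inv (h : IsH2Triple L κ κ₁ κ₂) (hne : ∀ s ∈ Icc 0 L, κ s ≠ 0) :
    IsH2Triple L (fun s => (κ s)⁻¹) (fun s => -1 * (κ₁ s * ((κ s)⁻¹ * (κ s)⁻¹)))
      (fun s => -1 * (κ₂ s * ((κ s)⁻¹ * (κ s)⁻¹) +
        κ₁ s * (-1 * (κ₁ s * ((κ s)⁻¹ * (κ s)⁻¹)) * (κ s)⁻¹ +
          (κ s)⁻¹ * (-1 * (κ₁ s * ((κ s)⁻¹ * (κ s)⁻¹)))))) := by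
  have c0 := h.prim.continuousOn
  have c1 := h.prim₁.continuousOn
  have ci : ContinuousOn (fun s => (κ s)⁻¹) (Icc 0 L) := c0.inv₀ hne
  have ci1 : ContinuousOn (fun s => -1 * (κ₁ s * ((κ s)⁻¹ * (κ s)⁻¹))) (Icc 0 L) :=
    continuousOn_const.mul (c1.mul (ci.mul ci))
  have p : IsPrimitiveOn (fun s => (κ s)⁻¹) (fun s => -1 * (κ₁ s * ((κ s)⁻¹ * (κ s)⁻¹))) 0 L :=
    IsPrimitiveOn.of_hasDerivAt_Ioo h.prim.le ci ci1 fun x hx => by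
      refine ((h.prim.hasDerivAt c1 hx).inv (hne x (Ioo_subset_Icc_self hx))).congr_deriv ?_
      have := hne x (Ioo_subset_Icc_self hx)
      field_simp
  -- The first derivative is kept in product form so that the product rule yields the second one.
  refine ⟨p, (h.prim₁.mul (p.mul p)).const_mul (-1), ?_⟩
  have m1 := h.memLp.continuousOn_mul (ci.mul ci)
  have m2 := memLp_of_continuousOn_Icc (q := 2) (c1.mul ((ci1.mul ci).add (ci.mul ci1)))
  refine MemLp.ae_eq ?_ ((m1.add m2).const_mul (-1))
  filter_upwards with s
  simp only [Pi.add_apply, Pi.mul_apply]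
  ring

/-- min(κ, c) and c are continuous and agree a.e., hence everywhere. This makes the continuous
representative of k bounded below up to the end points, so that it can be inverted. -/
theorem le_of_ae_le_of_continuousOn (hL : 0 < L) {c : ℝ} (hκ : ContinuousOn κ (Icc 0 L))
    (h : ∀ᵐ s ∂intervalMeasure L, c ≤ κ s) {s : ℝ} (hs : s ∈ Icc 0 L) : c ≤ κ s := by
  have h' : (fun s => min (κ s) c) =ᵐ[volume.restrict (Icc 0 L)] fun _ => c := by
    rw [← Measure.restrict_congr_set Ioo_ae_eq_Icc]
    filter_upwards [h] with s hs
    exact min_eq_right hs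
  have := Measure.eqOn_Icc_of_ae_eq volume hL.ne h' (fun x hx => Filter.Tendsto.min (hκ x hx)
    tendsto_const_nhds) continuousOn_const hs
  exact min_eq_right_iff.1 this

end Reciprocal

/-! ### Coefficients and data in H² -/

section SmoothCoefficient

variable {L k₁ k₂ : ℝ} {k : ℝ → ℝ}

/-- The embedding of H² into C¹: pointwise interpolation with weight 1 at scale 1. -/
theorem SobolevI.sq_add_sq_le (hL : 0 < L) (u : SobolevI L 2 2) {U U₁ U₂ : ℝ → ℝ}
    (hU : IsH2Triple L U U₁ U₂) (h0 : weakDer u 0 =ᵐ[intervalMeasure L] U)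
    (h2 : weakDer u 2 =ᵐ[intervalMeasure L] U₂) {x : ℝ} (hx : x ∈ Icc 0 L) :
    U x ^ 2 + U₁ x ^ 2 ≤ 2 * interpConst L * ‖u‖ ^ 2 := by
  have := (isC2Weight_one (δ := 1) (τ := 0) le_rfl).toIsSlowWeight.pointwise_le hL one_pos le_rfl
    hU.prim hU.prim₁ (intervalIntegrable_sq_of_memLp hL.le hU.memLp) hx
  have hC := interpConst_pos hL
  simp only [one_mul, one_pow, div_one] at this
  rw [← setIntegral_Ioo_eq hL.le, integral_add
    (memLp_of_continuousOn_Icc (q := 2) hU.prim.continuousOn).integrable_sq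
    hU.memLp.integrable_sq, ← norm_sq_weakDer h0, ← norm_sq_weakDer h2] at this
  have b0 : ‖weakDer u 0‖ ^ 2 ≤ ‖u‖ ^ 2 := by gcongr; exact SobolevI.norm_weakDer_le u 0
  have b2 : ‖weakDer u 2‖ ^ 2 ≤ ‖u‖ ^ 2 := by gcongr; exact SobolevI.norm_weakDer_le u 2
  nlinarith

/-- Constant bounding the second derivative of the quotient of `H²` functions. -/
noncomputable def quotConst (L k₁ K₁ : ℝ) : ℝ :=
  3 * (1 / k₁ ^ 2 + 8 * interpConst L * (2 * interpConst L * K₁ ^ 2) * L / k₁ ^ 4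
    + 16 * interpConst L * (2 * interpConst L * K₁ ^ 2) ^ 2 * L / k₁ ^ 6
    + 4 * interpConst L * K₁ ^ 2 / k₁ ^ 4)

theorem quotConst_nonneg (hL : 0 < L) (hk₁ : 0 < k₁) (K₁ : ℝ) : 0 ≤ quotConst L k₁ K₁ := by
  have := interpConst_pos hL
  unfold quotConst; positivity

/-- The square of (g/κ)''. The lower-order quantities are bounded uniformly; `g₂` and `κ₂`, known
only in L², enter linearly, so the bound integrates. -/
theorem quot_pointwise {k₁ b S κ κ₁ κ₂ g g₁ g₂ : ℝ} (hk₁ : 0 < k₁) (hκ : k₁ ≤ κ)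
    (hκ₁ : κ₁ ^ 2 ≤ S) (hg : g ^ 2 ≤ b) (hg₁ : g₁ ^ 2 ≤ b) :
    (g₂ * κ⁻¹ + 2 * (g₁ * (-1 * (κ₁ * (κ⁻¹ * κ⁻¹))))
      + g * (-1 * (κ₂ * (κ⁻¹ * κ⁻¹) + κ₁ * (-1 * (κ₁ * (κ⁻¹ * κ⁻¹)) * κ⁻¹ +
          κ⁻¹ * (-1 * (κ₁ * (κ⁻¹ * κ⁻¹))))))) ^ 2
      ≤ 3 * (g₂ ^ 2 / k₁ ^ 2 + 4 * b * S / k₁ ^ 4 + 8 * b * S ^ 2 / k₁ ^ 6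
        + 2 * b / k₁ ^ 4 * κ₂ ^ 2) := by
  have hκ0 : 0 < κ := hk₁.trans_le hκ
  set i := κ⁻¹ with hi
  have hi0 : 0 ≤ i := (inv_pos.2 hκ0).le
  have hi1 : i ≤ k₁⁻¹ := inv_anti₀ hk₁ hκ
  set j := k₁⁻¹ with hj
  have hb : 0 ≤ b := (sq_nonneg _).trans hg
  have hS : 0 ≤ S := (sq_nonneg _).trans hκ₁
  have e : g₂ * i + 2 * (g₁ * (-1 * (κ₁ * (i * i))))
      + g * (-1 * (κ₂ * (i * i) + κ₁ * (-1 * (κ₁ * (i * i)) * i +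
          i * (-1 * (κ₁ * (i * i))))))
      = g₂ * i - 2 * (g₁ * κ₁ * i ^ 2) + g * (2 * κ₁ ^ 2 * i ^ 3 - κ₂ * i ^ 2) := by ring
  have t1 : (g₂ * i) ^ 2 ≤ g₂ ^ 2 * j ^ 2 := by rw [mul_pow]; gcongr
  have t2 : (2 * (g₁ * κ₁ * i ^ 2)) ^ 2 ≤ 4 * b * S * j ^ 4 := by
    calc (2 * (g₁ * κ₁ * i ^ 2)) ^ 2 = 4 * g₁ ^ 2 * κ₁ ^ 2 * i ^ 4 := by ring
      _ ≤ 4 * b * S * j ^ 4 := by gcongr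
  have t3 : (2 * κ₁ ^ 2 * i ^ 3 - κ₂ * i ^ 2) ^ 2 ≤ 8 * S ^ 2 * j ^ 6 + 2 * κ₂ ^ 2 * j ^ 4 := by
    calc (2 * κ₁ ^ 2 * i ^ 3 - κ₂ * i ^ 2) ^ 2
        ≤ 8 * (κ₁ ^ 2) ^ 2 * i ^ 6 + 2 * κ₂ ^ 2 * i ^ 4 := by
          nlinarith [sq_nonneg (2 * κ₁ ^ 2 * i ^ 3 + κ₂ * i ^ 2)]
      _ ≤ _ := by gcongr
  have t4 : (g * (2 * κ₁ ^ 2 * i ^ 3 - κ₂ * i ^ 2)) ^ 2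
      ≤ b * (8 * S ^ 2 * j ^ 6 + 2 * κ₂ ^ 2 * j ^ 4) := by
    rw [mul_pow]; gcongr
  have r : 3 * (g₂ ^ 2 / k₁ ^ 2 + 4 * b * S / k₁ ^ 4 + 8 * b * S ^ 2 / k₁ ^ 6
        + 2 * b / k₁ ^ 4 * κ₂ ^ 2)
      = 3 * (g₂ ^ 2 * j ^ 2 + 4 * b * S * j ^ 4 + b * (8 * S ^ 2 * j ^ 6 + 2 * κ₂ ^ 2 * j ^ 4)) := by
    simp only [div_eq_mul_inv, hj, inv_pow]; ring
  rw [e, r]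
  set A := g₂ * i
  set B := 2 * (g₁ * κ₁ * i ^ 2)
  set C := g * (2 * κ₁ ^ 2 * i ^ 3 - κ₂ * i ^ 2)
  nlinarith [sq_nonneg (A + B), sq_nonneg (A - C), sq_nonneg (B + C)]

/-- The quotient `g / k` of `H²` functions lies in `H²`. -/
theorem exists_quotient (hL : 0 < L) (hk₁ : 0 < k₁) (hk : AdmissibleCoeff L k₁ k₂ k) {K₁ : ℝ}
    {κ : SobolevI L 2 2} (hκ : weakDer κ 0 =ᵐ[intervalMeasure L] k) (hκn : ‖κ‖ ≤ K₁)
    (g : SobolevI L 2 2) : ∃ P P₁ P₂ : ℝ → ℝ, IsH2Triple L P P₁ P₂ ∧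
      (weakDer g 0 =ᵐ[intervalMeasure L] fun s => k s * P s) ∧
      ∫ s in Ioo 0 L, P₂ s ^ 2 ≤ quotConst L k₁ K₁ * ‖g‖ ^ 2 := by
  obtain ⟨c, c₁, c₂, hc, hc0, -, hc2⟩ := SobolevI.exists_isH2Triple hL κ
  obtain ⟨G, G₁, G₂, hG, hG0, -, hG2⟩ := SobolevI.exists_isH2Triple hL g
  have hck : c =ᵐ[intervalMeasure L] k := hc0.symm.trans hκ
  have hlow : ∀ s ∈ Icc 0 L, k₁ ≤ c s := fun s hs =>
    le_of_ae_le_of_continuousOn hL hc.prim.continuousOn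
      (by filter_upwards [hck, hk.2] with s h1 h2; rw [h1]; exact h2.1) hs
  have hne : ∀ s ∈ Icc 0 L, c s ≠ 0 := fun s hs => (hk₁.trans_le (hlow s hs)).ne'
  have hP := hG.mul (hc.inv hne)
  refine ⟨_, _, _, hP, ?_, ?_⟩
  · filter_upwards [hG0, hck, ae_restrict_mem measurableSet_Ioo] with s h1 h2 hs
    have := hne s (Ioo_subset_Icc_self hs)
    rw [h1, ← h2]
    field_simp
  · have hC := interpConst_pos hL
    set S := 2 * interpConst L * K₁ ^ 2 with hS
    set b := 2 * interpConst L * ‖g‖ ^ 2 with hb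
    have hb0 : 0 ≤ b := by positivity
    have hκ2 : ‖κ‖ ^ 2 ≤ K₁ ^ 2 := by gcongr
    have i1 : Integrable (fun s => G₂ s ^ 2) (intervalMeasure L) := hG.memLp.integrable_sq
    have i2 : Integrable (fun s => c₂ s ^ 2) (intervalMeasure L) := hc.memLp.integrable_sq
    have mono := integral_mono_ae hP.memLp.integrable_sq
      (((i1.const_mul (3 / k₁ ^ 2)).add (integrable_const
        (3 * (4 * b * S / k₁ ^ 4 + 8 * b * S ^ 2 / k₁ ^ 6)))).add
        (i2.const_mul (3 * (2 * b / k₁ ^ 4)))) (by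
        filter_upwards [ae_restrict_mem measurableSet_Ioo] with s hs
        have hs' := Ioo_subset_Icc_self hs
        have bg := SobolevI.sq_add_sq_le hL g hG hG0 hG2 hs'
        have bκ := SobolevI.sq_add_sq_le hL κ hc hc0 hc2 hs'
        have hS' : 2 * interpConst L * ‖κ‖ ^ 2 ≤ S := by rw [hS]; gcongr
        refine (quot_pointwise (b := b) (S := S) hk₁ (hlow s hs')
          (by linarith [sq_nonneg (c s)]) (by linarith [sq_nonneg (G₁ s)])
          (by linarith [sq_nonneg (G s)])).trans (le_of_eq ?_)
        simp only [Pi.add_apply]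
        ring)
    refine mono.trans ?_
    simp only [Pi.add_apply]
    rw [integral_add, integral_add, integral_const_mul (3 / k₁ ^ 2),
      integral_const_mul (3 * (2 * b / k₁ ^ 4)), integral_const,
      ← norm_sq_weakDer hG2, ← norm_sq_weakDer hc2]
    rotate_left
    · exact i1.const_mul _
    · exact integrable_const _
    · exact (i1.const_mul _).add (integrable_const _)
    · exact i2.const_mul _
    have v : (intervalMeasure L).real univ = L := by simp [hL.le]
    rw [v, smul_eq_mul]
    have b2 : ‖weakDer g 2‖ ^ 2 ≤ ‖g‖ ^ 2 := by gcongr; exact SobolevI.norm_weakDer_le g 2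
    have c2 : ‖weakDer κ 2‖ ^ 2 ≤ K₁ ^ 2 :=
      (pow_le_pow_left₀ (norm_nonneg _) (SobolevI.norm_weakDer_le κ 2) 2).trans hκ2
    calc 3 / k₁ ^ 2 * ‖weakDer g 2‖ ^ 2 + L * (3 * (4 * b * S / k₁ ^ 4 + 8 * b * S ^ 2 / k₁ ^ 6))
          + 3 * (2 * b / k₁ ^ 4) * ‖weakDer κ 2‖ ^ 2
        ≤ 3 / k₁ ^ 2 * ‖g‖ ^ 2 + L * (3 * (4 * b * S / k₁ ^ 4 + 8 * b * S ^ 2 / k₁ ^ 6))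
          + 3 * (2 * b / k₁ ^ 4) * K₁ ^ 2 := by gcongr
      _ = quotConst L k₁ K₁ * ‖g‖ ^ 2 := by
        rw [quotConst, ← hS, hb]; ring

/-- Constant of the `H²`–`H⁴` estimate, for the squares of the norms. -/
noncomputable def smoothConst (L k₁ k₂ K₁ : ℝ) : ℝ :=
  (1 + interpConst L) * (resolventConst L k₁ +
    (1 + k₂ ^ 2 / (2 * k₁)) * quotConst L k₁ K₁)

theorem smoothConst_pos (hL : 0 < L) (hk₁ : 0 < k₁) (K₁ : ℝ) : 0 < smoothConst L k₁ k₂ K₁ := by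
  have := interpConst_pos hL
  have := resolventConst_pos hL hk₁
  have := quotConst_nonneg hL hk₁ K₁
  unfold smoothConst; positivity

/-- Bounds in `L²` for a solution with smooth coefficient and data. -/
theorem IsStrongSolution.integral_sq_le (hL : 0 < L) (hk₁ : 0 < k₁)
    (hk : AdmissibleCoeff L k₁ k₂ k) {K₁ : ℝ}
    {κ : SobolevI L 2 2} (hκ : weakDer κ 0 =ᵐ[intervalMeasure L] k) (hκn : ‖κ‖ ≤ K₁)
    {δ : ℝ} (hδ : 0 < δ) (hδ1 : δ ≤ 1) {g u : SobolevI L 2 2}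
    (hu : IsWeakSolution L k (δ ^ 4) 0 (weakDer g 0) u) {U U₁ U₂ U₃ : ℝ → ℝ}
    (hU : IsStrongSolution L k (δ ^ 4) (fun _ => 0) (weakDer g 0) U U₁ U₂ U₃)
    (h0 : weakDer u 0 =ᵐ[intervalMeasure L] U) (h1 : weakDer u 1 =ᵐ[intervalMeasure L] U₁)
    (h2 : weakDer u 2 =ᵐ[intervalMeasure L] U₂) (i : Fin 5) :
    MemLp (strongFamily k (δ ^ 4) (fun _ => 0) (weakDer g 0) U U₁ U₂ U₃ i) 2 (intervalMeasure L) ∧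
    (δ ^ ((i : ℕ) - 2)) ^ 2 * ∫ s in Ioo 0 L,
        strongFamily k (δ ^ 4) (fun _ => 0) (weakDer g 0) U U₁ U₂ U₃ i s ^ 2
      ≤ smoothConst L k₁ k₂ K₁ * ‖g‖ ^ 2 := by
  obtain ⟨P, P₁, P₂, hP, hgP, hPn⟩ := exists_quotient hL hk₁ hk hκ hκn g
  have hC := interpConst_pos hL
  have hR := resolventConst_pos hL hk₁
  have hQ := quotConst_nonneg hL hk₁ K₁
  have mU : MemLp U 2 (intervalMeasure L) := memLp_of_continuousOn_Icc hU.prim.continuousOn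
  have mU1 : MemLp U₁ 2 (intervalMeasure L) := memLp_of_continuousOn_Icc hU.prim₁.continuousOn
  have mU2 : MemLp U₂ 2 (intervalMeasure L) := memLp_of_continuousOn_Icc hU.prim₂.continuousOn
  have mU3 : MemLp U₃ 2 (intervalMeasure L) := memLp_of_continuousOn_Icc hU.prim₃.continuousOn
  have mP : MemLp P 2 (intervalMeasure L) := memLp_of_continuousOn_Icc hP.prim.continuousOn
  have mUP : MemLp (fun s => U s - P s) 2 (intervalMeasure L) := mU.sub mP
  have mU2P : MemLp (fun s => U₂ s - P₂ s) 2 (intervalMeasure L) := mU2.sub hP.memLp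
  have mkU := hk.memLp_mul hk₁ mU
  have mU4 : MemLp (fun s => (0 : ℝ) + (δ ^ 4)⁻¹ * (weakDer g 0 s - k s * U s)) 2
      (intervalMeasure L) := by
    simp only [zero_add]
    exact ((Lp.memLp _).sub mkU).const_mul _
  -- Testing with u − P, where g = kP, merges the zeroth-order terms into ∫k(u − P)².
  have hV : IsH2Triple L (fun s => U s - P s) (fun s => U₁ s - P₁ s) (fun s => U₂ s - P₂ s) :=
    ⟨hU.prim.sub hP.prim, hU.prim₁.sub hP.prim₁, mU2P⟩
  have test := hu.test h0 h2 hV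
  have z : ∫ s in Ioo 0 L, (0 : LebI L 2) s * (U₁ s - P₁ s) = 0 := by
    refine integral_eq_zero_of_ae ?_
    filter_upwards [Lp.coeFn_zero ℝ 2 (intervalMeasure L)] with s hs
    rw [hs]; simp
  rw [z, mul_zero, zero_add] at test
  -- Uses U₂(U₂ − P₂) ≥ (U₂² − P₂²)/2. It yields both ‖U₂‖ ≤ ‖P₂‖ and, from the first term,
  -- smallness of U − P of order δ².
  have pt : k₁ * (∫ s in Ioo 0 L, (U s - P s) ^ 2)
      + δ ^ 4 / 2 * ((∫ s in Ioo 0 L, U₂ s ^ 2) - ∫ s in Ioo 0 L, P₂ s ^ 2) ≤ 0 := by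
    have j1 := mkU.integrable_mul_of_two mUP
    have j2 := mU2.integrable_mul_of_two mU2P
    have j3 := (Lp.memLp (weakDer g 0)).integrable_mul_of_two mUP
    have e : (∫ s in Ioo 0 L, (k s * U s * (U s - P s) + δ ^ 4 * (U₂ s * (U₂ s - P₂ s))
        - weakDer g 0 s * (U s - P s))) = 0 := by
      rw [integral_sub, integral_add, integral_const_mul]
      · linarith
      exacts [j1, j2.const_mul _, j1.add (j2.const_mul _), j3]
    refine le_of_le_of_eq ?_ e
    rw [← integral_sub mU2.integrable_sq hP.memLp.integrable_sq, ← integral_const_mul,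
      ← integral_const_mul, ← integral_add]
    · refine integral_mono_ae ?_ ((j1.add (j2.const_mul _)).sub j3) ?_
      · exact (mUP.integrable_sq.const_mul _).add
          ((mU2.integrable_sq.sub hP.memLp.integrable_sq).const_mul _)
      filter_upwards [hgP, hk.2] with s hs hks
      rw [hs]
      have a1 : k₁ * (U s - P s) ^ 2 ≤ k s * (U s - P s) ^ 2 :=
        mul_le_mul_of_nonneg_right hks.1 (sq_nonneg _)
      have a2 : 0 ≤ δ ^ 4 * (U₂ s - P₂ s) ^ 2 := by positivity
      nlinarith
    · exact mUP.integrable_sq.const_mul _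
    · exact (mU2.integrable_sq.sub hP.memLp.integrable_sq).const_mul _
  have nr : 0 ≤ ∫ s in Ioo 0 L, (U s - P s) ^ 2 := integral_nonneg fun s => sq_nonneg _
  have n2 : 0 ≤ ∫ s in Ioo 0 L, U₂ s ^ 2 := integral_nonneg fun s => sq_nonneg _
  have b2 : ∫ s in Ioo 0 L, U₂ s ^ 2 ≤ quotConst L k₁ K₁ * ‖g‖ ^ 2 := by
    have h4 : 0 < δ ^ 4 / 2 := by positivity
    have := mul_nonneg hk₁.le nr
    have : (∫ s in Ioo 0 L, U₂ s ^ 2) - ∫ s in Ioo 0 L, P₂ s ^ 2 ≤ 0 := by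
      by_contra hcon
      have := mul_pos h4 (not_le.1 hcon)
      linarith
    linarith
  have br : ∫ s in Ioo 0 L, (U s - P s) ^ 2 ≤ δ ^ 4 / (2 * k₁) * (quotConst L k₁ K₁ * ‖g‖ ^ 2) := by
    rw [div_mul_eq_mul_div, le_div_iff₀ (by positivity)]
    have h4 : 0 ≤ δ ^ 4 := by positivity
    have := mul_le_mul_of_nonneg_left hPn h4
    have := mul_nonneg h4 n2
    linarith
  have b4 : δ ^ 4 * ∫ s in Ioo 0 L, ((0 : ℝ) + (δ ^ 4)⁻¹ * (weakDer g 0 s - k s * U s)) ^ 2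
      ≤ k₂ ^ 2 / (2 * k₁) * (quotConst L k₁ K₁ * ‖g‖ ^ 2) := by
    have : ∫ s in Ioo 0 L, ((0 : ℝ) + (δ ^ 4)⁻¹ * (weakDer g 0 s - k s * U s)) ^ 2
        ≤ ((δ ^ 4)⁻¹ ^ 2 * k₂ ^ 2) * ∫ s in Ioo 0 L, (U s - P s) ^ 2 := by
      rw [← integral_const_mul]
      refine integral_mono_ae mU4.integrable_sq (mUP.integrable_sq.const_mul _) ?_
      filter_upwards [hgP, hk.2] with s hs hks
      have hk0 : 0 ≤ k s := hk₁.le.trans hks.1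
      rw [hs, show (0 : ℝ) + (δ ^ 4)⁻¹ * (k s * P s - k s * U s)
        = (δ ^ 4)⁻¹ * -(k s) * (U s - P s) by ring, mul_pow, mul_pow, neg_sq]
      gcongr
      exact hks.2
    calc δ ^ 4 * ∫ s in Ioo 0 L, ((0 : ℝ) + (δ ^ 4)⁻¹ * (weakDer g 0 s - k s * U s)) ^ 2
        ≤ δ ^ 4 * (((δ ^ 4)⁻¹ ^ 2 * k₂ ^ 2) *
          (δ ^ 4 / (2 * k₁) * (quotConst L k₁ K₁ * ‖g‖ ^ 2))) := by
          gcongr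
          exact this.trans (mul_le_mul_of_nonneg_left br (by positivity))
      _ = _ := by field_simp
  have b0 : ∫ s in Ioo 0 L, U s ^ 2 ≤ resolventConst L k₁ * ‖g‖ ^ 2 := by
    have := hu.energy hL hk₁ hk hδ hδ1 0
    rw [norm_zero] at this
    have e : (δ ^ ((0 : Fin 3) : ℕ) * ‖weakDer u 0‖) ^ 2 = ∫ s in Ioo 0 L, U s ^ 2 := by
      rw [← norm_sq_weakDer h0]; simp
    rw [e] at this
    have hg : ‖weakDer g 0‖ ^ 2 ≤ ‖g‖ ^ 2 := by gcongr; exact SobolevI.norm_weakDer_le g 0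
    refine this.trans ?_
    gcongr
    simpa using hg
  have b1 : ∫ s in Ioo 0 L, U₁ s ^ 2
      ≤ interpConst L * (resolventConst L k₁ * ‖g‖ ^ 2 + quotConst L k₁ K₁ * ‖g‖ ^ 2) := by
    -- Scale 1 rather than δ: u and u'' are bounded without loss, so u' is too.
    have := SobolevI.norm_weakDer_one_sq_le hL one_pos le_rfl u
    rw [norm_sq_weakDer h0, norm_sq_weakDer h1, norm_sq_weakDer h2] at this
    simp only [one_pow, one_mul] at this
    refine this.trans ?_
    gcongr
  have b3 : δ ^ 2 * ∫ s in Ioo 0 L, U₃ s ^ 2 ≤ interpConst L * (quotConst L k₁ K₁ * ‖g‖ ^ 2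
      + k₂ ^ 2 / (2 * k₁) * (quotConst L k₁ K₁ * ‖g‖ ^ 2)) := by
    have := (isC2Weight_one (δ := δ) (τ := 0) le_rfl).toIsSlowWeight.integral_deriv_sq_le hL hδ hδ1
      hU.prim₂ hU.prim₃ (intervalIntegrable_sq_of_memLp hL.le mU4)
    simp only [one_mul] at this
    rw [← setIntegral_Ioo_eq hL.le, ← setIntegral_Ioo_eq hL.le,
      integral_add_pow_mul_sq mU2 mU4] at this
    refine this.trans ?_
    gcongr
  have q0 : 0 ≤ resolventConst L k₁ * ‖g‖ ^ 2 := by positivity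
  have q1 : 0 ≤ quotConst L k₁ K₁ * ‖g‖ ^ 2 := by positivity
  have q2 : 0 ≤ k₂ ^ 2 / (2 * k₁) * (quotConst L k₁ K₁ * ‖g‖ ^ 2) := by positivity
  have tot : smoothConst L k₁ k₂ K₁ * ‖g‖ ^ 2 = (1 + interpConst L) *
      (resolventConst L k₁ * ‖g‖ ^ 2 + quotConst L k₁ K₁ * ‖g‖ ^ 2
        + k₂ ^ 2 / (2 * k₁) * (quotConst L k₁ K₁ * ‖g‖ ^ 2)) := by
    rw [smoothConst]; ring
  have q3 := mul_nonneg hC.le q0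
  have q4 := mul_nonneg hC.le q1
  have q5 := mul_nonneg hC.le q2
  rw [tot]
  -- The exponent i − 2 is a truncated subtraction: orders 0, 1 and 2 lose no power of δ.
  fin_cases i
  · refine ⟨mU, ?_⟩
    change (δ ^ 0) ^ 2 * ∫ s in Ioo 0 L, U s ^ 2 ≤ _
    linarith
  · refine ⟨mU1, ?_⟩
    change (δ ^ 0) ^ 2 * ∫ s in Ioo 0 L, U₁ s ^ 2 ≤ _
    linarith
  · refine ⟨mU2, ?_⟩
    change (δ ^ 0) ^ 2 * ∫ s in Ioo 0 L, U₂ s ^ 2 ≤ _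
    linarith
  · refine ⟨mU3, ?_⟩
    change (δ ^ 1) ^ 2 * ∫ s in Ioo 0 L, U₃ s ^ 2 ≤ _
    linarith
  · refine ⟨mU4, ?_⟩
    change (δ ^ 2) ^ 2 * ∫ s in Ioo 0 L,
      ((0 : ℝ) + (δ ^ 4)⁻¹ * (weakDer g 0 s - k s * U s)) ^ 2 ≤ _
    rw [← pow_mul, show 2 * 2 = 4 from rfl]
    linarith

end SmoothCoefficient

/-! ### The solution operator and its linearity -/

section ResolventOperator

variable {L k₁ k₂ : ℝ} {k : ℝ → ℝ}

theorem isWeakSolution_iff_eq_resolventOp (hL : 0 < L) (hk₁ : 0 < k₁)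
    (hk : AdmissibleCoeff L k₁ k₂ k) {δ : ℝ} (hδ : 0 < δ) (hδ1 : δ ≤ 1) (f g : LebI L 2)
    (u : SobolevI L 2 2) :
    IsWeakSolution L k (δ ^ 4) f g u ↔ u = resolventOp L k (δ ^ 4) f g := by
  have h := isWeakSolution_resolventOp hL hk₁ hk (pow_pos hδ 4) f g
  exact ⟨fun hu => hu.unique hL hk₁ hk hδ hδ1 h, fun hu => hu ▸ h⟩

theorem IsWeakSolution.norm_weakDer_le (hL : 0 < L) (hk₁ : 0 < k₁)
    (hk : AdmissibleCoeff L k₁ k₂ k) {δ : ℝ} (hδ : 0 < δ) (hδ1 : δ ≤ 1) {f g : LebI L 2}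
    {u : SobolevI L 2 2} (hu : IsWeakSolution L k (δ ^ 4) f g u) (j : Fin 3) :
    ‖weakDer u j‖ ≤ √(resolventConst L k₁) * (δ ^ (j : ℕ))⁻¹ * (δ ^ 3 * ‖f‖ + ‖g‖) := by
  have h := hu.energy hL hk₁ hk hδ hδ1 j
  have hR := resolventConst_pos hL hk₁
  have h2 : (δ ^ (j : ℕ) * ‖weakDer u j‖) ^ 2
      ≤ (√(resolventConst L k₁) * (δ ^ 3 * ‖f‖ + ‖g‖)) ^ 2 := by
    rw [mul_pow √_, Real.sq_sqrt hR.le]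
    refine h.trans (mul_le_mul_of_nonneg_left ?_ hR.le)
    have : 0 ≤ δ ^ 3 * ‖f‖ * ‖g‖ := by positivity
    nlinarith
  have hn : 0 ≤ √(resolventConst L k₁) * (δ ^ 3 * ‖f‖ + ‖g‖) := by positivity
  have h3 := (pow_le_pow_iff_left₀ (by positivity) hn two_ne_zero).1 h2
  rw [mul_right_comm, ← div_eq_mul_inv, le_div_iff₀' (by positivity)]
  exact h3

/-- Bounds in `H^{2+j}(I)` for a coefficient and data in `H²(I)`. -/
theorem exists_sobolevI_of_smooth (hL : 0 < L) (hk₁ : 0 < k₁)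
    (hk : AdmissibleCoeff L k₁ k₂ k) {K₁ : ℝ}
    {κ : SobolevI L 2 2} (hκ : weakDer κ 0 =ᵐ[intervalMeasure L] k) (hκn : ‖κ‖ ≤ K₁)
    {δ : ℝ} (hδ : 0 < δ) (hδ1 : δ ≤ 1) {j : ℕ} (hj : j ≤ 2) (g : SobolevI L 2 2) :
    ∃ w : SobolevI L (2 + j) 2,
      weakDer w 0 = weakDer (resolventOp₂ L k (δ ^ 4) (weakDer g 0)) 0 ∧
      ‖w‖ ≤ 5 * √(smoothConst L k₁ k₂ K₁) * (δ ^ j)⁻¹ * ‖g‖ := by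
  have hu := isWeakSolution_resolventOp hL hk₁ hk (pow_pos hδ 4) 0 (weakDer g 0)
  obtain ⟨U, U₁, U₂, U₃, hU, h0, h1, h2⟩ := hu.exists_isStrongSolution hL hk₁ hk (pow_pos hδ 4)
    (IsPrimitiveOn.const hL.le 0) (Lp.coeFn_zero ℝ 2 (intervalMeasure L))
  have key := hU.integral_sq_le hL hk₁ hk hκ hκn hδ hδ1 hu h0 h1 h2
  have hS := smoothConst_pos (k₂ := k₂) hL hk₁ K₁
  obtain ⟨w, hw, hwn⟩ := hU.exists_sobolevI (fun i => (key i).1) (m := 2 + j) (by omega)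
    (B := √(smoothConst L k₁ k₂ K₁) * (δ ^ j)⁻¹ * ‖g‖) (by
      intro i hi
      obtain ⟨hm, hb⟩ := key i
      rw [← Lp.norm_toLp _ hm]
      have e : ‖hm.toLp _‖ ^ 2 = ∫ s in Ioo 0 L, strongFamily k (δ ^ 4) (fun _ => 0)
          (weakDer g 0) U U₁ U₂ U₃ i s ^ 2 := by
        rw [Lp.norm_sq_eq_integral]
        exact integral_congr_ae (by filter_upwards [hm.coeFn_toLp] with s hs; rw [hs])
      rw [← e, ← mul_pow, ← Real.sq_sqrt hS.le, ← mul_pow] at hb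
      have hb' := (pow_le_pow_iff_left₀ (by positivity) (by positivity) two_ne_zero).1 hb
      rw [← le_div_iff₀' (by positivity)] at hb'
      refine hb'.trans ?_
      rw [div_eq_mul_inv, mul_right_comm]
      have : δ ^ j ≤ δ ^ ((i : ℕ) - 2) := pow_le_pow_of_le_one hδ.le hδ1 (by omega)
      gcongr)
  refine ⟨w, Lp.ext (hw.trans h0.symm), hwn.trans (le_of_eq (by ring))⟩

/-- A bounded solution operator into a Sobolev space, from pointwise bounds. -/
theorem exists_resolventOp₂_clm (hL : 0 < L) (hk₁ : 0 < k₁) (hk : AdmissibleCoeff L k₁ k₂ k)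
    {δ : ℝ} (hδ : 0 < δ) (hδ1 : δ ≤ 1) {m : ℕ} {C : ℝ} (hC : 0 ≤ C)
    (h : ∀ g : SobolevI L 2 2, ∃ w : SobolevI L m 2,
      weakDer w 0 = weakDer (resolventOp₂ L k (δ ^ 4) (weakDer g 0)) 0 ∧ ‖w‖ ≤ C * ‖g‖) :
    ∃ T : SobolevI L 2 2 →L[ℝ] SobolevI L m 2,
      (∀ g, weakDer (T g) 0 = weakDer (resolventOp₂ L k (δ ^ 4) (weakDer g 0)) 0) ∧ ‖T‖ ≤ C := by
  choose w hw hwn using h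
  have hspec := fun g => isWeakSolution_resolventOp hL hk₁ hk (pow_pos hδ 4) 0 g
  have hadd : ∀ g g', resolventOp₂ L k (δ ^ 4) (g + g')
      = resolventOp₂ L k (δ ^ 4) g + resolventOp₂ L k (δ ^ 4) g' := fun g g' => by
    have := (hspec g).add hk₁ hk (hspec g')
    rw [add_zero] at this
    exact (hspec _).unique hL hk₁ hk hδ hδ1 this
  have hsmul : ∀ (c : ℝ) g, resolventOp₂ L k (δ ^ 4) (c • g)
      = c • resolventOp₂ L k (δ ^ 4) g := fun c g => by
    have := (hspec g).smul hk₁ hk c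
    rw [smul_zero] at this
    exact (hspec _).unique hL hk₁ hk hδ hδ1 this
  -- The chosen values form a linear map because a Sobolev tuple is determined by its entry 0, and
  -- that entry is linear by uniqueness of weak solutions.
  let T : SobolevI L 2 2 →ₗ[ℝ] SobolevI L m 2 :=
    { toFun := w
      map_add' := fun g g' => SobolevI.ext_of_weakDer_zero (by
        rw [weakDer_add, hw, hw, hw, weakDer_add, hadd, weakDer_add])
      map_smul' := fun c g => SobolevI.ext_of_weakDer_zero (by
        rw [RingHom.id_apply, weakDer_smul, hw, hw, weakDer_smul, hsmul, weakDer_smul]) }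
  exact ⟨T.mkContinuous C hwn, hw, T.mkContinuous_norm_le hC hwn⟩

end ResolventOperator

/-! ### From δ back to powers of ε -/

section FractionalPowers

variable {ε : ℝ}

theorem exists_fourth_root (hε : 0 < ε) (hε1 : ε < 1) : ∃ δ : ℝ, 0 < δ ∧ δ ≤ 1 ∧ δ ^ 4 = ε :=
  ⟨ε ^ (1 / 4 : ℝ), by positivity, Real.rpow_le_one hε.le hε1.le (by norm_num), by
    rw [← Real.rpow_natCast, ← Real.rpow_mul hε.le]; norm_num⟩

theorem pow_four_rpow {δ : ℝ} (hδ : 0 < δ) (a : ℝ) : (δ ^ 4) ^ (a / 4) = δ ^ a := by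
  rw [← Real.rpow_natCast, ← Real.rpow_mul hδ.le]
  congr 1
  push_cast
  ring

theorem pow_four_rpow_neg {δ : ℝ} (hδ : 0 < δ) (j : ℕ) :
    (δ ^ 4) ^ (-(j : ℝ) / 4) = (δ ^ j)⁻¹ := by
  rw [pow_four_rpow hδ, Real.rpow_neg hδ.le, Real.rpow_natCast]

theorem pow_four_rpow_three {δ : ℝ} (hδ : 0 < δ) : (δ ^ 4) ^ ((3 : ℝ) / 4) = δ ^ 3 := by
  rw [pow_four_rpow hδ]
  exact_mod_cast Real.rpow_natCast δ 3

theorem pow_four_rpow_one {δ : ℝ} (hδ : 0 < δ) : (δ ^ 4) ^ ((1 : ℝ) / 4) = δ := by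
  rw [pow_four_rpow hδ, Real.rpow_one]

theorem pow_four_rpow_three_sub {δ : ℝ} (hδ : 0 < δ) (j : ℕ) :
    (δ ^ 4) ^ ((3 - (j : ℝ)) / 4) = δ ^ 3 * (δ ^ j)⁻¹ := by
  rw [sub_div, Real.rpow_sub (by positivity), pow_four_rpow_three hδ, pow_four_rpow hδ,
    Real.rpow_natCast, div_eq_mul_inv]

end FractionalPowers

/-! ### Assembly of the three statements -/

theorem proposition3p2 (L k₁ k₂ : ℝ) (hL : 0 < L) (hk₁ : 0 < k₁) (hk₂ : k₁ ≤ k₂) :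
    -- the resolvent operator is well defined: it gives the unique weak solution
    (∀ (k : ℝ → ℝ) (ε : ℝ), AdmissibleCoeff L k₁ k₂ k → 0 < ε → ε < 1 →
      ∀ (f g : LebI L 2) (u : SobolevI L 2 2),
        IsWeakSolution L k ε f g u ↔ u = resolventOp L k ε f g) ∧
    -- one constant `K`, depending only on `L, k₁, k₂`, for parts (i) and (ii)
    (∃ K : ℝ, 0 < K ∧
      ∀ (k : ℝ → ℝ) (ε : ℝ), AdmissibleCoeff L k₁ k₂ k → 0 < ε → ε < 1 →
        -- (i)
        (∀ (f g : LebI L 2) (j : Fin 3),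
          ‖weakDer (resolventOp L k ε f g) j‖
            ≤ K * ε ^ (-((j : ℕ) : ℝ) / 4) * (ε ^ ((3 : ℝ) / 4) * ‖f‖ + ‖g‖)) ∧
        -- (ii)
        (∀ (q : ℝ≥0∞) [Fact (1 ≤ q)] (hq : 2 ≤ q) (j : ℕ), j ≤ 4 →
          (∀ f : SobolevI L 1 q, ∃ w : SobolevI L j q,
            (weakDer w 0 =ᵐ[intervalMeasure L]
              weakDer (resolventOp₁ L k ε (LebI.toL2 hq (weakDer f 0))) 0) ∧
            ‖w‖ ≤ K * ε ^ ((3 - (j : ℝ)) / 4)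
              * (‖weakDer f 0‖ + ε ^ ((1 : ℝ) / 4) * ‖weakDer f 1‖)) ∧
          (∀ g : LebI L q, ∃ w : SobolevI L j q,
            (weakDer w 0 =ᵐ[intervalMeasure L] weakDer (resolventOp₂ L k ε (LebI.toL2 hq g)) 0) ∧
            ‖w‖ ≤ K * ε ^ (-(j : ℝ) / 4) * ‖g‖))) ∧
    -- (iii), with a constant depending only on `L, k₁, k₂, K₁`
    (∀ K₁ : ℝ, 0 < K₁ → ∃ K' : ℝ, 0 < K' ∧
      ∀ (k : ℝ → ℝ) (ε : ℝ), AdmissibleCoeff L k₁ k₂ k → 0 < ε → ε < 1 →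
        (∃ κ : SobolevI L 2 2, (weakDer κ 0 =ᵐ[intervalMeasure L] k) ∧ ‖κ‖ ≤ K₁) →
          ∀ j : ℕ, j ≤ 2 → ∃ T : SobolevI L 2 2 →L[ℝ] SobolevI L (2 + j) 2,
            (∀ g : SobolevI L 2 2, weakDer (T g) 0 = weakDer (resolventOp₂ L k ε (weakDer g 0)) 0) ∧
            ‖T‖ ≤ K' * ε ^ (-(j : ℝ) / 4)) := by
  have hk₂' : 0 ≤ k₂ := hk₁.le.trans hk₂
  -- A common K: the first summand serves (i), the second (ii).
  refine ⟨?_, ⟨√(resolventConst L k₁) + sobolevConst L k₁ k₂, ?_, ?_⟩, ?_⟩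
  · intro k ε hk hε hε1 f g u
    obtain ⟨δ, hδ, hδ1, rfl⟩ := exists_fourth_root hε hε1
    exact isWeakSolution_iff_eq_resolventOp hL hk₁ hk hδ hδ1 f g u
  · have := sobolevConst_pos (L := L) (k₁ := k₁) hk₂'
    positivity
  · intro k ε hk hε hε1
    obtain ⟨δ, hδ, hδ1, rfl⟩ := exists_fourth_root hε hε1
    have hS := sobolevConst_pos (L := L) (k₁ := k₁) hk₂'
    have hspec := fun f g => isWeakSolution_resolventOp hL hk₁ hk (pow_pos hδ 4) f g
    refine ⟨fun f g j => ?_, fun q _ hq j hj => ⟨fun f => ?_, fun g => ?_⟩⟩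
    · rw [pow_four_rpow_neg hδ, pow_four_rpow_three hδ]
      refine ((hspec f g).norm_weakDer_le hL hk₁ hk hδ hδ1 j).trans ?_
      gcongr
      exact le_add_of_nonneg_right hS.le
    · obtain ⟨D, hD, hD'⟩ := SobolevI.exists_isPrimitiveOn hL f
      have hf2 : LebI.toL2 hq (weakDer f 0) =ᵐ[intervalMeasure L] weakDer f 0 :=
        MemLp.coeFn_toLp _
      have z := Lp.coeFn_zero ℝ 2 (intervalMeasure L)
      obtain ⟨w, hw, hwn⟩ := (hspec (LebI.toL2 hq (weakDer f 0)) 0).exists_sobolevI hL hk₁ hk₂' hk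
        hδ hδ1 (hD' 0) (hf2.trans (hD 0)) hq
        ((memLp_congr_ae z).2 MemLp.zero) ((memLp_congr_ae (hD 1)).1 (Lp.memLp _)) hj
      refine ⟨w, hw, hwn.trans ?_⟩
      have e1 : eLpNorm (D (Fin.succ 0)) q (intervalMeasure L)
          = eLpNorm (weakDer f 1) q (intervalMeasure L) := eLpNorm_congr_ae (hD 1).symm
      rw [eLpNorm_congr_ae z, eLpNorm_zero, eLpNorm_congr_ae hf2, e1, ENNReal.toReal_zero, zero_add,
        ← Lp.norm_def, ← Lp.norm_def, pow_four_rpow_three_sub hδ, pow_four_rpow_one hδ]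
      calc sobolevConst L k₁ k₂ * (δ ^ j)⁻¹ * (δ ^ 3 * ‖weakDer f 0‖ + δ ^ 4 * ‖weakDer f 1‖)
          = sobolevConst L k₁ k₂ *
              (δ ^ 3 * (δ ^ j)⁻¹) * (‖weakDer f 0‖ + δ * ‖weakDer f 1‖) := by ring
        _ ≤ _ := by
          gcongr
          exact le_add_of_nonneg_left (Real.sqrt_nonneg _)
    · have hg2 : LebI.toL2 hq g =ᵐ[intervalMeasure L] g := MemLp.coeFn_toLp _
      have z := Lp.coeFn_zero ℝ 2 (intervalMeasure L)
      obtain ⟨w, hw, hwn⟩ := (hspec 0 (LebI.toL2 hq g)).exists_sobolevI hL hk₁ hk₂' hk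
        hδ hδ1 (IsPrimitiveOn.const hL.le 0) z hq
        ((memLp_congr_ae hg2).2 (Lp.memLp g)) MemLp.zero' hj
      refine ⟨w, hw, hwn.trans ?_⟩
      rw [eLpNorm_congr_ae z, eLpNorm_congr_ae hg2, eLpNorm_zero, eLpNorm_zero',
        ENNReal.toReal_zero, mul_zero, mul_zero, add_zero, add_zero, ← Lp.norm_def,
        pow_four_rpow_neg hδ]
      gcongr
      exact le_add_of_nonneg_left (Real.sqrt_nonneg _)
  · intro K₁ _
    have hS := smoothConst_pos (k₂ := k₂) hL hk₁ K₁
    refine ⟨5 * √(smoothConst L k₁ k₂ K₁), by positivity, ?_⟩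
    rintro k ε hk hε hε1 ⟨κ, hκ, hκn⟩ j hj
    obtain ⟨δ, hδ, hδ1, rfl⟩ := exists_fourth_root hε hε1
    rw [pow_four_rpow_neg hδ]
    exact exists_resolventOp₂_clm hL hk₁ hk hδ hδ1 (by positivity)
      (exists_sobolevI_of_smooth hL hk₁ hk hκ hκn hδ hδ1 hj)
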